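/- Let $1<B<2$ and $0<\kappa<\min(B^2/4,\,1/2)$. For $i,j\in\mathbb N=\{1,2,\dots\}$ let $d(i,j)$ be the least $p\ge 0$ such that $i$ and $j$ lie in a common block $\{(k-1)2^p+1,\dots,k2^p\}$, $k\ge1$. Let $\omega=(\omega_i)_{i\ge1}$ be a centered Gaussian sequence with $\mathbb E[\omega_i\omega_j]=\kappa^{d(i,j)}$. For $\beta\ge0$ and $h\in\mathbb R$ set $Z_0^{(i)}=e^{\beta\omega_i+h}$ and $$Z_{n+1}^{(i)}=\frac{Z_n^{(2i-1)}Z_n^{(2i)}+B-1}{B},\qquad Z_{n,h}^\omega:=Z_n^{(1)},$$ and define the quenched and annealed free energies $$F(\beta,h)=\lim_{n\to\infty}2^{-n}\,\mathbb E[\log Z_{n,h}^\omega],\qquad F^a(\beta,h)=\lim_{n\to\infty}2^{-n}\log\mathbb E[Z_{n,h}^\omega],$$ and the annealed critical point $h_c^a=h_c^a(\beta)=\sup\{h: F^a(\beta,h)=0\}$. Put $\nu=\log 2/\log(2/B)$. These quantities are well defined: for all $\beta\ge0$ and $h\in\mathbb R$ the variables $Z_{n,h}^\omega$ and $\log Z_{n,h}^\omega$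 are integrable, both limits exist and are finite, $F^a(\beta,h)=0$ if $h\le h_c^a(\beta)$, and $F^a(\beta,h)>0$ if $h>h_c^a(\beta)$. Moreover, with constants that may depend on $B$ and $\kappa$: 1. If $B>\sqrt2$, there is $\beta_0>0$ such that for every $\eta\in(0,1)$ there is $\varepsilon=\varepsilon(\eta)>0$ such that for all $\beta\in[0,\beta_0]$ and all $u\in(0,\varepsilon)$ $$F(\beta,h_c^a+u)\ \ge\ (1-\eta)\,F^a(\beta,h_c^a+u).\qquad(*)$$ 2. If $B<\sqrt2$, then for every $\eta\in(0,1)$ there are $c,\beta_0,\varepsilon>0$ such that $(*)$ holds for all $\beta\in[0,\beta_0]$ and all $u\in\bigl(c\,\beta^{2/(2-\nu)},\,\varepsilon\bigr)$. 3. If $B=\sqrt2$, then for every $\eta\in(0,1)$ there are $\beta_0>0$ and $c>0$ such that $(*)$ holds for all $\beta\in(0,\beta_0]$ and all $u\in\bigl(c\exp(-c\,\beta^{-2/3}),\,1\bigr)$. -/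

import Mathlib

open Real Filter Topology MeasureTheory ProbabilityTheory

namespace HierPinning

noncomputable section

/-- Any two indices lie in a common dyadic block. -/
theorem exists_common_block (i j : ℕ) : ∃ p : ℕ, i / 2 ^ p = j / 2 ^ p := by
  refine ⟨i + j, ?_⟩
  have h : i + j < 2 ^ (i + j) := Nat.lt_two_pow_self
  rw [Nat.div_eq_of_lt (by omega), Nat.div_eq_of_lt (by omega)]

/-- Hierarchical (binary tree) distance on `ℕ`. The sites are numbered from `0`, so that the
dyadic blocks of size `2 ^ p` are `{k * 2 ^ p, …, (k + 1) * 2 ^ p - 1}` and the block of `i` has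
number `i / 2 ^ p`; the distance of `i` and `j` is the least `p` such that `i` and `j` are in the
same block of size `2 ^ p`. -/
def hierDist (i j : ℕ) : ℕ := Nat.find (exists_common_block i j)

/-- The disorder: a centered Gaussian sequence `ω` (all finite-dimensional marginals are Gaussian)
with covariances `E[ω i * ω j] = κ ^ d(i, j)`, where `d` is the hierarchical distance. -/
structure IsHierGaussian {Ω : Type*} [MeasurableSpace Ω] (κ : ℝ) (P : Measure Ω)
    (ω : ℕ → Ω → ℝ) : Prop where
  gaussian : IsGaussianProcess ω P
  centered : ∀ i, ∫ a, ω i a ∂P = 0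
  covariance : ∀ i j, ∫ a, ω i a * ω j a ∂P = κ ^ hierDist i j

/-- Partition function `Z_n^{(i)}` on the `i`-th block of size `2 ^ n` (blocks numbered from `0`)
in the environment `x`. -/
def blockZ (B β h : ℝ) (x : ℕ → ℝ) : ℕ → ℕ → ℝ
  | 0, i => exp (β * x i + h)
  | n + 1, i => (blockZ B β h x n (2 * i) * blockZ B β h x n (2 * i + 1) + B - 1) / B

/-- Partition function of the system of size `2 ^ n`, as a random variable. -/
def partZ {Ω : Type*} (B β h : ℝ) (ω : ℕ → Ω → ℝ) (n : ℕ) (a : Ω) : ℝ :=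
  blockZ B β h (fun i => ω i a) n 0

variable {Ω : Type*} [MeasurableSpace Ω]

/-- Quenched finite-volume free energy `2 ^ (-n) * E[log Z_n]`. -/
def quenchedF_n (B : ℝ) (P : Measure Ω) (ω : ℕ → Ω → ℝ) (β h : ℝ) (n : ℕ) : ℝ :=
  (1 / 2 ^ n) * ∫ a, log (partZ B β h ω n a) ∂P

/-- Annealed finite-volume free energy `2 ^ (-n) * log E[Z_n]`. -/
def annealedF_n (B : ℝ) (P : Measure Ω) (ω : ℕ → Ω → ℝ) (β h : ℝ) (n : ℕ) : ℝ :=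
  (1 / 2 ^ n) * log (∫ a, partZ B β h ω n a ∂P)

/-- Quenched free energy. -/
def quenchedF (B : ℝ) (P : Measure Ω) (ω : ℕ → Ω → ℝ) (β h : ℝ) : ℝ :=
  limUnder atTop (quenchedF_n B P ω β h)

/-- Annealed free energy. -/
def annealedF (B : ℝ) (P : Measure Ω) (ω : ℕ → Ω → ℝ) (β h : ℝ) : ℝ :=
  limUnder atTop (annealedF_n B P ω β h)

/-- Annealed critical point: the threshold of `h` up to which the annealed free energy vanishes. -/
def annealedHc (B : ℝ) (P : Measure Ω) (ω : ℕ → Ω → ℝ) (β : ℝ) : ℝ :=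
  sSup {h : ℝ | annealedF B P ω β h = 0}

/-- Critical exponent of the homogeneous model. -/
def pureNu (B : ℝ) : ℝ := log 2 / log (2 / B)

end

end HierPinning

/-! The disorder behaves like a sum of independent Gaussian fields, one per dyadic block, a block of
size `2 ^ n` contributing variance `(1 - κ) * κ ^ n`. Integrating out only the fields inside a block
turns the moments of its partition function into polynomials in `e ^ h`, and smoothing by a shared
field of variance `s` multiplies the coefficient of `e ^ (k h)` by `exp (s k ^ 2 / 2)`. Mean
(`annPoly`) and variance (`varPoly`) thus obey deterministic recursions with nonnegative
coefficients (`rep_blockZ`, `rep_blockZ_sq`).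

At the annealed critical point the mean recursion is a perturbation of `x ↦ (x ^ 2 + B - 1) / B` at
its repelling fixed point `1`, of multiplier `2 / B`. The smoothing at level `n` moves it by `O(β ^
2 * q ^ n)`, where `q = corrRate B κ < 1` by the two bounds on `κ`. Hence at distance `u` from
criticality the mean leaves the neighbourhood of `1` at a level `i` with `u` of order `(B / 2) ^ i`.
The difficulty is that `exp (s k ^ 2 / 2)` is not close to `1` for `k` near `2 ^ n`. Such `k` carry
little mass: at distance `(B / 2) ^ i` the polynomial is at most `exp (O(2 ^ (n - i)))`, which
forces decay of the coefficients (`exists_gaussian_weight_bound`). This yields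
`exists_crit_control`.

Near criticality the variance is multiplied by about `2 / B ^ 2` per level, so it is `O(β ^ 2 * (2 /
B ^ 2) ^ i)` as long as `β ^ 2 * ∑ (2 / B ^ 2) ^ j` stays small (`exists_variance_control`). A
number of further levels depending only on `η` makes the mean exceed a large constant while the
variance is still below `η / 8`. A second moment inequality for the logarithm then bounds `E log Z`
below by `(1 - η / 2) * log E Z` minus a constant, superadditivity carries this to the quenched free
energy, and the annealed free energy is bounded above at the same level (`exists_comparison`).

The three cases correspond to a geometric sum of ratio `2 / B ^ 2` below, above or equal to `1`.
Since `2 / B ^ 2 = (2 / B) ^ (2 - ν)`, the factor `(2 / B ^ 2) ^ i` is of order `u ^ (-(2 - ν))`,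
whence the threshold `β ^ (2 / (2 - ν))` in the second case. -/

namespace HierPinning

/-! ### Exponential polynomials and their Gaussian smoothing. -/

noncomputable section

open Polynomial

/-- The linear functional `p ↦ ∑ k, p_k * w k` on polynomials. -/
def wsum (w : ℕ → ℝ) : ℝ[X] →ₗ[ℝ] ℝ := Polynomial.lsum fun k => w k • LinearMap.id

theorem wsum_apply (w : ℕ → ℝ) (p : ℝ[X]) : wsum w p = ∑ k ∈ p.support, p.coeff k * w k := by
  simp [wsum, Polynomial.lsum_apply, Polynomial.sum_def, mul_comm]

@[simp] theorem wsum_monomial (w : ℕ → ℝ) (k : ℕ) (c : ℝ) : wsum w (monomial k c) = c * w k := by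
  simp [wsum, Polynomial.lsum_apply, mul_comm]

/-- Gaussian smoothing of exponential polynomials: the action of `x ↦ x + N(0, s)` on
polynomials in `e ^ x`. -/
def heat (s : ℝ) : ℝ[X] →ₗ[ℝ] ℝ[X] :=
  Polynomial.lsum fun k => exp (s * (k : ℝ) ^ 2 / 2) • monomial k

@[simp] theorem heat_monomial (s : ℝ) (k : ℕ) (c : ℝ) :
    heat s (monomial k c) = monomial k (exp (s * (k : ℝ) ^ 2 / 2) * c) := by
  simp [heat, Polynomial.lsum_apply, smul_monomial]

theorem coeff_heat (s : ℝ) (p : ℝ[X]) (k : ℕ) :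
    (heat s p).coeff k = exp (s * (k : ℝ) ^ 2 / 2) * p.coeff k := by
  induction p using Polynomial.induction_on' with
  | add p q hp hq => simp [hp, hq, mul_add]
  | monomial n a =>
    rw [heat_monomial, coeff_monomial, coeff_monomial]
    split_ifs with h <;> simp [h]

theorem natDegree_heat_le (s : ℝ) (p : ℝ[X]) : (heat s p).natDegree ≤ p.natDegree := by
  refine natDegree_le_iff_coeff_eq_zero.2 fun k hk => ?_
  rw [coeff_heat, coeff_eq_zero_of_natDegree_lt (by exact_mod_cast hk), mul_zero]

theorem wsum_heat (w : ℕ → ℝ) (s : ℝ) (p : ℝ[X]) :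
    wsum w (heat s p) = wsum (fun k => exp (s * (k : ℝ) ^ 2 / 2) * w k) p := by
  induction p using Polynomial.induction_on' with
  | add p q hp hq => simp [hp, hq]
  | monomial n a => simp; ring

theorem wsum_mul (w : ℕ → ℝ) (p q : ℝ[X]) :
    wsum w (p * q) = wsum (fun k => wsum (fun l => w (k + l)) q) p := by
  induction p using Polynomial.induction_on' with
  | add p q hp hq => simp [hp, hq, add_mul]
  | monomial n a =>
    induction q using Polynomial.induction_on' with
    | add p q hp hq => simp only [mul_add, map_add, hp, hq]; simp [mul_add]
    | monomial m b => simp [monomial_mul_monomial]; ring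

theorem wsum_add_right (w w' : ℕ → ℝ) (p : ℝ[X]) :
    wsum (fun k => w k + w' k) p = wsum w p + wsum w' p := by
  simp [wsum_apply, mul_add, Finset.sum_add_distrib]

theorem wsum_sub_right (w w' : ℕ → ℝ) (p : ℝ[X]) :
    wsum (fun k => w k - w' k) p = wsum w p - wsum w' p := by
  simp [wsum_apply, mul_sub, Finset.sum_sub_distrib]

theorem wsum_const_mul (c : ℝ) (w : ℕ → ℝ) (p : ℝ[X]) :
    wsum (fun k => c * w k) p = c * wsum w p := by
  simp only [wsum_apply, Finset.mul_sum]
  exact Finset.sum_congr rfl fun k _ => by ring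

theorem wsum_sum {ι : Type*} (s : Finset ι) (w : ι → ℕ → ℝ) (p : ℝ[X]) :
    wsum (fun k => ∑ i ∈ s, w i k) p = ∑ i ∈ s, wsum (w i) p := by
  simp only [wsum_apply, Finset.mul_sum]
  exact Finset.sum_comm

/-- Evaluation at `e ^ x`. -/
def ev (p : ℝ[X]) (x : ℝ) : ℝ := p.eval (exp x)

theorem ev_eq_wsum (p : ℝ[X]) (x : ℝ) : ev p x = wsum (fun k => exp (k * x)) p := by
  rw [ev, wsum_apply, eval_eq_sum, Polynomial.sum_def]
  refine Finset.sum_congr rfl fun k _ => ?_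
  rw [← exp_nat_mul]

theorem ev_heat (s : ℝ) (p : ℝ[X]) (x : ℝ) :
    ev (heat s p) x = wsum (fun k => exp (s * (k : ℝ) ^ 2 / 2) * exp (k * x)) p := by
  rw [ev_eq_wsum, wsum_heat]

@[simp] theorem ev_add (p q : ℝ[X]) (x : ℝ) : ev (p + q) x = ev p x + ev q x := by simp [ev]
@[simp] theorem ev_sub (p q : ℝ[X]) (x : ℝ) : ev (p - q) x = ev p x - ev q x := by simp [ev]
@[simp] theorem ev_mul (p q : ℝ[X]) (x : ℝ) : ev (p * q) x = ev p x * ev q x := by simp [ev]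
@[simp] theorem ev_pow (p : ℝ[X]) (n : ℕ) (x : ℝ) : ev (p ^ n) x = ev p x ^ n := by simp [ev]
@[simp] theorem ev_C (c x : ℝ) : ev (C c) x = c := by simp [ev]
@[simp] theorem ev_X (x : ℝ) : ev X x = exp x := by simp [ev]
@[simp] theorem ev_zero (x : ℝ) : ev 0 x = 0 := by simp [ev]

theorem continuous_ev (p : ℝ[X]) : Continuous (ev p) := p.continuous.comp continuous_exp

/-- Polynomials with nonnegative coefficients. -/
def NonnegCoeff (p : ℝ[X]) : Prop := ∀ k, 0 ≤ p.coeff k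

namespace NonnegCoeff

variable {p q : ℝ[X]}

theorem add (hp : NonnegCoeff p) (hq : NonnegCoeff q) : NonnegCoeff (p + q) := fun k => by
  rw [coeff_add]; exact add_nonneg (hp k) (hq k)

theorem mul (hp : NonnegCoeff p) (hq : NonnegCoeff q) : NonnegCoeff (p * q) := fun k => by
  rw [coeff_mul]; exact Finset.sum_nonneg fun i _ => mul_nonneg (hp _) (hq _)

theorem heat (hp : NonnegCoeff p) (s : ℝ) : NonnegCoeff (heat s p) := fun k => by
  rw [coeff_heat]; exact mul_nonneg (exp_nonneg _) (hp k)

theorem const {c : ℝ} (hc : 0 ≤ c) : NonnegCoeff (C c) := fun k => by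
  rw [coeff_C]; split_ifs <;> simp [hc]

theorem X : NonnegCoeff (X : ℝ[X]) := fun k => by
  rw [coeff_X]; split_ifs <;> simp

theorem zero : NonnegCoeff (0 : ℝ[X]) := fun k => by simp

theorem wsum_le (hp : NonnegCoeff p) {w w' : ℕ → ℝ} (h : ∀ k ≤ p.natDegree, w k ≤ w' k) :
    wsum w p ≤ wsum w' p := by
  rw [wsum_apply, wsum_apply]
  exact Finset.sum_le_sum fun k hk =>
    mul_le_mul_of_nonneg_left (h k (le_natDegree_of_mem_supp k hk)) (hp k)

theorem wsum_nonneg (hp : NonnegCoeff p) {w : ℕ → ℝ} (h : ∀ k, 0 ≤ w k) : 0 ≤ wsum w p := by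
  rw [wsum_apply]
  exact Finset.sum_nonneg fun k _ => mul_nonneg (hp k) (h k)

theorem ev_nonneg (hp : NonnegCoeff p) (x : ℝ) : 0 ≤ ev p x := by
  rw [ev_eq_wsum]; exact hp.wsum_nonneg fun k => exp_nonneg _

theorem ev_mono (hp : NonnegCoeff p) : Monotone (ev p) := fun x y hxy => by
  rw [ev_eq_wsum, ev_eq_wsum]
  exact hp.wsum_le fun k _ => by gcongr

theorem ev_le_ev_heat (hp : NonnegCoeff p) {s : ℝ} (hs : 0 ≤ s) (x : ℝ) :
    ev p x ≤ ev (HierPinning.heat s p) x := by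
  rw [ev_heat, ev_eq_wsum]
  refine hp.wsum_le fun k _ => le_mul_of_one_le_left (exp_nonneg _) (one_le_exp (by positivity))

end NonnegCoeff

/-- The gap between the smoothing of a square and the square of the smoothing. -/
def heatVar (s : ℝ) (p : ℝ[X]) : ℝ[X] := heat s (p ^ 2) - heat s p ^ 2

/-- The convolution sums compare termwise because `(k + l) ^ 2 ≥ k ^ 2 + l ^ 2` for nonnegative
degrees. -/
theorem NonnegCoeff.heatVar {p : ℝ[X]} (hp : NonnegCoeff p) {s : ℝ} (hs : 0 ≤ s) :
    NonnegCoeff (heatVar s p) := fun k => by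
  rw [HierPinning.heatVar, coeff_sub, coeff_heat, pow_two p, pow_two (HierPinning.heat s p), coeff_mul,
    coeff_mul, sub_nonneg,
    Finset.mul_sum]
  refine Finset.sum_le_sum fun ij hij => ?_
  rw [Finset.HasAntidiagonal.mem_antidiagonal] at hij
  rw [coeff_heat, coeff_heat, mul_mul_mul_comm, ← exp_add]
  refine mul_le_mul_of_nonneg_right (exp_le_exp.2 ?_) (mul_nonneg (hp _) (hp _))
  rw [← hij]; push_cast
  nlinarith [mul_nonneg hs (mul_nonneg (Nat.cast_nonneg (α := ℝ) ij.1)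
    (Nat.cast_nonneg (α := ℝ) ij.2))]

/-- Over pairs of degrees, smoothing the product exceeds the product of smoothings by the factor
`exp (s k l)`. The inequality `e ^ z - 1 ≤ z e ^ z` extracts `s k l`, and `s k l ≤ s (k ^ 2 + l ^ 2)
/ 2` separates the variables, which leaves a perfect square. -/
theorem ev_heatVar_le {p : ℝ[X]} (hp : NonnegCoeff p) {s : ℝ} (hs : 0 ≤ s) (x : ℝ) :
    ev (heatVar s p) x ≤ s * (wsum (fun k => k * (exp (s * (k : ℝ) ^ 2) * exp (k * x))) p) ^ 2 := by
  have key : ∀ w : ℕ → ℝ, wsum w p ^ 2 = wsum (fun k => wsum (fun l => w k * w l) p) p := by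
    intro w
    rw [pow_two, ← wsum_const_mul]
    congr 2; ext k
    rw [wsum_const_mul, mul_comm]
  rw [heatVar, ev_sub, ev_heat, pow_two, wsum_mul, ev_pow, ev_heat, key, key, ← wsum_sub_right,
    ← wsum_const_mul]
  refine hp.wsum_le fun k _ => ?_
  rw [← wsum_sub_right, ← wsum_const_mul]
  refine hp.wsum_le fun l _ => ?_
  set a : ℝ := (k : ℝ)
  set b : ℝ := (l : ℝ)
  have ha : 0 ≤ a := Nat.cast_nonneg k
  have hb : 0 ≤ b := Nat.cast_nonneg l
  have h1 : ∀ z : ℝ, exp z - 1 ≤ z * exp z := fun z => by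
    have := add_one_le_exp (-z)
    rw [exp_neg] at this
    have h2 := exp_pos z
    have h3 : (-z + 1) * exp z ≤ (exp z)⁻¹ * exp z := mul_le_mul_of_nonneg_right this h2.le
    rw [inv_mul_cancel₀ h2.ne'] at h3
    linarith
  have e1 : exp (s * ((k + l : ℕ) : ℝ) ^ 2 / 2) * exp ((k + l : ℕ) * x) =
      exp (s * a * b) *
        (exp (s * a ^ 2 / 2) * exp (a * x) * (exp (s * b ^ 2 / 2) * exp (b * x))) := by
    rw [← exp_add, ← exp_add, ← exp_add, ← exp_add, ← exp_add]
    congr 1; push_cast; ring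
  have e2 : s * (a * (exp (s * a ^ 2) * exp (a * x)) * (b * (exp (s * b ^ 2) * exp (b * x)))) =
      s * a * b * exp (s * a ^ 2 / 2 + s * b ^ 2 / 2) *
        (exp (s * a ^ 2 / 2) * exp (a * x) * (exp (s * b ^ 2 / 2) * exp (b * x))) := by
    have : exp (s * a ^ 2) = exp (s * a ^ 2 / 2) * exp (s * a ^ 2 / 2) := by
      rw [← exp_add]; congr 1; ring
    have h' : exp (s * b ^ 2) = exp (s * b ^ 2 / 2) * exp (s * b ^ 2 / 2) := by
      rw [← exp_add]; congr 1; ring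
    rw [this, h', exp_add]; ring
  rw [e1, e2, ← sub_one_mul]
  refine mul_le_mul_of_nonneg_right ((h1 _).trans ?_) (by positivity)
  refine mul_le_mul_of_nonneg_left (exp_le_exp.2 ?_) (by positivity)
  nlinarith [mul_nonneg hs (sq_nonneg (a - b))]

end

end HierPinning

/-! ### Laws and exponential moments of the disorder; the hierarchical distance. -/

namespace HierPinning

noncomputable section

namespace IsHierGaussian

variable {Ω : Type*} [MeasurableSpace Ω] {P : Measure Ω} {ω : ℕ → Ω → ℝ} {κ : ℝ} {ι : Type*}

theorem hasGaussianLaw_sum (hω : IsHierGaussian κ P ω) (f : ι → ℕ) (c : ι → ℝ) (I : Finset ι) :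
    HasGaussianLaw (fun a => ∑ i ∈ I, c i * ω (f i) a) P := by
  simpa using ((hω.gaussian.comp_right f).smul c).hasGaussianLaw_fun_sum (I := I)

theorem integral_sum (hω : IsHierGaussian κ P ω) (f : ι → ℕ) (c : ι → ℝ) (I : Finset ι) :
    ∫ a, ∑ i ∈ I, c i * ω (f i) a ∂P = 0 := by
  rw [integral_finsetSum]
  · exact Finset.sum_eq_zero fun i _ => by rw [integral_const_mul, hω.centered, mul_zero]
  · exact fun i _ => ((hω.gaussian.hasGaussianLaw_eval _).integrable).const_mul _

theorem variance_sum (hω : IsHierGaussian κ P ω) (f : ι → ℕ) (c : ι → ℝ) (I : Finset ι) :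
    Var[fun a => ∑ i ∈ I, c i * ω (f i) a; P] =
      ∑ i ∈ I, ∑ j ∈ I, c i * c j * κ ^ hierDist (f i) (f j) := by
  have hint : ∀ i j, Integrable (fun a => ω i a * ω j a) P := fun i j =>
    (hω.gaussian.hasGaussianLaw_eval i).memLp_two.integrable_mul
      (hω.gaussian.hasGaussianLaw_eval j).memLp_two
  have hmul : ∀ i j, Integrable (fun a => c i * ω (f i) a * (c j * ω (f j) a)) P := fun i j =>
    ((hint (f i) (f j)).const_mul (c i * c j)).congr (Eventually.of_forall fun a => by
      change c i * c j * (ω (f i) a * ω (f j) a) = _; ring)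
  rw [variance_of_integral_eq_zero (hω.hasGaussianLaw_sum f c I).aemeasurable
    (hω.integral_sum f c I)]
  simp only [pow_two, Finset.sum_mul_sum]
  rw [integral_finsetSum _ fun i _ => integrable_finsetSum _ fun j _ => hmul i j]
  refine Finset.sum_congr rfl fun i _ => ?_
  rw [integral_finsetSum _ fun j _ => hmul i j]
  refine Finset.sum_congr rfl fun j _ => ?_
  rw [← hω.covariance, ← integral_const_mul]
  exact integral_congr_ae (Eventually.of_forall fun a => by
    change c i * ω (f i) a * (c j * ω (f j) a) = c i * c j * (ω (f i) a * ω (f j) a); ring)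

/-- A centered Gaussian vector is determined by the variances of its linear functionals, and these
depend on the sites only through their distances. -/
theorem map_eq (hω : IsHierGaussian κ P ω) [Fintype ι] (f g : ι → ℕ)
    (hfg : ∀ i j, hierDist (f i) (f j) = hierDist (g i) (g j)) :
    P.map (fun a i => ω (f i) a) = P.map (fun a i => ω (g i) a) := by
  classical
  have := hω.gaussian.isProbabilityMeasure
  have hlaw : ∀ f : ι → ℕ, HasGaussianLaw (fun a (i : ι) => ω (f i) a) P := fun f => by
    let L : (↥(Finset.univ : Finset ι) → ℝ) →L[ℝ] (ι → ℝ) :=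
      { toFun := fun x i => x ⟨i, Finset.mem_univ i⟩
        map_add' := fun x y => rfl
        map_smul' := fun c x => rfl }
    exact ((hω.gaussian.comp_right f).hasGaussianLaw Finset.univ).map L
  have hdual : ∀ (L : StrongDual ℝ (ι → ℝ)) (x : ι → ℝ),
      L x = ∑ i, L (Pi.single i 1) * x i := fun L x => by
    conv_lhs => rw [pi_eq_sum_univ' x]
    simp [mul_comm]
  have := (hlaw f).isGaussian_map
  have := (hlaw g).isGaussian_map
  refine Measure.ext_of_charFunDual ?_
  ext L
  rw [(hlaw f).charFunDual_map_eq_fun, (hlaw g).charFunDual_map_eq_fun]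
  have hrw : ∀ f : ι → ℕ, (fun a => L fun i => ω (f i) a) =
      fun a => ∑ i, L (Pi.single i 1) * ω (f i) a := fun f => funext fun a => hdual L _
  rw [hrw f, hrw g, hω.integral_sum f _ _, hω.integral_sum g _ _, hω.variance_sum f _ _,
    hω.variance_sum g _ _]
  simp only [hfg]

theorem map_sum (hω : IsHierGaussian κ P ω) (c : ℕ → ℝ) (I : Finset ℕ) :
    P.map (fun a => ∑ i ∈ I, c i * ω i a) =
      gaussianReal 0 (∑ i ∈ I, ∑ j ∈ I, c i * c j * κ ^ hierDist i j).toNNReal := by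
  rw [(hω.hasGaussianLaw_sum (fun i => i) c I).map_eq_gaussianReal,
    hω.integral_sum (fun i => i) c I,
    hω.variance_sum (fun i => i) c I]

theorem variance_nonneg (hω : IsHierGaussian κ P ω) (c : ℕ → ℝ) (I : Finset ℕ) :
    0 ≤ ∑ i ∈ I, ∑ j ∈ I, c i * c j * κ ^ hierDist i j := by
  rw [← hω.variance_sum (fun i => i) c I]; exact ProbabilityTheory.variance_nonneg _ _

theorem integrable_exp_sum (hω : IsHierGaussian κ P ω) (c : ℕ → ℝ) (I : Finset ℕ) :
    Integrable (fun a => exp (∑ i ∈ I, c i * ω i a)) P := by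
  have h := integrable_exp_mul_gaussianReal (μ := 0)
    (v := (∑ i ∈ I, ∑ j ∈ I, c i * c j * κ ^ hierDist i j).toNNReal) 1
  rw [← hω.map_sum, integrable_map_measure (by fun_prop)
    (hω.hasGaussianLaw_sum (fun i => i) c I).aemeasurable] at h
  simpa [Function.comp_def] using h

theorem integral_exp_sum (hω : IsHierGaussian κ P ω) (c : ℕ → ℝ) (I : Finset ℕ) :
    ∫ a, exp (∑ i ∈ I, c i * ω i a) ∂P =
      exp ((∑ i ∈ I, ∑ j ∈ I, c i * c j * κ ^ hierDist i j) / 2) := by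
  have h := mgf_gaussianReal (hω.map_sum c I) 1
  simpa [mgf, hω.variance_nonneg c I] using h

/-- Sum of the covariances over two families of sites. -/
def _root_.HierPinning.covSum (κ : ℝ) (s t : Multiset ℕ) : ℝ :=
  (s.map fun i => (t.map fun j => κ ^ hierDist i j).sum).sum

theorem multiset_sum_eq (s : Multiset ℕ) (x : ℕ → ℝ) :
    (s.map x).sum = ∑ i ∈ s.toFinset, (s.count i : ℝ) * x i := by
  rw [Finset.sum_multiset_map_count]; simp

theorem integrable_exp_multiset (hω : IsHierGaussian κ P ω) (β h : ℝ) (s : Multiset ℕ) :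
    Integrable (fun a => exp ((s.map fun i => β * ω i a + h).sum)) P := by
  refine ((hω.integrable_exp_sum (fun i => β * s.count i) s.toFinset).const_mul
    (exp (s.card * h))).congr (Eventually.of_forall fun a => ?_)
  simp only
  rw [← exp_add, Multiset.sum_map_add, Multiset.sum_map_mul_left, multiset_sum_eq, Finset.mul_sum]
  simp [mul_assoc, add_comm]

theorem integral_exp_multiset (hω : IsHierGaussian κ P ω) (β h : ℝ) (s : Multiset ℕ) :
    ∫ a, exp ((s.map fun i => β * ω i a + h).sum) ∂P =
      exp (s.card * h + β ^ 2 * covSum κ s s / 2) := by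
  have key : ∀ a, exp ((s.map fun i => β * ω i a + h).sum) =
      exp (s.card * h) * exp (∑ i ∈ s.toFinset, (β * s.count i) * ω i a) := fun a => by
    rw [← exp_add, Multiset.sum_map_add, Multiset.sum_map_mul_left, multiset_sum_eq,
      Finset.mul_sum]
    simp [mul_assoc, add_comm]
  simp only [key]
  rw [integral_const_mul, hω.integral_exp_sum, ← exp_add]
  congr 3
  rw [covSum, multiset_sum_eq, Finset.mul_sum]
  refine Finset.sum_congr rfl fun i _ => ?_
  rw [multiset_sum_eq, Finset.mul_sum, Finset.mul_sum]
  exact Finset.sum_congr rfl fun j _ => by ring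

end IsHierGaussian

theorem hierDist_le_iff {i j n : ℕ} : hierDist i j ≤ n ↔ i / 2 ^ n = j / 2 ^ n := by
  constructor
  · intro h
    have h0 : i / 2 ^ hierDist i j = j / 2 ^ hierDist i j := Nat.find_spec (exists_common_block i j)
    obtain ⟨d, rfl⟩ := Nat.exists_eq_add_of_le h
    rw [pow_add, ← Nat.div_div_eq_div_mul, ← Nat.div_div_eq_div_mul, h0]
  · exact fun h => Nat.find_min' _ h

theorem hierDist_comm (i j : ℕ) : hierDist i j = hierDist j i :=
  le_antisymm (hierDist_le_iff.2 (hierDist_le_iff.1 le_rfl).symm)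
    (hierDist_le_iff.2 (hierDist_le_iff.1 le_rfl).symm)

/-- Covariances across the two halves of a block are constant, so they depend on two families of
sites only through their cardinalities. This is what closes the recursion on polynomials. -/
theorem hierDist_sibling {i j k n : ℕ} (hi : i / 2 ^ n = 2 * k) (hj : j / 2 ^ n = 2 * k + 1) :
    hierDist i j = n + 1 := by
  refine le_antisymm (hierDist_le_iff.2 ?_) (not_lt.1 fun h => ?_)
  · rw [pow_succ, ← Nat.div_div_eq_div_mul, ← Nat.div_div_eq_div_mul, hi, hj]; omega
  · have := hierDist_le_iff.1 (Nat.lt_succ_iff.1 h)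
    omega

theorem hierDist_shift {i j n : ℕ} (hi : i < 2 ^ n) (hj : j < 2 ^ n) :
    hierDist (i + 2 ^ n) (j + 2 ^ n) = hierDist i j := by
  have hn : (hierDist i j) ≤ n := hierDist_le_iff.2 (by
    rw [Nat.div_eq_of_lt hi, Nat.div_eq_of_lt hj])
  have hn' : (hierDist (i + 2 ^ n) (j + 2 ^ n)) ≤ n := hierDist_le_iff.2 (by
    rw [Nat.add_div_right _ (by positivity), Nat.add_div_right _ (by positivity),
      Nat.div_eq_of_lt hi, Nat.div_eq_of_lt hj])
  have key : ∀ p ≤ n, ((i + 2 ^ n) / 2 ^ p = (j + 2 ^ n) / 2 ^ p ↔ i / 2 ^ p = j / 2 ^ p) := by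
    intro p hp
    obtain ⟨d, rfl⟩ := Nat.exists_eq_add_of_le hp
    rw [pow_add, Nat.add_mul_div_left _ _ (by positivity), Nat.add_mul_div_left _ _ (by positivity)]
    omega
  exact le_antisymm (hierDist_le_iff.2 ((key _ hn).2 (hierDist_le_iff.1 le_rfl)))
    (hierDist_le_iff.2 ((key _ hn').1 (hierDist_le_iff.1 le_rfl)))

theorem covSum_add_left (κ : ℝ) (s s' t : Multiset ℕ) :
    covSum κ (s + s') t = covSum κ s t + covSum κ s' t := by simp [covSum]

theorem covSum_add_right (κ : ℝ) (s t t' : Multiset ℕ) :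
    covSum κ s (t + t') = covSum κ s t + covSum κ s t' := by simp [covSum]

theorem covSum_eq_of_forall {κ : ℝ} {n : ℕ} {s t : Multiset ℕ}
    (h : ∀ i ∈ s, ∀ j ∈ t, hierDist i j = n) : covSum κ s t = s.card * t.card * κ ^ n := by
  have h1 : ∀ i ∈ s, (t.map fun j => κ ^ hierDist i j).sum = t.card * κ ^ n := fun i hi => by
    rw [Multiset.map_congr rfl fun j hj => by rw [h i hi j hj]]
    simp
  rw [covSum, Multiset.map_congr rfl h1]
  simp [mul_assoc]

end

end HierPinning

/-! ### First and second moments of a block as polynomials in `e ^ h`. -/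

namespace HierPinning

noncomputable section

open Polynomial

/-- Variance of the increment of the disorder shared by a block of size `2 ^ n`, beyond what is
shared by its parent block. -/
def stepVar (κ β : ℝ) (n : ℕ) : ℝ := β ^ 2 * (1 - κ) * κ ^ n

/-- Mean of the partition function of a block of size `2 ^ n` over the disorder internal to the
block, as a polynomial in `e ^ h`. -/
def annPoly (B κ β : ℝ) : ℕ → ℝ[X]
  | 0 => X
  | n + 1 => C (1 / B) * heat (stepVar κ β n) (annPoly B κ β n) ^ 2 + C ((B - 1) / B)

/-- Variance polynomial of the partition function of a block, the disorder of its parent block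
being frozen. -/
def excessPoly (B κ β s : ℝ) (n : ℕ) (v : ℝ[X]) : ℝ[X] := heat s v + heatVar s (annPoly B κ β n)

/-- Variance of the partition function of a block of size `2 ^ n` over the disorder internal to
the block, as a polynomial in `e ^ h`. -/
def varPoly (B κ β : ℝ) : ℕ → ℝ[X]
  | 0 => 0
  | n + 1 => C (1 / B ^ 2) * (excessPoly B κ β (stepVar κ β n) n (varPoly B κ β n) *
      (C 2 * heat (stepVar κ β n) (annPoly B κ β n) ^ 2 +
        excessPoly B κ β (stepVar κ β n) n (varPoly B κ β n)))

/-- `Φ` is an exponential polynomial in the disorder of the block `(n, i)`, whose mean over the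
disorder internal to the block is `p`. -/
def Rep (κ β h : ℝ) (n i : ℕ) (Φ : (ℕ → ℝ) → ℝ) (p : ℝ[X]) : Prop :=
  ∃ (ι : Type) (_ : Fintype ι) (c : ι → ℝ) (s : ι → Multiset ℕ),
    (∀ j, ∀ l ∈ s j, l / 2 ^ n = i) ∧
    (∀ x, Φ x = ∑ j, c j * exp (((s j).map fun l => β * x l + h).sum)) ∧
    p = ∑ j, monomial (s j).card
      (c j * exp (β ^ 2 * (covSum κ (s j) (s j) - κ ^ n * (s j).card ^ 2) / 2))

namespace Rep

variable {κ β h : ℝ} {n i : ℕ} {Φ Ψ : (ℕ → ℝ) → ℝ} {p q : ℝ[X]}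

theorem const (c : ℝ) : Rep κ β h n i (fun _ => c) (C c) :=
  ⟨Unit, inferInstance, fun _ => c, fun _ => 0, by simp, by simp, by simp [covSum]⟩

theorem const_mul (hΦ : Rep κ β h n i Φ p) (a : ℝ) :
    Rep κ β h n i (fun x => a * Φ x) (C a * p) := by
  obtain ⟨ι, _, c, s, hs, hΦ, rfl⟩ := hΦ
  refine ⟨ι, inferInstance, fun j => a * c j, s, hs, fun x => ?_, ?_⟩
  · beta_reduce; rw [hΦ, Finset.mul_sum]; simp [mul_assoc]
  · rw [Finset.mul_sum]; simp [C_mul_monomial, mul_assoc]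

theorem add (hΦ : Rep κ β h n i Φ p) (hΨ : Rep κ β h n i Ψ q) :
    Rep κ β h n i (fun x => Φ x + Ψ x) (p + q) := by
  obtain ⟨ι, _, c, s, hs, hΦ, rfl⟩ := hΦ
  obtain ⟨ι', _, c', s', hs', hΨ, rfl⟩ := hΨ
  refine ⟨ι ⊕ ι', inferInstance, Sum.elim c c', Sum.elim s s', ?_, fun x => ?_, ?_⟩
  · rintro (j | j)
    exacts [hs j, hs' j]
  · simp [hΦ, hΨ]
  · simp

/-- Once the field of the parent is frozen, the halves are independent. Algebraically, passing from
`κ ^ n` to `κ ^ (n + 1)` in the subtracted common part releases `(κ ^ n - κ ^ (n + 1)) * card ^ 2`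
for each half, which is one smoothing by `stepVar`, and the constant cross covariance cancels the
cross term of the square. -/
theorem mul_sibling (hΦ : Rep κ β h n (2 * i) Φ p) (hΨ : Rep κ β h n (2 * i + 1) Ψ q) :
    Rep κ β h (n + 1) i (fun x => Φ x * Ψ x)
      (heat (stepVar κ β n) p * heat (stepVar κ β n) q) := by
  obtain ⟨ι, _, c, s, hs, hΦ, rfl⟩ := hΦ
  obtain ⟨ι', _, c', s', hs', hΨ, rfl⟩ := hΨ
  refine ⟨ι × ι', inferInstance, fun j => c j.1 * c' j.2, fun j => s j.1 + s' j.2, ?_,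
    fun x => ?_, ?_⟩
  · rintro ⟨j, j'⟩ l hl
    rw [pow_succ, ← Nat.div_div_eq_div_mul]
    rcases Multiset.mem_add.1 hl with hl | hl
    · rw [hs _ _ hl]; omega
    · rw [hs' _ _ hl]; omega
  · beta_reduce; rw [hΦ, hΨ, Finset.sum_mul_sum, Fintype.sum_prod_type]
    refine Finset.sum_congr rfl fun j _ => Finset.sum_congr rfl fun j' _ => ?_
    simp only
    rw [Multiset.map_add, Multiset.sum_add, exp_add]; ring
  · rw [map_sum, map_sum, Finset.sum_mul_sum, Fintype.sum_prod_type]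
    refine Finset.sum_congr rfl fun j _ => Finset.sum_congr rfl fun j' _ => ?_
    simp only
    rw [heat_monomial, heat_monomial, monomial_mul_monomial, Multiset.card_add]
    congr 1
    have h1 : covSum κ (s j) (s' j') = (s j).card * (s' j').card * κ ^ (n + 1) :=
      covSum_eq_of_forall fun a ha b hb => hierDist_sibling (hs _ _ ha) (hs' _ _ hb)
    have h2 : covSum κ (s' j') (s j) = (s' j').card * (s j).card * κ ^ (n + 1) :=
      covSum_eq_of_forall fun a ha b hb => by
        rw [hierDist_comm]; exact hierDist_sibling (hs _ _ hb) (hs' _ _ ha)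
    rw [covSum_add_left, covSum_add_right, covSum_add_right, h1, h2]
    have hmul : ∀ a b a' b' : ℝ, exp a * (c j * exp b) * (exp a' * (c' j' * exp b')) =
        c j * c' j' * exp (a + b + a' + b') := fun a b a' b' => by
      rw [exp_add, exp_add, exp_add]; ring
    rw [hmul]
    congr 2
    rw [stepVar]; push_cast; ring

variable {Ω : Type*} [MeasurableSpace Ω] {P : Measure Ω} {ω : ℕ → Ω → ℝ}

theorem integrable (hω : IsHierGaussian κ P ω) (hΦ : Rep κ β h n i Φ p) :
    Integrable (fun a => Φ fun j => ω j a) P := by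
  obtain ⟨ι, _, c, s, hs, hΦ, rfl⟩ := hΦ
  simp only [hΦ]
  exact integrable_finsetSum _ fun j _ => (hω.integrable_exp_multiset β h (s j)).const_mul _

/-- What the polynomial has not yet averaged is the field common to the whole block, of variance `κ
^ n`; a last smoothing integrates it out. -/
theorem integral_eq (hω : IsHierGaussian κ P ω) (hΦ : Rep κ β h n i Φ p) :
    ∫ a, Φ (fun j => ω j a) ∂P = ev (heat (β ^ 2 * κ ^ n) p) h := by
  obtain ⟨ι, _, c, s, hs, hΦ, rfl⟩ := hΦ
  simp only [hΦ]
  rw [integral_finsetSum _ fun j _ => (hω.integrable_exp_multiset β h (s j)).const_mul _,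
    map_sum, ev_eq_wsum, map_sum]
  refine Finset.sum_congr rfl fun j _ => ?_
  rw [integral_const_mul, hω.integral_exp_multiset, heat_monomial, wsum_monomial,
    mul_left_comm, mul_assoc, ← exp_add, ← exp_add]
  congr 2; ring

end Rep

theorem hierDist_self (i : ℕ) : hierDist i i = 0 := Nat.le_zero.1 (hierDist_le_iff.2 rfl)

theorem rep_blockZ (B κ β h : ℝ) (n i : ℕ) :
    Rep κ β h n i (fun x => blockZ B β h x n i) (annPoly B κ β n) := by
  induction n generalizing i with
  | zero =>
    refine ⟨Unit, inferInstance, fun _ => 1, fun _ => {i}, by simp, fun x => by simp [blockZ], ?_⟩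
    simp [annPoly, covSum, hierDist_self, X]
  | succ n ih =>
    have h1 := (((ih (2 * i)).mul_sibling (ih (2 * i + 1))).const_mul (1 / B)).add
      (Rep.const ((B - 1) / B))
    convert h1 using 1
    · ext x; simp only [blockZ]; ring
    · rw [annPoly, pow_two]

theorem rep_blockZ_sq (B κ β h : ℝ) (n i : ℕ) :
    Rep κ β h n i (fun x => blockZ B β h x n i ^ 2) (annPoly B κ β n ^ 2 + varPoly B κ β n) := by
  induction n generalizing i with
  | zero =>
    -- The square counts the site twice: exponents are indexed by multisets for this reason.
    refine ⟨Unit, inferInstance, fun _ => 1, fun _ => {i, i}, by simp, fun x => ?_, ?_⟩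
    · simp [blockZ, ← exp_nat_mul]; ring
    · simp [annPoly, varPoly, covSum, hierDist_self, X_pow_eq_monomial]; norm_num
  | succ n ih =>
    have h1 := (((ih (2 * i)).mul_sibling (ih (2 * i + 1))).const_mul (1 / B ^ 2)).add
      (((((rep_blockZ B κ β h n (2 * i)).mul_sibling
        (rep_blockZ B κ β h n (2 * i + 1))).const_mul (2 * (B - 1) / B ^ 2))).add
      (Rep.const ((B - 1) ^ 2 / B ^ 2)))
    convert h1 using 1
    · ext x; simp only [blockZ]; ring
    · rw [annPoly, varPoly, map_add]
      set g := heat (stepVar κ β n) (annPoly B κ β n) with hg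
      -- With `E` the excess and `g` the smoothed mean of a child, the children's second moments
      -- multiply to `(E + g ^ 2) ^ 2`; removing `g ^ 4` leaves `E * (2 g ^ 2 + E)`, the bracket in
      -- `varPoly`.
      have hE : heat (stepVar κ β n) (annPoly B κ β n ^ 2) + heat (stepVar κ β n) (varPoly B κ β n)
          = excessPoly B κ β (stepVar κ β n) n (varPoly B κ β n) + g ^ 2 := by
        rw [excessPoly, heatVar]; ring
      rw [hE]
      generalize excessPoly B κ β (stepVar κ β n) n (varPoly B κ β n) = E
      have e1 : C (2 * (B - 1) / B ^ 2) = C 2 * C (1 / B) * (C ((B - 1) / B) : ℝ[X]) := by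
        rw [← C_mul, ← C_mul]; congr 1; ring
      have e2 : C ((B - 1) ^ 2 / B ^ 2) = (C ((B - 1) / B) : ℝ[X]) ^ 2 := by
        rw [← C_pow]; congr 1; ring
      have e3 : C (1 / B ^ 2) = (C (1 / B) : ℝ[X]) ^ 2 := by
        rw [← C_pow]; congr 1; ring
      have e4 : (C 2 : ℝ[X]) = 2 := map_ofNat C 2
      rw [e1, e2, e3, e4]; ring

end

end HierPinning

/-! ### Superadditivity and a second moment bound for the quenched free energy. -/

namespace HierPinning

noncomputable section

theorem blockZ_pos {B : ℝ} (hB : 1 < B) (β h : ℝ) (x : ℕ → ℝ) (n i : ℕ) :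
    0 < blockZ B β h x n i := by
  induction n generalizing i with
  | zero => exact exp_pos _
  | succ n ih =>
    have := mul_pos (ih (2 * i)) (ih (2 * i + 1))
    exact div_pos (by linarith) (by linarith)

theorem le_blockZ_succ {B : ℝ} (hB : 1 < B) (β h : ℝ) (x : ℕ → ℝ) (n i : ℕ) :
    (B - 1) / B ≤ blockZ B β h x (n + 1) i := by
  have := mul_pos (blockZ_pos hB β h x n (2 * i)) (blockZ_pos hB β h x n (2 * i + 1))
  exact div_le_div_of_nonneg_right (by linarith) (by linarith)

theorem log_blockZ_succ_ge {B : ℝ} (hB : 1 < B) (β h : ℝ) (x : ℕ → ℝ) (n i : ℕ) :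
    log (blockZ B β h x n (2 * i)) + log (blockZ B β h x n (2 * i + 1)) - log B ≤
      log (blockZ B β h x (n + 1) i) := by
  have h0 := blockZ_pos hB β h x n (2 * i)
  have h1 := blockZ_pos hB β h x n (2 * i + 1)
  rw [← log_mul h0.ne' h1.ne', ← log_div (mul_pos h0 h1).ne' (by linarith)]
  refine log_le_log (div_pos (mul_pos h0 h1) (by linarith)) ?_
  exact div_le_div_of_nonneg_right (by linarith) (by linarith)

theorem blockZ_shift (B β h : ℝ) (x : ℕ → ℝ) (n i c : ℕ) :
    blockZ B β h x n (i + c) = blockZ B β h (fun j => x (j + c * 2 ^ n)) n i := by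
  induction n generalizing i c with
  | zero => simp [blockZ]
  | succ n ih =>
    rw [blockZ, blockZ, mul_add, ih (2 * i) (2 * c), add_right_comm, ih (2 * i + 1) (2 * c)]
    simp only [pow_succ, mul_assoc, mul_comm 2]

theorem blockZ_congr (B β h : ℝ) {x y : ℕ → ℝ} {n i : ℕ} (hxy : ∀ j, j / 2 ^ n = i → x j = y j) :
    blockZ B β h x n i = blockZ B β h y n i := by
  induction n generalizing i with
  | zero => simp [blockZ, hxy i (by simp)]
  | succ n ih =>
    rw [blockZ, blockZ, ih fun j hj => hxy j ?_, ih fun j hj => hxy j ?_]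
    all_goals rw [pow_succ, ← Nat.div_div_eq_div_mul, hj]; omega

theorem measurable_blockZ (B β h : ℝ) {α : Type*} [MeasurableSpace α] {x : α → ℕ → ℝ}
    (hx : ∀ j, Measurable fun a => x a j) (n i : ℕ) :
    Measurable fun a => blockZ B β h (x a) n i := by
  induction n generalizing i with
  | zero => exact (((hx i).const_mul β).add_const h).exp
  | succ n ih =>
    exact (((ih (2 * i)).mul (ih (2 * i + 1))).add_const B).sub_const 1 |>.div_const B

theorem partZ_pos {Ω : Type*} {ω : ℕ → Ω → ℝ} {B β h : ℝ} (hB : 1 < B) (n : ℕ) (a : Ω) :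
    0 < partZ B β h ω n a := blockZ_pos hB _ _ _ _ _

section

variable {Ω : Type*} [MeasurableSpace Ω] {P : Measure Ω} {ω : ℕ → Ω → ℝ} {κ B : ℝ}

theorem integrable_log_blockZ (hB : 1 < B) (hω : IsHierGaussian κ P ω) (β h : ℝ) (n i : ℕ) :
    Integrable (fun a => log (blockZ B β h (fun j => ω j a) n i)) P := by
  have := hω.gaussian.isProbabilityMeasure
  cases n with
  | zero =>
    simp only [blockZ, log_exp]
    exact ((hω.gaussian.hasGaussianLaw_eval i).integrable.const_mul β).add (integrable_const h)
  | succ n =>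
    have hZ := (rep_blockZ B κ β h (n + 1) i).integrable hω
    refine Integrable.mono' (hZ.add (integrable_const |log ((B - 1) / B)|))
      (measurable_log.comp_aemeasurable hZ.aemeasurable).aestronglyMeasurable
      (Eventually.of_forall fun a => ?_)
    have h0 := blockZ_pos hB β h (fun j => ω j a) (n + 1) i
    have h1 := log_le_log (div_pos (by linarith) (by linarith))
      (le_blockZ_succ hB β h (fun j => ω j a) n i)
    have h2 := log_le_sub_one_of_pos h0
    simp only [Pi.add_apply, norm_eq_abs]
    refine abs_le.2 ⟨?_, ?_⟩
    · have := neg_abs_le (log ((B - 1) / B)); linarith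
    · have := abs_nonneg (log ((B - 1) / B)); linarith

/-- Translation by `2 ^ n` preserves distances inside the block, so both halves see disorder of the
same law; the environment is cut to finitely many sites to apply `map_eq`. -/
theorem integral_log_blockZ_one (hω : IsHierGaussian κ P ω) (β h : ℝ) (n : ℕ) :
    ∫ a, log (blockZ B β h (fun j => ω j a) n 1) ∂P =
      ∫ a, log (blockZ B β h (fun j => ω j a) n 0) ∂P := by
  let ext : (Fin (2 ^ n) → ℝ) → ℕ → ℝ := fun y j => if hj : j < 2 ^ n then y ⟨j, hj⟩ else 0
  have hext : ∀ j, Measurable fun y => ext y j := fun j => by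
    by_cases hj : j < 2 ^ n
    · simpa [ext, hj] using measurable_pi_apply _
    · simp [ext, hj]
  let F : (Fin (2 ^ n) → ℝ) → ℝ := fun y => log (blockZ B β h (ext y) n 0)
  have hF : Measurable F := measurable_log.comp (measurable_blockZ B β h hext n 0)
  have hlt : ∀ j : ℕ, j / 2 ^ n = 0 → j < 2 ^ n := fun j hj =>
    (Nat.div_eq_zero_iff_lt (by positivity)).1 hj
  have h0 : ∀ a, log (blockZ B β h (fun j => ω j a) n 0) =
      F (fun i : Fin (2 ^ n) => ω (i : ℕ) a) := fun a => by
    simp only [F]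
    rw [blockZ_congr]
    intro j hj
    simp [ext, hlt j hj]
  have h1 : ∀ a, log (blockZ B β h (fun j => ω j a) n 1) =
      F (fun i : Fin (2 ^ n) => ω ((i : ℕ) + 2 ^ n) a) := fun a => by
    simp only [F]
    rw [show (1 : ℕ) = 0 + 1 from rfl, blockZ_shift, blockZ_congr]
    intro j hj
    simp [ext, hlt j hj]
  simp only [h0, h1]
  have hm : ∀ f : Fin (2 ^ n) → ℕ, AEMeasurable (fun a i => ω (f i) a) P := fun f =>
    aemeasurable_pi_lambda _ fun i => hω.gaussian.aemeasurable (f i)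
  rw [← integral_map (hm fun i => (i : ℕ) + 2 ^ n) hF.aestronglyMeasurable,
    ← integral_map (hm fun i => (i : ℕ)) hF.aestronglyMeasurable,
    hω.map_eq (fun i : Fin (2 ^ n) => (i : ℕ) + 2 ^ n) (fun i => (i : ℕ))
      fun i j => hierDist_shift i.2 j.2]

variable {β h : ℝ}

theorem integrable_partZ (hω : IsHierGaussian κ P ω) (n : ℕ) : Integrable (partZ B β h ω n) P :=
  (rep_blockZ B κ β h n 0).integrable hω

theorem integrable_log_partZ (hB : 1 < B) (hω : IsHierGaussian κ P ω) (n : ℕ) :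
    Integrable (fun a => log (partZ B β h ω n a)) P := integrable_log_blockZ hB hω β h n 0

theorem integral_partZ (hω : IsHierGaussian κ P ω) (n : ℕ) :
    ∫ a, partZ B β h ω n a ∂P = ev (heat (β ^ 2 * κ ^ n) (annPoly B κ β n)) h :=
  (rep_blockZ B κ β h n 0).integral_eq hω

theorem integral_log_partZ_succ_ge (hB : 1 < B) (hω : IsHierGaussian κ P ω) (n : ℕ) :
    2 * ∫ a, log (partZ B β h ω n a) ∂P - log B ≤ ∫ a, log (partZ B β h ω (n + 1) a) ∂P := by
  have := hω.gaussian.isProbabilityMeasure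
  have i0 := integrable_log_blockZ (B := B) hB hω β h n 0
  have i1 := integrable_log_blockZ (B := B) hB hω β h n 1
  have h1 : ∫ a, (log (blockZ B β h (fun j => ω j a) n 0) + log (blockZ B β h (fun j => ω j a) n 1)
      - log B) ∂P ≤ ∫ a, log (partZ B β h ω (n + 1) a) ∂P := by
    refine integral_mono ((i0.add i1).sub (integrable_const _)) (integrable_log_partZ hB hω _)
      fun a => ?_
    have := log_blockZ_succ_ge hB β h (fun j => ω j a) n 0
    simpa [partZ] using this
  have i01 : Integrable (fun a => log (blockZ B β h (fun j => ω j a) n 0) +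
      log (blockZ B β h (fun j => ω j a) n 1)) P := i0.add i1
  rw [integral_sub i01 (integrable_const _), integral_add i0 i1, integral_log_blockZ_one hω] at h1
  simp only [partZ] at h1 ⊢
  simp at h1
  linarith

theorem integral_log_partZ_le (hB : 1 < B) (hω : IsHierGaussian κ P ω) (n : ℕ) :
    ∫ a, log (partZ B β h ω n a) ∂P ≤ log (∫ a, partZ B β h ω n a ∂P) := by
  have := hω.gaussian.isProbabilityMeasure
  have hA : 0 < ∫ a, partZ B β h ω n a ∂P := by
    rw [integral_pos_iff_support_of_nonneg (fun a => (partZ_pos hB n a).le) (integrable_partZ hω n)]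
    have : Function.support (partZ B β h ω n) = Set.univ :=
      Set.eq_univ_of_forall fun a => (partZ_pos hB n a).ne'
    rw [this]; simp
  set A := ∫ a, partZ B β h ω n a ∂P with hAdef
  have h1 : ∫ a, log (partZ B β h ω n a) ∂P ≤ ∫ a, (partZ B β h ω n a / A - 1 + log A) ∂P := by
    refine integral_mono (integrable_log_partZ hB hω n)
      ((((integrable_partZ hω n).div_const A).sub (integrable_const 1)).add (integrable_const _))
      fun a => ?_
    have h2 := log_le_sub_one_of_pos (div_pos (partZ_pos (β := β) (h := h) (ω := ω) hB n a) hA)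
    rw [log_div (partZ_pos hB n a).ne' hA.ne'] at h2
    simp only
    linarith
  have i1 : Integrable (fun a => partZ B β h ω n a / A - 1) P :=
    ((integrable_partZ hω n).div_const A).sub (integrable_const 1)
  rw [integral_add i1 (integrable_const _),
    integral_sub ((integrable_partZ hω n).div_const A) (integrable_const 1),
    integral_div, ← hAdef, div_self hA.ne'] at h1
  simpa using h1

/-- If `z ≥ A / 2`, the loss `log 2` suffices. Otherwise `(z / A - 1) ^ 2 ≥ 1 / 4`, and the factor
`4` makes the quadratic term pay for the whole drop from `log A` to `log δ`. -/
theorem log_ge_sub_sq {A z δ : ℝ} (hA : 1 ≤ A) (hδ : 0 < δ) (hδ1 : δ ≤ 1) (hz : δ ≤ z) :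
    log A - log 2 - 4 * (log A - log δ) * (z / A - 1) ^ 2 ≤ log z := by
  have hA0 : 0 < A := by linarith
  have hlA := log_nonneg hA
  have hlδ := log_nonpos hδ.le hδ1
  have hc : 0 ≤ log A - log δ := by linarith
  rcases le_total (A / 2) z with h | h
  · have := log_le_log (by positivity) h
    rw [log_div hA0.ne' (by norm_num)] at this
    have := mul_nonneg hc (sq_nonneg (z / A - 1))
    linarith
  · have h1 : z / A ≤ 1 / 2 := by rw [div_le_iff₀ hA0]; linarith
    have h2 : 1 / 4 ≤ (z / A - 1) ^ 2 := by nlinarith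
    have h3 := mul_le_mul_of_nonneg_left h2 hc
    have h4 := log_le_log hδ hz
    have h5 := log_nonneg (show (1 : ℝ) ≤ 2 by norm_num)
    linarith

/-- Integration of `log_ge_sub_sq` with `A` the mean. The level is `n + 1` because the deterministic
floor `(B - 1) / B` is not available at level `0`. -/
theorem integral_log_partZ_ge (hB : 1 < B) (hω : IsHierGaussian κ P ω) (n : ℕ)
    (hA : 1 ≤ ev (heat (β ^ 2 * κ ^ (n + 1)) (annPoly B κ β (n + 1))) h) :
    let A := ev (heat (β ^ 2 * κ ^ (n + 1)) (annPoly B κ β (n + 1))) h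
    log A - log 2 - 4 * (log A - log ((B - 1) / B)) *
      ev (excessPoly B κ β (β ^ 2 * κ ^ (n + 1)) (n + 1) (varPoly B κ β (n + 1))) h ≤
      ∫ a, log (partZ B β h ω (n + 1) a) ∂P := by
  intro A
  change 1 ≤ A at hA
  have := hω.gaussian.isProbabilityMeasure
  have hA0 : 0 < A := by linarith
  have i1 := integrable_partZ (B := B) (β := β) (h := h) hω (n + 1)
  have i2 : Integrable (fun a => partZ B β h ω (n + 1) a ^ 2) P :=
    (rep_blockZ_sq B κ β h (n + 1) 0).integrable hω
  have m1 : ∫ a, partZ B β h ω (n + 1) a ∂P = A := integral_partZ hω (n + 1)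
  have m2 : ∫ a, partZ B β h ω (n + 1) a ^ 2 ∂P =
      ev (excessPoly B κ β (β ^ 2 * κ ^ (n + 1)) (n + 1) (varPoly B κ β (n + 1))) h + A ^ 2 := by
    refine ((rep_blockZ_sq B κ β h (n + 1) 0).integral_eq hω).trans ?_
    simp only [A, excessPoly, heatVar, ev_add, ev_sub, map_add, ev_pow]
    ring
  set V := ev (excessPoly B κ β (β ^ 2 * κ ^ (n + 1)) (n + 1) (varPoly B κ β (n + 1))) h
  set c := 4 * (log A - log ((B - 1) / B)) with hc
  have hδ : 0 < (B - 1) / B := div_pos (by linarith) (by linarith)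
  have hδ1 : (B - 1) / B ≤ 1 := (div_le_one (by linarith)).2 (by linarith)
  have hc0 : 0 ≤ c := by
    have := log_nonneg hA
    have := log_nonpos hδ.le hδ1
    rw [hc]; linarith
  have hrw : ∀ a, log A - log 2 - c * (partZ B β h ω (n + 1) a / A - 1) ^ 2 =
      (log A - log 2 - c) - (c / A ^ 2) * partZ B β h ω (n + 1) a ^ 2
        + (2 * c / A) * partZ B β h ω (n + 1) a := fun a => by field_simp; ring
  have h1 : ∫ a, ((log A - log 2 - c) - (c / A ^ 2) * partZ B β h ω (n + 1) a ^ 2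
        + (2 * c / A) * partZ B β h ω (n + 1) a) ∂P ≤ ∫ a, log (partZ B β h ω (n + 1) a) ∂P := by
    refine integral_mono (((integrable_const _).sub (i2.const_mul _)).add (i1.const_mul _))
      (integrable_log_partZ hB hω _) fun a => ?_
    simp only
    rw [← hrw]
    exact log_ge_sub_sq hA hδ hδ1 (le_blockZ_succ hB β h _ n 0)
  have i3 : Integrable (fun a => (log A - log 2 - c) -
      (c / A ^ 2) * partZ B β h ω (n + 1) a ^ 2) P := (integrable_const _).sub (i2.const_mul _)
  rw [integral_add i3 (i1.const_mul _),
    integral_sub (integrable_const _) (i2.const_mul _), integral_const_mul, integral_const_mul,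
    m1, m2] at h1
  simp only [integral_const, probReal_univ, smul_eq_mul, one_mul] at h1
  refine le_trans ?_ h1
  have e1 : log A - log 2 - c - c / A ^ 2 * (V + A ^ 2) + 2 * c / A * A =
      log A - log 2 - c * (V / A ^ 2) := by field_simp; ring
  rw [e1]
  have hV : 0 ≤ V + A ^ 2 - A ^ 2 := by
    rw [← m2, ← m1]
    have := ProbabilityTheory.variance_nonneg (partZ B β h ω (n + 1)) P
    rw [variance_eq_sub ((memLp_two_iff_integrable_sq i1.aestronglyMeasurable).2 i2)] at this
    simpa using this
  have h2 : V / A ^ 2 ≤ V := div_le_self (by linarith) (one_le_pow₀ hA)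
  nlinarith

end

end

end HierPinning

/-! ### The annealed recursion, its free energy and its critical point. -/

namespace HierPinning

noncomputable section

open Polynomial

/-- `annPoly` as a function of the field. -/
def annF (B κ β : ℝ) (n : ℕ) (x : ℝ) : ℝ := ev (annPoly B κ β n) x

/-- The smoothing of `annF` by the disorder shared by a block but not by its parent block. -/
def annG (B κ β : ℝ) (n : ℕ) (x : ℝ) : ℝ := ev (heat (stepVar κ β n) (annPoly B κ β n)) x

section

variable {B κ β : ℝ}

theorem stepVar_nonneg (hκ1 : κ ≤ 1) (hκ : 0 ≤ κ) (n : ℕ) : 0 ≤ stepVar κ β n := by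
  have : 0 ≤ 1 - κ := by linarith
  unfold stepVar; positivity

theorem stepVar_le (hκ : 0 ≤ κ) (n : ℕ) : stepVar κ β n ≤ β ^ 2 * κ ^ n := by
  unfold stepVar
  have : 0 ≤ β ^ 2 * κ ^ n * κ := by positivity
  nlinarith

theorem nonnegCoeff_annPoly (hB : 1 < B) (n : ℕ) : NonnegCoeff (annPoly B κ β n) := by
  induction n with
  | zero => exact NonnegCoeff.X
  | succ n ih =>
    rw [annPoly, pow_two]
    exact ((NonnegCoeff.const (by positivity)).mul ((ih.heat _).mul (ih.heat _))).add
      (NonnegCoeff.const (div_nonneg (by linarith) (by linarith)))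

theorem natDegree_annPoly_le (n : ℕ) : (annPoly B κ β n).natDegree ≤ 2 ^ n := by
  induction n with
  | zero => simp [annPoly]
  | succ n ih =>
    rw [annPoly]
    refine (natDegree_add_C).le.trans ((natDegree_C_mul_le _ _).trans ?_)
    refine natDegree_pow_le.trans ?_
    rw [pow_succ, mul_comm]
    exact Nat.mul_le_mul_right _ ((natDegree_heat_le _ _).trans ih)

@[simp] theorem annF_zero (x : ℝ) : annF B κ β 0 x = exp x := by simp [annF, annPoly]

theorem annF_succ (n : ℕ) (x : ℝ) :
    annF B κ β (n + 1) x = (annG B κ β n x ^ 2 + B - 1) / B := by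
  simp only [annF, annPoly, annG, ev_add, ev_mul, ev_pow, ev_C]; ring

theorem continuous_annF (n : ℕ) : Continuous (annF B κ β n) := continuous_ev _
theorem continuous_annG (n : ℕ) : Continuous (annG B κ β n) := continuous_ev _

theorem annF_mono (hB : 1 < B) (n : ℕ) : Monotone (annF B κ β n) :=
  (nonnegCoeff_annPoly hB n).ev_mono

theorem annG_mono (hB : 1 < B) (n : ℕ) : Monotone (annG B κ β n) :=
  ((nonnegCoeff_annPoly hB n).heat _).ev_mono

theorem annF_le_annG (hB : 1 < B) (hκ : 0 ≤ κ) (hκ1 : κ ≤ 1) (n : ℕ) (x : ℝ) :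
    annF B κ β n x ≤ annG B κ β n x :=
  (nonnegCoeff_annPoly hB n).ev_le_ev_heat (stepVar_nonneg hκ1 hκ n) x

theorem annF_pos (hB : 1 < B) (n : ℕ) (x : ℝ) : 0 < annF B κ β n x := by
  cases n with
  | zero => rw [annF_zero]; exact exp_pos x
  | succ n =>
    rw [annF_succ]
    have := sq_nonneg (annG B κ β n x)
    exact div_pos (by linarith) (by linarith)

theorem annG_pos (hB : 1 < B) (hκ : 0 ≤ κ) (hκ1 : κ ≤ 1) (n : ℕ) (x : ℝ) :
    0 < annG B κ β n x := (annF_pos hB n x).trans_le (annF_le_annG hB hκ hκ1 n x)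

theorem ev_heat_le_exp_mul {p : ℝ[X]} (hp : NonnegCoeff p) {s D : ℝ} (hs : 0 ≤ s)
    (hD : (p.natDegree : ℝ) ≤ D) (x : ℝ) : ev (heat s p) x ≤ exp (s * D ^ 2 / 2) * ev p x := by
  rw [ev_heat, ev_eq_wsum, ← wsum_const_mul]
  refine hp.wsum_le fun k hk => ?_
  have : (k : ℝ) ≤ D := le_trans (by exact_mod_cast hk) hD
  gcongr

/-- On the degrees present `k ^ 2 ≤ D k`, so smoothing is dominated by a translation of the field.
-/
theorem ev_heat_le_shift {p : ℝ[X]} (hp : NonnegCoeff p) {s D : ℝ} (hs : 0 ≤ s)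
    (hD : (p.natDegree : ℝ) ≤ D) (x : ℝ) : ev (heat s p) x ≤ ev p (x + s * D / 2) := by
  rw [ev_heat, ev_eq_wsum]
  refine hp.wsum_le fun k hk => ?_
  have h1 : (k : ℝ) ≤ D := le_trans (by exact_mod_cast hk) hD
  have h2 : (0 : ℝ) ≤ k := Nat.cast_nonneg k
  rw [← exp_add]
  refine exp_le_exp.2 ?_
  nlinarith [mul_nonneg (mul_nonneg hs h2) (sub_nonneg.2 h1)]

theorem cast_natDegree_annPoly_le (n : ℕ) : ((annPoly B κ β n).natDegree : ℝ) ≤ 2 ^ n := by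
  exact_mod_cast natDegree_annPoly_le n

theorem ev_heat_annPoly_le (hB : 1 < B) {s : ℝ} (hs : 0 ≤ s) {n : ℕ} (hsn : s ≤ β ^ 2 * κ ^ n)
    (x : ℝ) : ev (heat s (annPoly B κ β n)) x ≤
      exp (2 ^ n * (β ^ 2 * (2 * κ) ^ n / 2)) * annF B κ β n x := by
  refine (ev_heat_le_exp_mul (nonnegCoeff_annPoly hB n) hs (cast_natDegree_annPoly_le n) x).trans ?_
  refine mul_le_mul_of_nonneg_right (exp_le_exp.2 ?_) (annF_pos hB n x).le
  rw [mul_pow]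
  have := mul_le_mul_of_nonneg_right hsn (show (0 : ℝ) ≤ (2 ^ n) ^ 2 by positivity)
  linarith

theorem annF_sq_div_le (hB : 1 < B) (hκ : 0 ≤ κ) (hκ1 : κ ≤ 1) (n : ℕ) (x : ℝ) :
    annF B κ β n x ^ 2 / B ≤ annF B κ β (n + 1) x := by
  rw [annF_succ]
  have h1 := annF_le_annG (β := β) hB hκ hκ1 n x
  have h2 := annF_pos (κ := κ) (β := β) hB n x
  refine div_le_div_of_nonneg_right ?_ (by linarith)
  nlinarith

/-- Superadditive lower approximation of the annealed free energy. -/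
def annLow (B κ β : ℝ) (x : ℝ) (n : ℕ) : ℝ := (log (annF B κ β n x) - log B) / 2 ^ n

theorem annLow_mono (hB : 1 < B) (hκ : 0 ≤ κ) (hκ1 : κ ≤ 1) (x : ℝ) :
    Monotone (annLow B κ β x) := by
  refine monotone_nat_of_le_succ fun n => ?_
  have h0 := annF_pos (κ := κ) (β := β) hB n x
  have h1 := log_le_log (div_pos (pow_pos h0 2) (by linarith))
    (annF_sq_div_le (β := β) hB hκ hκ1 n x)
  rw [log_div (pow_pos h0 2).ne' (by linarith), log_pow] at h1
  rw [annLow, annLow, pow_succ, div_le_div_iff₀ (by positivity) (by positivity)]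
  push_cast at h1
  have : (0 : ℝ) < 2 ^ n := by positivity
  nlinarith

theorem geom_sum_two_mul_le (hκ : 0 ≤ κ) (hκ2 : κ < 1 / 2) (n : ℕ) :
    ∑ j ∈ Finset.range n, (2 * κ) ^ j ≤ (1 - 2 * κ)⁻¹ := by
  rw [← tsum_geometric_of_lt_one (by linarith) (by linarith)]
  exact (summable_geometric_of_lt_one (by linarith) (by linarith)).sum_le_tsum _
    fun j _ => pow_nonneg (by linarith) j

/-- A smoothing at level `n` costs at most `β ^ 2 * κ ^ n * 4 ^ n / 2` in the exponent; relative to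
the volume `2 ^ n` these costs are the terms of a geometric series of ratio `2 * κ`. -/
theorem annF_le_exp (hB : 1 < B) (hκ : 0 ≤ κ) (hκ1 : κ ≤ 1) (n : ℕ) (x : ℝ) :
    annF B κ β n x ≤ exp (2 ^ n * (max x 0 + β ^ 2 * ∑ j ∈ Finset.range n, (2 * κ) ^ j)) := by
  induction n with
  | zero => simp
  | succ n ih =>
    set S := ∑ j ∈ Finset.range n, (2 * κ) ^ j with hS
    have hS0 : 0 ≤ S := Finset.sum_nonneg fun j _ => by positivity
    have hm : 0 ≤ max x 0 := le_max_right _ _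
    have h1 : annG B κ β n x ≤ exp (2 ^ n * (max x 0 + β ^ 2 * (S + (2 * κ) ^ n))) := by
      refine (ev_heat_annPoly_le hB (stepVar_nonneg hκ1 hκ n) (stepVar_le hκ n) x).trans ?_
      refine (mul_le_mul_of_nonneg_left ih (exp_nonneg _)).trans ?_
      rw [← exp_add]
      refine exp_le_exp.2 ?_
      have : 0 ≤ 2 ^ n * (β ^ 2 * (2 * κ) ^ n / 2) := by positivity
      nlinarith
    rw [annF_succ, Finset.sum_range_succ, ← hS, pow_succ (2 : ℝ), mul_right_comm, mul_two, exp_add,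
      ← pow_two, div_le_iff₀ (by linarith)]
    have h2 : 1 ≤ exp (2 ^ n * (max x 0 + β ^ 2 * (S + (2 * κ) ^ n))) := one_le_exp (by positivity)
    have h3 := (annG_pos (β := β) hB hκ hκ1 n x).le
    have h4 := one_le_pow₀ h2 (n := 2)
    nlinarith [pow_le_pow_left₀ h3 h1 2]

theorem annLow_le (hB : 1 < B) (hκ : 0 ≤ κ) (hκ2 : κ < 1 / 2) (x : ℝ) (n : ℕ) :
    annLow B κ β x n ≤ max x 0 + β ^ 2 * (1 - 2 * κ)⁻¹ := by
  rw [annLow, div_le_iff₀ (by positivity)]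
  have h1 := log_le_log (annF_pos hB n x) (annF_le_exp (β := β) hB hκ (by linarith) n x)
  rw [log_exp] at h1
  have h2 := mul_le_mul_of_nonneg_left (geom_sum_two_mul_le hκ hκ2 n) (sq_nonneg β)
  have h3 := log_pos hB
  have : (0 : ℝ) < 2 ^ n := by positivity
  nlinarith

/-- Undoing each smoothing by a translation keeps the recursion below its fixed point `1`; this
supplies the subcritical fields needed for `annealedHc` to be a genuine supremum. -/
theorem annF_le_one_of_le (hB : 1 < B) (hκ : 0 ≤ κ) (hκ1 : κ ≤ 1) (n : ℕ) {x : ℝ}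
    (hx : x ≤ -(β ^ 2 * ∑ j ∈ Finset.range n, (2 * κ) ^ j)) : annF B κ β n x ≤ 1 := by
  induction n generalizing x with
  | zero => simpa using hx
  | succ n ih =>
    rw [Finset.sum_range_succ, mul_add] at hx
    have h1 : annG B κ β n x ≤ 1 := by
      refine (ev_heat_le_shift (nonnegCoeff_annPoly hB n) (stepVar_nonneg hκ1 hκ n)
        (cast_natDegree_annPoly_le n) x).trans (ih ?_)
      have := mul_le_mul_of_nonneg_right (stepVar_le (β := β) hκ n)
        (show (0 : ℝ) ≤ 2 ^ n by positivity)
      have h0 : 0 ≤ β ^ 2 * (2 * κ) ^ n := by positivity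
      rw [mul_pow] at hx h0
      linarith
    rw [annF_succ, div_le_one (by linarith)]
    nlinarith [(annG_pos (β := β) hB hκ hκ1 n x).le]

/-- Smoothing only increases the mean, and `g ^ 2 - 1 ≥ 2 * (g - 1)`: the fixed point `1` repels
upwards at rate at least `2 / B`. -/
theorem annF_growth (hB : 1 < B) (hκ : 0 ≤ κ) (hκ1 : κ ≤ 1) {n : ℕ} {x : ℝ}
    (hn : 1 ≤ annF B κ β n x) (k : ℕ) :
    1 + (2 / B) ^ k * (annF B κ β n x - 1) ≤ annF B κ β (n + k) x := by
  induction k with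
  | zero => simp
  | succ k ih =>
    have hB0 : 0 < B := by linarith
    have h0 : 0 ≤ (2 / B) ^ k * (annF B κ β n x - 1) :=
      mul_nonneg (by positivity) (by linarith)
    have h1 := annF_le_annG (β := β) hB hκ hκ1 (n + k) x
    rw [← add_assoc, annF_succ, pow_succ, le_div_iff₀ hB0]
    have e : (1 + (2 / B) ^ k * (2 / B) * (annF B κ β n x - 1)) * B =
        B + 2 * ((2 / B) ^ k * (annF B κ β n x - 1)) := by field_simp
    rw [e]
    nlinarith

end

section

variable {Ω : Type*} [MeasurableSpace Ω] {P : Measure Ω} {ω : ℕ → Ω → ℝ} {κ B : ℝ}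

theorem tendsto_annLow (hB : 1 < B) (hκ : 0 ≤ κ) (hκ2 : κ < 1 / 2) (β x : ℝ) :
    Tendsto (annLow B κ β x) atTop (𝓝 (⨆ n, annLow B κ β x n)) :=
  tendsto_atTop_ciSup (annLow_mono hB hκ (by linarith) x)
    ⟨_, Set.forall_mem_range.2 (annLow_le hB hκ hκ2 x)⟩

theorem tendsto_const_div_two_pow (c : ℝ) : Tendsto (fun n : ℕ => c / 2 ^ n) atTop (𝓝 0) :=
  tendsto_const_nhds.div_atTop (tendsto_pow_atTop_atTop_of_one_lt (by norm_num))

theorem tendsto_annealedF_n_aux (hB : 1 < B) (hκ : 0 ≤ κ) (hκ2 : κ < 1 / 2)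
    (hω : IsHierGaussian κ P ω) (β h : ℝ) :
    Tendsto (annealedF_n B P ω β h) atTop (𝓝 (⨆ n, annLow B κ β h n)) := by
  have h1 : Tendsto (fun n => annLow B κ β h n + log B / 2 ^ n) atTop
      (𝓝 ((⨆ n, annLow B κ β h n) + 0)) :=
    (tendsto_annLow hB hκ hκ2 β h).add (tendsto_const_div_two_pow _)
  have h2 : Tendsto (fun n : ℕ => β ^ 2 / 2 * (2 * κ) ^ n) atTop (𝓝 (β ^ 2 / 2 * 0)) :=
    (tendsto_pow_atTop_nhds_zero_of_lt_one (by linarith) (by linarith)).const_mul _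
  have h3 := h1.add h2
  rw [mul_zero, add_zero, add_zero] at h3
  rw [add_zero] at h1
  have e1 : ∀ n, annLow B κ β h n + log B / 2 ^ n = log (annF B κ β n h) / 2 ^ n := fun n => by
    rw [annLow]; ring
  refine tendsto_of_tendsto_of_tendsto_of_le_of_le h1 h3 (fun n => ?_) fun n => ?_
  · simp only [e1, annealedF_n]
    rw [integral_partZ hω, div_eq_mul_one_div, mul_comm]
    refine mul_le_mul_of_nonneg_left (log_le_log (annF_pos hB n h) ?_) (by positivity)
    exact (nonnegCoeff_annPoly hB n).ev_le_ev_heat (by positivity) h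
  · simp only [e1, annealedF_n]
    rw [integral_partZ hω]
    have h4 : ev (heat (β ^ 2 * κ ^ n) (annPoly B κ β n)) h ≤ _ :=
      ev_heat_annPoly_le hB (by positivity) le_rfl h
    have h5 : 0 < ev (heat (β ^ 2 * κ ^ n) (annPoly B κ β n)) h := (annF_pos hB n h).trans_le
      ((nonnegCoeff_annPoly hB n).ev_le_ev_heat (by positivity) h)
    have h6 := log_le_log h5 h4
    rw [log_mul (exp_pos _).ne' (annF_pos hB n h).ne', log_exp] at h6
    have : (0 : ℝ) < 2 ^ n := by positivity
    rw [one_div_mul_eq_div, div_le_iff₀ this, add_mul, div_mul_cancel₀ _ this.ne']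
    linarith

theorem annealedF_eq (hB : 1 < B) (hκ : 0 ≤ κ) (hκ2 : κ < 1 / 2) (hω : IsHierGaussian κ P ω)
    (β h : ℝ) : annealedF B P ω β h = ⨆ n, annLow B κ β h n :=
  (tendsto_annealedF_n_aux hB hκ hκ2 hω β h).limUnder_eq

theorem tendsto_annealedF_n (hB : 1 < B) (hκ : 0 ≤ κ) (hκ2 : κ < 1 / 2)
    (hω : IsHierGaussian κ P ω) (β h : ℝ) :
    Tendsto (annealedF_n B P ω β h) atTop (𝓝 (annealedF B P ω β h)) := by
  rw [annealedF_eq hB hκ hκ2 hω]; exact tendsto_annealedF_n_aux hB hκ hκ2 hω β h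

theorem annLow_le_annealedF (hB : 1 < B) (hκ : 0 ≤ κ) (hκ2 : κ < 1 / 2)
    (hω : IsHierGaussian κ P ω) (β h : ℝ) (n : ℕ) :
    annLow B κ β h n ≤ annealedF B P ω β h := by
  rw [annealedF_eq hB hκ hκ2 hω]
  exact le_ciSup ⟨_, Set.forall_mem_range.2 (annLow_le hB hκ hκ2 h)⟩ n

theorem annealedF_le (hB : 1 < B) (hκ : 0 ≤ κ) (hκ2 : κ < 1 / 2)
    (hω : IsHierGaussian κ P ω) {β h c : ℝ}
    (hc : ∀ᶠ n in atTop, log (annF B κ β n h) ≤ c * 2 ^ n) : annealedF B P ω β h ≤ c := by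
  rw [annealedF_eq hB hκ hκ2 hω]
  refine le_of_tendsto (tendsto_annLow hB hκ hκ2 β h) (hc.mono fun n hn => ?_)
  rw [annLow, div_le_iff₀ (by positivity)]
  have := log_pos hB
  linarith

theorem annealedF_nonneg (hB : 1 < B) (hκ : 0 ≤ κ) (hκ2 : κ < 1 / 2)
    (hω : IsHierGaussian κ P ω) (β h : ℝ) : 0 ≤ annealedF B P ω β h := by
  have h1 := tendsto_const_div_two_pow (log ((B - 1) / B) - log B)
  refine le_of_tendsto h1 ((eventually_ge_atTop 1).mono fun n hn => ?_)
  refine le_trans ?_ (annLow_le_annealedF hB hκ hκ2 hω β h n)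
  obtain ⟨m, rfl⟩ := Nat.exists_eq_add_of_le' hn
  rw [annLow]
  refine div_le_div_of_nonneg_right (sub_le_sub_right (log_le_log ?_ ?_) _) (by positivity)
  · exact div_pos (by linarith) (by linarith)
  · rw [annF_succ]
    have := sq_nonneg (annG B κ β m h)
    exact div_le_div_of_nonneg_right (by linarith) (by linarith)

/-- As soon as the mean exceeds `1`, `annF_growth` pushes it above `B`, where the superadditive
lower approximation `annLow` is positive. -/
theorem annealedF_eq_zero_iff (hB : 1 < B) (hB2 : B < 2) (hκ : 0 ≤ κ) (hκ2 : κ < 1 / 2)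
    (hω : IsHierGaussian κ P ω) (β h : ℝ) :
    annealedF B P ω β h = 0 ↔ ∀ n, annF B κ β n h ≤ 1 := by
  constructor
  · intro h0
    by_contra! hn
    obtain ⟨n, hn⟩ := hn
    have hg : 1 < 2 / B := (one_lt_div (by linarith)).2 hB2
    obtain ⟨k, hk⟩ := pow_unbounded_of_one_lt ((B - 1) / (annF B κ β n h - 1)) hg
    rw [div_lt_iff₀ (by linarith)] at hk
    have h1 := annF_growth hB hκ (by linarith) hn.le k
    have h2 := annLow_le_annealedF hB hκ hκ2 hω β h (n + k)
    have h3 : 0 < annLow B κ β h (n + k) :=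
      div_pos (sub_pos.2 (log_lt_log (by linarith) (by linarith))) (by positivity)
    linarith
  · intro h1
    refine le_antisymm (annealedF_le hB hκ hκ2 hω (Eventually.of_forall fun n => ?_))
      (annealedF_nonneg hB hκ hκ2 hω β h)
    rw [zero_mul]
    exact log_nonpos (annF_pos hB n h).le (h1 n)

/-- The set of fields with vanishing free energy is nonempty, bounded above by `0`, and closed as an
intersection of sublevel sets; so it contains its supremum, and monotonicity in the field does the
rest. -/
theorem le_annealedHc_iff (hB : 1 < B) (hB2 : B < 2) (hκ : 0 ≤ κ) (hκ2 : κ < 1 / 2)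
    (hω : IsHierGaussian κ P ω) (β h : ℝ) :
    h ≤ annealedHc B P ω β ↔ ∀ n, annF B κ β n h ≤ 1 := by
  set S := {h : ℝ | annealedF B P ω β h = 0} with hS
  have hmem : ∀ h, h ∈ S ↔ ∀ n, annF B κ β n h ≤ 1 :=
    annealedF_eq_zero_iff hB hB2 hκ hκ2 hω β
  have hbdd : BddAbove S := ⟨0, fun x hx => by simpa using (hmem x).1 hx 0⟩
  have hne : S.Nonempty := ⟨-(β ^ 2 * (1 - 2 * κ)⁻¹), (hmem _).2 fun n =>
    annF_le_one_of_le hB hκ (by linarith) n (neg_le_neg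
      (mul_le_mul_of_nonneg_left (geom_sum_two_mul_le hκ hκ2 n) (sq_nonneg β)))⟩
  have hcl : IsClosed S := by
    have : S = ⋂ n, {h | annF B κ β n h ≤ 1} := by ext h; simp [hmem]
    rw [this]
    exact isClosed_iInter fun n => isClosed_le (continuous_annF n) continuous_const
  have hsup := hcl.csSup_mem hne hbdd
  constructor
  · exact fun hh n => (annF_mono hB n hh).trans ((hmem _).1 hsup n)
  · exact fun hh => le_csSup hbdd ((hmem _).2 hh)

/-- The sequence corrected by `log B` is monotone by superadditivity and bounded through Jensen's
inequality by the annealed one. Its limit is its supremum, hence the finite volume lower bounds. -/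
theorem tendsto_quenchedF_n_and_le (hB : 1 < B) (hκ : 0 ≤ κ) (hκ2 : κ < 1 / 2)
    (hω : IsHierGaussian κ P ω) (β h : ℝ) :
    Tendsto (quenchedF_n B P ω β h) atTop (𝓝 (quenchedF B P ω β h)) ∧
    ∀ n, (∫ a, log (partZ B β h ω n a) ∂P - log B) / 2 ^ n ≤ quenchedF B P ω β h := by
  set low : ℕ → ℝ := fun n => (∫ a, log (partZ B β h ω n a) ∂P - log B) / 2 ^ n with hlow
  have hmono : Monotone low := by
    refine monotone_nat_of_le_succ fun n => ?_
    have h1 := integral_log_partZ_succ_ge (β := β) (h := h) hB hω n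
    simp only [hlow]
    rw [pow_succ, div_le_div_iff₀ (by positivity) (by positivity)]
    have : (0 : ℝ) < 2 ^ n := by positivity
    nlinarith
  have hbdd : BddAbove (Set.range low) := by
    obtain ⟨c, hc⟩ := (tendsto_annealedF_n hB hκ hκ2 hω β h).bddAbove_range
    refine ⟨c, Set.forall_mem_range.2 fun n => ?_⟩
    refine le_trans ?_ (hc ⟨n, rfl⟩)
    have h1 := integral_log_partZ_le (β := β) (h := h) hB hω n
    simp only [hlow, annealedF_n]
    rw [div_eq_mul_one_div, mul_comm]
    have := log_pos hB
    exact mul_le_mul_of_nonneg_left (by linarith) (by positivity)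
  have hlim := tendsto_atTop_ciSup hmono hbdd
  have h2 : Tendsto (quenchedF_n B P ω β h) atTop (𝓝 (⨆ n, low n)) := by
    have h3 := hlim.add (tendsto_const_div_two_pow (log B))
    rw [add_zero] at h3
    refine h3.congr fun n => ?_
    simp only [hlow, quenchedF_n]; ring
  have h4 : quenchedF B P ω β h = ⨆ n, low n := h2.limUnder_eq
  rw [h4]
  exact ⟨h2, fun n => le_ciSup hbdd n⟩

end

end

end HierPinning

/-! ### Gaussian weights dominated by exponential weights. -/

namespace HierPinning

noncomputable section

/-- Geometric rate at which the effect of the correlations between blocks decays. -/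
def corrRate (B κ : ℝ) : ℝ := max (2 * κ) (4 * κ / B ^ 2)

theorem corrRate_pos {B κ : ℝ} (hκ : 0 < κ) : 0 < corrRate B κ :=
  lt_max_of_lt_left (by linarith)

theorem corrRate_lt_one {B κ : ℝ} (hB : 1 < B) (hκ : κ < min (B ^ 2 / 4) (1 / 2)) :
    corrRate B κ < 1 := by
  have h1 := hκ.trans_le (min_le_left _ _)
  have h2 := hκ.trans_le (min_le_right _ _)
  refine max_lt (by linarith) ((div_lt_one (by positivity)).2 (by linarith))

/-- The left side is monotone in `i`, so the worst case is `i = 0` or `i = n`; these give the two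
candidates in `corrRate`. -/
theorem two_mul_pow_le_corrRate {B κ : ℝ} (hB : 1 < B) (hκ : 0 < κ) {i n : ℕ} (hi : i ≤ n) :
    (2 * κ) ^ n * (2 / B ^ 2) ^ i ≤ corrRate B κ ^ n := by
  rcases le_total (2 / B ^ 2) 1 with h | h
  · calc (2 * κ) ^ n * (2 / B ^ 2) ^ i ≤ (2 * κ) ^ n * 1 := by
          gcongr; exact pow_le_one₀ (by positivity) h
      _ ≤ corrRate B κ ^ n := by
          rw [mul_one]; gcongr; exact le_max_left _ _
  · calc (2 * κ) ^ n * (2 / B ^ 2) ^ i ≤ (2 * κ) ^ n * (2 / B ^ 2) ^ n := by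
          gcongr
      _ = (4 * κ / B ^ 2) ^ n := by rw [← mul_pow]; congr 1; ring
      _ ≤ corrRate B κ ^ n := by
          gcongr; exact le_max_right _ _

/-- One factor `k` is kept and the other is replaced by its bound `M * 2 ^ n / B ^ i`: a Gaussian
exponent becomes a linear one, small by `corrRate B κ ^ n`. -/
theorem mul_sq_le_of_scale {B κ s τ M k : ℝ} (hB : 1 < B) (hκ : 0 < κ) (hτ : 0 ≤ τ) (hM : 0 ≤ M)
    (hk : 0 ≤ k) {i n : ℕ} (hi : i ≤ n) (hs : s ≤ τ * κ ^ n)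
    (hki : k * (B / 2) ^ i ≤ M * (2 ^ n / 2 ^ i)) :
    s * k ^ 2 ≤ τ * M * corrRate B κ ^ n * (k * (B / 2) ^ i) := by
  have hB0 : 0 < B := by linarith
  have h1 : k * B ^ i ≤ M * 2 ^ n := by
    rw [div_pow, mul_div_assoc', mul_div_assoc', div_le_div_iff_of_pos_right (by positivity)] at hki
    exact hki
  have h2 := two_mul_pow_le_corrRate hB hκ hi
  calc s * k ^ 2 ≤ τ * κ ^ n * k ^ 2 := by gcongr
    _ = τ * κ ^ n * k * (k * B ^ i) / B ^ i := by field_simp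
    _ ≤ τ * κ ^ n * k * (M * 2 ^ n) / B ^ i := by gcongr
    _ = τ * M * k * ((2 * κ) ^ n * (2 / B ^ 2) ^ i) * (B / 2) ^ i := by
        rw [mul_pow, div_pow, div_pow, ← pow_mul, mul_comm 2 i, pow_mul]; field_simp
    _ ≤ τ * M * k * (corrRate B κ ^ n) * (B / 2) ^ i := by gcongr
    _ = _ := by ring

/-- Either the degree is moderate for the window `m`, or there is a wider window `i` at which it is
moderate and just beyond which it is not; there the Gaussian exponent is still controllable and the
degree is large enough to be penalised. -/
theorem scale_dichotomy {B M k : ℝ} {n : ℕ} (h0 : k ≤ M * 2 ^ n) (m : ℕ) :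
    k * (B / 2) ^ m ≤ M * (2 ^ n / 2 ^ m) ∨
      ∃ i < m, k * (B / 2) ^ i ≤ M * (2 ^ n / 2 ^ i) ∧
        M * (2 ^ n / 2 ^ (i + 1)) < k * (B / 2) ^ (i + 1) := by
  induction m with
  | zero => left; simpa using h0
  | succ m ih =>
    rcases ih with h | ⟨i, hi, h⟩
    · rcases le_or_gt (k * (B / 2) ^ (m + 1)) (M * (2 ^ n / 2 ^ (m + 1))) with h' | h'
      · exact Or.inl h'
      · exact Or.inr ⟨m, Nat.lt_succ_self m, h, h'⟩
    · exact Or.inr ⟨i, hi.trans (Nat.lt_succ_self m), h⟩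

theorem exp_sub_one_le_mul_exp (z : ℝ) : exp z - 1 ≤ z * exp z := by
  have h1 := add_one_le_exp (-z)
  have h2 : (-z + 1) * exp z ≤ exp (-z) * exp z := mul_le_mul_of_nonneg_right h1 (exp_pos z).le
  rw [← exp_add, neg_add_cancel, exp_zero] at h2
  linarith

/-- Weights of the windows `Θ * (B / 2) ^ i`, `i < m`, in the bounds on Gaussian smoothing. -/
def tailWeight (B Θ L : ℝ) (n m : ℕ) (k : ℝ) : ℝ :=
  ∑ i ∈ Finset.range m, exp (-(L * (2 ^ n / 2 ^ i))) * exp (k * (Θ * (B / 2) ^ i - Θ * (B / 2) ^ m))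

theorem tailWeight_nonneg (B Θ L : ℝ) (n m : ℕ) (k : ℝ) : 0 ≤ tailWeight B Θ L n m k :=
  Finset.sum_nonneg fun _ _ => by positivity

/-- A single window suffices. Moving from window `m` back to window `i` gains at least `4 * α * z`
in the exponent, with `z = k * (B / 2) ^ i`, while the damping costs at most `α * z` because the
degree is large for window `i + 1`. -/
theorem le_tailWeight {B Θ L M k α : ℝ} (hB : 1 < B) (hB2 : B < 2) (hΘ : 0 < Θ) (hk : 0 ≤ k)
    (hα : α = Θ * (1 - B / 2) / 4) (hM : L ≤ M / 2 * α) {n m i : ℕ} (hi : i < m)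
    (hki : M * (2 ^ n / 2 ^ (i + 1)) < k * (B / 2) ^ (i + 1)) :
    exp (3 * α * (k * (B / 2) ^ i)) ≤ tailWeight B Θ L n m k := by
  have hα0 : 0 < α := by rw [hα]; have : 0 < 1 - B / 2 := by linarith
                         positivity
  refine le_trans ?_ (Finset.single_le_sum (fun j _ => by positivity) (Finset.mem_range.2 hi))
  rw [← exp_add]
  refine exp_le_exp.2 ?_
  have hp : (0 : ℝ) < (B / 2) ^ i := by positivity
  have h1 : (B / 2) ^ m ≤ (B / 2) ^ (i + 1) :=
    pow_le_pow_of_le_one (by positivity) (by linarith) hi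
  have h2 : M / 2 * (2 ^ n / 2 ^ i) ≤ k * (B / 2) ^ i := by
    have e : M * ((2 : ℝ) ^ n / 2 ^ (i + 1)) = M / 2 * (2 ^ n / 2 ^ i) := by
      rw [pow_succ]; field_simp
    rw [e] at hki
    refine hki.le.trans ?_
    gcongr k * ?_
    exact pow_le_pow_of_le_one (by positivity) (by linarith) (Nat.le_succ i)
  have h3 : L * (2 ^ n / 2 ^ i) ≤ α * (k * (B / 2) ^ i) := by
    calc L * ((2 : ℝ) ^ n / 2 ^ i) ≤ M / 2 * α * (2 ^ n / 2 ^ i) := by gcongr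
      _ = α * (M / 2 * (2 ^ n / 2 ^ i)) := by ring
      _ ≤ _ := by gcongr
  have h4 : 4 * α * (k * (B / 2) ^ i) ≤ k * (Θ * (B / 2) ^ i - Θ * (B / 2) ^ m) := by
    have e : 4 * α * (k * (B / 2) ^ i) = k * (Θ * (B / 2) ^ i - Θ * (B / 2) ^ (i + 1)) := by
      rw [hα, pow_succ]; ring
    rw [e]; gcongr
  linarith

/-- For moderate degrees `mul_sq_le_of_scale` makes the Gaussian exponent small. For the others it
is at most `α * z`, which fits inside the gain `3 * α * z` of `le_tailWeight` and leaves room for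
polynomial prefactors. -/
theorem exists_gaussian_weight_bound {B κ Θ L : ℝ} (hB : 1 < B) (hB2 : B < 2) (hκ : 0 < κ)
    (hκ' : κ < min (B ^ 2 / 4) (1 / 2)) (hΘ : 0 < Θ) (hL : 0 ≤ L) :
    ∃ C : ℝ, 1 ≤ C ∧ ∀ τ s : ℝ, 0 ≤ τ → C * τ ≤ 1 → 0 ≤ s → ∀ n : ℕ, s ≤ τ * κ ^ n →
      ∀ k : ℝ, 0 ≤ k → k ≤ 2 * 2 ^ n →
      (∀ m ≤ n, exp (s * k ^ 2) ≤
        exp (C * τ * corrRate B κ ^ n * (2 ^ n / 2 ^ m)) + tailWeight B Θ L n m k) ∧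
      (1 + k * (B / 2) ^ n) * (exp (s * k ^ 2) - 1) ≤
        C * τ * corrRate B κ ^ n * (1 + tailWeight B Θ L n n k) ∧
      (∀ m ≤ n, k * (B / 2) ^ n * exp (s * k ^ 2) ≤
        C * (exp (2 * (2 ^ n / 2 ^ m)) + tailWeight B Θ L n m k)) := by
  obtain ⟨α, hα⟩ : ∃ α, α = Θ * (1 - B / 2) / 4 := ⟨_, rfl⟩
  have hα0 : 0 < α := by
    have : 0 < 1 - B / 2 := by linarith
    rw [hα]; positivity
  -- `M ≥ 2` starts the dichotomy from `k ≤ 2 * 2 ^ n`, and `M / 2 * α ≥ L` lets the gain beat the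
  -- damping.
  obtain ⟨M, hM⟩ : ∃ M, M = 2 + 2 * L / α := ⟨_, rfl⟩
  have hM2 : 2 ≤ M := by rw [hM]; have : 0 ≤ 2 * L / α := by positivity
                         linarith
  have hML : L ≤ M / 2 * α := by
    have e : M / 2 * α = α + L := by rw [hM]; field_simp
    rw [e]; linarith
  have hM0 : 0 < M := by linarith
  set q := corrRate B κ with hq
  have hq0 : 0 < q := corrRate_pos hκ
  have hq1 : q < 1 := corrRate_lt_one hB hκ'
  have htail'' : ∀ (n m i : ℕ) (k : ℝ), 0 ≤ k → i < m →
      M * (2 ^ n / 2 ^ (i + 1)) < k * (B / 2) ^ (i + 1) →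
      exp (3 * α * (k * (B / 2) ^ i)) ≤ tailWeight B Θ L n m k := fun n m i k hk hi h =>
    le_tailWeight hB hB2 hΘ hk hα hML hi h
  obtain ⟨C, hCdef⟩ : ∃ C, C = M ^ 2 + 3 * (1 + M) * M ^ 2 + M * (1 / α) * (1 + 1 / α) + M +
    1 / α + M / α := ⟨_, rfl⟩
  have p1 : 0 ≤ M ^ 2 := by positivity
  have p2 : 0 ≤ 3 * (1 + M) * M ^ 2 := by positivity
  have p3 : 0 ≤ M * (1 / α) * (1 + 1 / α) := by positivity
  have p4 : 0 ≤ 1 / α := by positivity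
  have p5 : 0 ≤ M / α := by positivity
  have c1 : M ^ 2 ≤ C := by linarith
  have c2 : 3 * (1 + M) * M ^ 2 ≤ C := by linarith
  have c3 : M * (1 / α) * (1 + 1 / α) ≤ C := by linarith
  have c4 : M ≤ C := by linarith
  have c5 : 1 / α ≤ C := by linarith
  have c6 : M / α ≤ C := by linarith
  have hC0 : 0 ≤ C := by linarith
  clear hM hα hCdef p1 p2 p3 p4 p5
  refine ⟨C, by nlinarith, ?_⟩
  intro τ s hτ hC hs0 n hs k hk hkn
  have hτM2 : τ * M ^ 2 ≤ 1 :=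
    le_trans (by rw [mul_comm C]; exact mul_le_mul_of_nonneg_left c1 hτ) hC
  have hτM : τ * M ≤ α := by
    have : M / α * τ ≤ 1 := (mul_le_mul_of_nonneg_right c6 hτ).trans hC
    rw [div_mul_eq_mul_div, div_le_one hα0] at this
    linarith
  have hqn : q ^ n ≤ 1 := pow_le_one₀ hq0.le hq1.le
  have hqn0 : 0 < q ^ n := by positivity
  have hk0 : k ≤ M * 2 ^ n := hkn.trans (by gcongr)
  have hz0 : ∀ i, 0 ≤ k * (B / 2) ^ i := fun i => by positivity
  have hzn : ∀ i ≤ n, k * (B / 2) ^ n ≤ k * (B / 2) ^ i := fun i hi => by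
    gcongr k * ?_
    exact pow_le_pow_of_le_one (by positivity) (by linarith) hi
  have hsk : ∀ i ≤ n, k * (B / 2) ^ i ≤ M * (2 ^ n / 2 ^ i) →
      s * k ^ 2 ≤ τ * M * q ^ n * (k * (B / 2) ^ i) := fun i hi h =>
    mul_sq_le_of_scale hB hκ hτ hM0.le hk hi hs h
  have hskα : ∀ i ≤ n, k * (B / 2) ^ i ≤ M * (2 ^ n / 2 ^ i) →
      s * k ^ 2 ≤ α * (k * (B / 2) ^ i) := fun i hi h => by
    refine (hsk i hi h).trans (mul_le_mul_of_nonneg_right ?_ (hz0 i))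
    exact (mul_le_of_le_one_right (mul_nonneg hτ hM0.le) hqn).trans hτM
  have hskW : ∀ i ≤ n, k * (B / 2) ^ i ≤ M * (2 ^ n / 2 ^ i) →
      s * k ^ 2 ≤ τ * M ^ 2 * q ^ n * (2 ^ n / 2 ^ i) := fun i hi h => by
    refine (hsk i hi h).trans ?_
    calc _ ≤ τ * M * q ^ n * (M * (2 ^ n / 2 ^ i)) := by gcongr
      _ = _ := by ring
  have hzexp : ∀ z : ℝ, 0 ≤ z → z ≤ 1 / α * exp (α * z) := fun z hz => by
    rw [one_div_mul_eq_div, le_div_iff₀ hα0]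
    linarith [add_one_le_exp (α * z)]
  have htail' := fun m i => htail'' n m i k hk
  have htail := fun m => tailWeight_nonneg B Θ L n m k
  refine ⟨fun m hm => ?_, ?_, fun m hm => ?_⟩
  · rcases scale_dichotomy (B := B) hk0 m with h | ⟨i, hi, h, h'⟩
    · refine le_trans (exp_le_exp.2 ((hskW m hm h).trans ?_)) (le_add_of_nonneg_right (htail m))
      have : τ * M ^ 2 ≤ C * τ := by rw [mul_comm C]; exact mul_le_mul_of_nonneg_left c1 hτ
      gcongr
    · refine le_trans ?_ (le_add_of_nonneg_left (exp_nonneg _))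
      refine le_trans (exp_le_exp.2 ?_) (htail' m i hi h')
      have := hskα i (hi.le.trans hm) h
      have := mul_nonneg hα0.le (hz0 i)
      linarith
  · have hsq : 0 ≤ s * k ^ 2 := by positivity
    rcases scale_dichotomy (B := B) hk0 n with h | ⟨i, hi, h, h'⟩
    · have h1 := hskW n le_rfl h
      rw [div_self (by positivity), mul_one] at h1
      rw [div_self (by positivity), mul_one] at h
      have h2 : s * k ^ 2 ≤ 1 := h1.trans (mul_le_one₀ hτM2 hqn0.le hqn)
      have h3 : exp (s * k ^ 2) ≤ 3 := (exp_le_exp.2 h2).trans (by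
        have := exp_one_lt_d9; linarith)
      have h4 := exp_sub_one_le_mul_exp (s * k ^ 2)
      have h5 : exp (s * k ^ 2) - 1 ≤ τ * M ^ 2 * q ^ n * 3 :=
        h4.trans (mul_le_mul h1 h3 (exp_nonneg _) (by positivity))
      calc (1 + k * (B / 2) ^ n) * (exp (s * k ^ 2) - 1)
          ≤ (1 + M) * (τ * M ^ 2 * q ^ n * 3) := by
            refine mul_le_mul (by linarith) h5 ?_ (by positivity)
            linarith [one_le_exp hsq]
        _ = 3 * (1 + M) * M ^ 2 * τ * q ^ n * 1 := by ring
        _ ≤ C * τ * q ^ n * (1 + tailWeight B Θ L n n k) := by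
            have := htail n
            gcongr
            linarith
    · set z := k * (B / 2) ^ i with hz
      have hz0' : 0 ≤ z := hz0 i
      have h1 := hsk i hi.le h
      have h2 := hskα i hi.le h
      have h3 := htail' n i hi h'
      have h4 : exp (s * k ^ 2) - 1 ≤ τ * M * q ^ n * z * exp (α * z) :=
        (exp_sub_one_le_mul_exp _).trans
          (mul_le_mul h1 (exp_le_exp.2 h2) (exp_nonneg _) (by positivity))
      have h5 : 1 + z ≤ (1 + 1 / α) * exp (α * z) := by
        have := hzexp z hz0'
        have := one_le_exp (mul_nonneg hα0.le hz0')
        linarith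
      have h6 := hzn i hi.le
      calc (1 + k * (B / 2) ^ n) * (exp (s * k ^ 2) - 1)
          ≤ ((1 + 1 / α) * exp (α * z)) *
              (τ * M * q ^ n * (1 / α * exp (α * z)) * exp (α * z)) := by
            refine mul_le_mul (by linarith) (h4.trans ?_) ?_ (by positivity)
            · gcongr
              exact hzexp z hz0'
            · linarith [one_le_exp hsq]
        _ = M * (1 / α) * (1 + 1 / α) * τ * q ^ n * exp (3 * α * z) := by
            rw [show 3 * α * z = α * z + α * z + α * z by ring, exp_add, exp_add]; ring
        _ ≤ C * τ * q ^ n * (1 + tailWeight B Θ L n n k) := by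
            gcongr
            linarith
  · rcases scale_dichotomy (B := B) hk0 m with h | ⟨i, hi, h, h'⟩
    · set W : ℝ := 2 ^ n / 2 ^ m with hW
      have hW0 : 0 < W := by positivity
      have h1 := hskW m hm h
      have h2 : s * k ^ 2 ≤ W := h1.trans (mul_le_of_le_one_left hW0.le
        (mul_le_one₀ hτM2 hqn0.le hqn))
      calc k * (B / 2) ^ n * exp (s * k ^ 2) ≤ M * W * exp W := by
            exact mul_le_mul ((hzn m hm).trans h) (exp_le_exp.2 h2) (exp_nonneg _) (by positivity)
        _ ≤ M * exp W * exp W := by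
            gcongr
            linarith [add_one_le_exp W]
        _ = M * (exp (2 * W) + 0) := by rw [two_mul, exp_add]; ring
        _ ≤ C * (exp (2 * W) + tailWeight B Θ L n m k) := by
            gcongr
            exact htail m
    · set z := k * (B / 2) ^ i with hz
      have hz0' : 0 ≤ z := hz0 i
      have h2 := hskα i (hi.le.trans hm) h
      have h3 := htail' m i hi h'
      calc k * (B / 2) ^ n * exp (s * k ^ 2) ≤ (1 / α * exp (α * z)) * exp (α * z) := by
            exact mul_le_mul ((hzn i (hi.le.trans hm)).trans (hzexp z hz0')) (exp_le_exp.2 h2)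
              (exp_nonneg _) (by positivity)
        _ = 1 / α * (0 + exp (α * z + α * z)) := by rw [exp_add]; ring
        _ ≤ C * (exp (2 * (2 ^ n / 2 ^ m)) + exp (3 * α * z)) := by
            gcongr
            · exact exp_nonneg _
            · have := mul_nonneg hα0.le hz0'
              linarith
        _ ≤ _ := by gcongr

end

end HierPinning

/-! ### Smoothing estimates for polynomials controlled on a grid of windows. -/

namespace HierPinning

noncomputable section

open Polynomial

/-- Bounds on Gaussian weights by exponential weights, at scale `n` and for exponents at most
`2 * 2 ^ n`. -/
def WeightBound (B κ Θ L C : ℝ) : Prop :=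
  ∀ τ s : ℝ, 0 ≤ τ → C * τ ≤ 1 → 0 ≤ s → ∀ n : ℕ, s ≤ τ * κ ^ n →
    ∀ k : ℝ, 0 ≤ k → k ≤ 2 * 2 ^ n →
    (∀ m ≤ n, exp (s * k ^ 2) ≤
      exp (C * τ * corrRate B κ ^ n * (2 ^ n / 2 ^ m)) + tailWeight B Θ L n m k) ∧
    (1 + k * (B / 2) ^ n) * (exp (s * k ^ 2) - 1) ≤
      C * τ * corrRate B κ ^ n * (1 + tailWeight B Θ L n n k) ∧
    (∀ m ≤ n, k * (B / 2) ^ n * exp (s * k ^ 2) ≤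
      C * (exp (2 * (2 ^ n / 2 ^ m)) + tailWeight B Θ L n m k))

/-- Damped values of a polynomial at the windows `x₀ + Θ * (B / 2) ^ i`, `i < m`. -/
def tailSum (B Θ L x₀ : ℝ) (p : ℝ[X]) (n m : ℕ) : ℝ :=
  ∑ i ∈ Finset.range m, exp (-(L * (2 ^ n / 2 ^ i))) * ev p (x₀ + Θ * (B / 2) ^ i)

section

variable {B κ Θ L C x₀ τ s x : ℝ} {p : ℝ[X]} {n m : ℕ}

theorem wsum_tailWeight_le (hp : NonnegCoeff p) (hx : x ≤ x₀ + Θ * (B / 2) ^ m) :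
    wsum (fun k => tailWeight B Θ L n m k * exp (k * x)) p ≤ tailSum B Θ L x₀ p n m := by
  have h1 : (fun k : ℕ => tailWeight B Θ L n m k * exp (k * x)) = fun k : ℕ =>
      ∑ i ∈ Finset.range m, exp (-(L * (2 ^ n / 2 ^ i))) *
        (exp (k * (Θ * (B / 2) ^ i - Θ * (B / 2) ^ m)) * exp (k * x)) := by
    ext k; rw [tailWeight, Finset.sum_mul]
    exact Finset.sum_congr rfl fun i _ => by ring
  rw [h1, wsum_sum, tailSum]
  refine Finset.sum_le_sum fun i _ => ?_
  rw [wsum_const_mul, ev_eq_wsum]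
  refine mul_le_mul_of_nonneg_left (hp.wsum_le fun k _ => ?_) (exp_nonneg _)
  rw [← exp_add]
  refine exp_le_exp.2 ?_
  have := mul_le_mul_of_nonneg_left hx (Nat.cast_nonneg (α := ℝ) k)
  linarith

/-- With one unit of damping left over, each term is at most `R * exp (-w) ≤ R / w` for `w = 2 ^ n /
2 ^ i`, and the resulting geometric series is dominated by its last terms. -/
theorem tailSum_le {R Q : ℝ} (hR : 0 ≤ R) (hL : Q + 1 ≤ L)
    (h : ∀ i < m, ev p (x₀ + Θ * (B / 2) ^ i) ≤ R * exp (Q * (2 ^ n / 2 ^ i))) :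
    tailSum B Θ L x₀ p n m ≤ R * (2 ^ m / 2 ^ n) := by
  have h1 : tailSum B Θ L x₀ p n m ≤ ∑ i ∈ Finset.range m, R / 2 ^ n * 2 ^ i := by
    refine Finset.sum_le_sum fun i hi => ?_
    have hW : (0 : ℝ) < 2 ^ n / 2 ^ i := by positivity
    refine (mul_le_mul_of_nonneg_left (h i (Finset.mem_range.1 hi)) (exp_nonneg _)).trans ?_
    have e : exp (-(L * (2 ^ n / 2 ^ i))) * (R * exp (Q * (2 ^ n / 2 ^ i))) =
        R * exp (-((L - Q) * (2 ^ n / 2 ^ i))) := by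
      rw [mul_left_comm, ← exp_add]; congr 2; ring
    rw [e, div_mul_eq_mul_div, mul_div_assoc]
    refine mul_le_mul_of_nonneg_left ?_ hR
    rw [← inv_div ((2 : ℝ) ^ n) (2 ^ i), exp_neg]
    refine inv_anti₀ hW ?_
    have := add_one_le_exp ((L - Q) * ((2 : ℝ) ^ n / 2 ^ i))
    nlinarith
  refine h1.trans ?_
  rw [← Finset.mul_sum, div_mul_eq_mul_div, mul_div_assoc']
  gcongr
  rw [geom_sum_eq (by norm_num)]
  norm_num

theorem ev_heat_le_window (hW : WeightBound B κ Θ L C) (hp : NonnegCoeff p)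
    (hd : p.natDegree ≤ 2 * 2 ^ n) (hτ : 0 ≤ τ) (hCτ : C * τ ≤ 1) (hs : 0 ≤ s)
    (hsn : s ≤ τ * κ ^ n) (hm : m ≤ n) (hx : x ≤ x₀ + Θ * (B / 2) ^ m) :
    ev (heat s p) x ≤ exp (C * τ * corrRate B κ ^ n * (2 ^ n / 2 ^ m)) * ev p x +
      tailSum B Θ L x₀ p n m := by
  refine le_trans ?_ (add_le_add_right (wsum_tailWeight_le hp hx) _)
  rw [ev_heat, ev_eq_wsum, ← wsum_const_mul, ← wsum_add_right]
  refine hp.wsum_le fun k hk => ?_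
  have h1 := (hW τ s hτ hCτ hs n hsn k (Nat.cast_nonneg k)
    (by exact_mod_cast hk.trans hd)).1 m hm
  rw [← add_mul]
  refine mul_le_mul_of_nonneg_right (le_trans (exp_le_exp.2 ?_) h1) (exp_nonneg _)
  have : 0 ≤ s * (k : ℝ) ^ 2 := by positivity
  linarith

/-- In the weight `1 + k * (B / 2) ^ n`, the `1` serves the effect of smoothing on values and the
second term its effect on increments, where a derivative brings down a factor `k`. -/
theorem wsum_heat_sub_le (hW : WeightBound B κ Θ L C) (hp : NonnegCoeff p)
    (hd : p.natDegree ≤ 2 * 2 ^ n) (hτ : 0 ≤ τ) (hCτ : C * τ ≤ 1) (hs : 0 ≤ s)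
    (hsn : s ≤ τ * κ ^ n) (hB : 0 ≤ B) (hC : 0 ≤ C) (hκ : 0 < κ)
    (hx : x ≤ x₀ + Θ * (B / 2) ^ n) :
    wsum (fun k => (1 + k * (B / 2) ^ n) * (exp (s * (k : ℝ) ^ 2 / 2) - 1) * exp (k * x)) p ≤
      C * τ * corrRate B κ ^ n * (ev p (x₀ + Θ * (B / 2) ^ n) + tailSum B Θ L x₀ p n n) := by
  have hq := corrRate_pos (B := B) hκ
  refine le_trans ?_ (mul_le_mul_of_nonneg_left (add_le_add (hp.ev_mono hx)
    (wsum_tailWeight_le hp hx)) (by positivity))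
  rw [ev_eq_wsum, ← wsum_add_right, ← wsum_const_mul]
  refine hp.wsum_le fun k hk => ?_
  have h1 := (hW τ s hτ hCτ hs n hsn k (Nat.cast_nonneg k)
    (by exact_mod_cast hk.trans hd)).2.1
  rw [← one_add_mul, ← mul_assoc]
  refine mul_le_mul_of_nonneg_right (le_trans ?_ h1) (exp_nonneg _)
  have : 0 ≤ s * (k : ℝ) ^ 2 := by positivity
  gcongr
  linarith

theorem wsum_mul_heat_le (hW : WeightBound B κ Θ L C) (hp : NonnegCoeff p)
    (hd : p.natDegree ≤ 2 * 2 ^ n) (hτ : 0 ≤ τ) (hCτ : C * τ ≤ 1) (hs : 0 ≤ s)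
    (hsn : s ≤ τ * κ ^ n) (hC : 0 ≤ C) (hm : m ≤ n) (hx : x ≤ x₀ + Θ * (B / 2) ^ m) :
    (B / 2) ^ n * wsum (fun k => k * (exp (s * (k : ℝ) ^ 2) * exp (k * x))) p ≤
      C * (exp (2 * (2 ^ n / 2 ^ m)) * ev p (x₀ + Θ * (B / 2) ^ m) +
        tailSum B Θ L x₀ p n m) := by
  refine le_trans ?_ (mul_le_mul_of_nonneg_left (add_le_add
    (mul_le_mul_of_nonneg_left (hp.ev_mono hx) (exp_nonneg _)) (wsum_tailWeight_le hp hx)) hC)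
  rw [ev_eq_wsum, ← wsum_const_mul, ← wsum_const_mul, ← wsum_add_right, ← wsum_const_mul]
  refine hp.wsum_le fun k hk => ?_
  have h1 := (hW τ s hτ hCτ hs n hsn k (Nat.cast_nonneg k)
    (by exact_mod_cast hk.trans hd)).2.2 m hm
  rw [← add_mul, ← mul_assoc C, ← mul_assoc, ← mul_assoc, mul_comm ((B / 2) ^ n)]
  exact mul_le_mul_of_nonneg_right h1 (exp_nonneg _)

theorem ev_heat_sub_le (hW : WeightBound B κ Θ L C) (hp : NonnegCoeff p)
    (hd : p.natDegree ≤ 2 * 2 ^ n) (hτ : 0 ≤ τ) (hCτ : C * τ ≤ 1) (hs : 0 ≤ s)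
    (hsn : s ≤ τ * κ ^ n) (hB : 0 ≤ B) (hC : 0 ≤ C) (hκ : 0 < κ)
    (hx : x ≤ x₀ + Θ * (B / 2) ^ n) :
    ev (heat s p) x - ev p x ≤
      C * τ * corrRate B κ ^ n * (ev p (x₀ + Θ * (B / 2) ^ n) + tailSum B Θ L x₀ p n n) := by
  refine le_trans ?_ (wsum_heat_sub_le hW hp hd hτ hCτ hs hsn hB hC hκ hx)
  rw [ev_heat, ev_eq_wsum, ← wsum_sub_right]
  refine hp.wsum_le fun k _ => ?_
  rw [← sub_one_mul]
  have h1 : 0 ≤ exp (s * (k : ℝ) ^ 2 / 2) - 1 := by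
    have := one_le_exp (show 0 ≤ s * (k : ℝ) ^ 2 / 2 by positivity)
    linarith
  refine mul_le_mul_of_nonneg_right (le_mul_of_one_le_left h1 ?_) (exp_nonneg _)
  have : 0 ≤ (k : ℝ) * (B / 2) ^ n := by positivity
  linarith

/-- By convexity `exp (k (x + y)) - exp (k x) ≤ k y exp (k (x + y))`, and `k = (2 / B) ^ n * (k * (B
/ 2) ^ n)`: the error is proportional to the rescaled increment `(2 / B) ^ n * y`, so it only
perturbs the slope. -/
theorem ev_heat_diff_le (hW : WeightBound B κ Θ L C) (hp : NonnegCoeff p)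
    (hd : p.natDegree ≤ 2 * 2 ^ n) (hτ : 0 ≤ τ) (hCτ : C * τ ≤ 1) (hs : 0 ≤ s)
    (hsn : s ≤ τ * κ ^ n) (hB : 0 < B) (hC : 0 ≤ C) (hκ : 0 < κ) {y : ℝ} (hy : 0 ≤ y)
    (hx : x + y ≤ x₀ + Θ * (B / 2) ^ n) :
    ev (heat s p) (x + y) - ev (heat s p) x ≤ ev p (x + y) - ev p x +
      (2 / B) ^ n * y * (C * τ * corrRate B κ ^ n *
        (ev p (x₀ + Θ * (B / 2) ^ n) + tailSum B Θ L x₀ p n n)) := by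
  have h0 := wsum_heat_sub_le hW hp hd hτ hCτ hs hsn hB.le hC hκ hx
  refine le_trans ?_ (add_le_add_right (mul_le_mul_of_nonneg_left h0
    (show 0 ≤ (2 / B) ^ n * y by positivity)) _)
  rw [ev_heat, ev_heat, ev_eq_wsum, ev_eq_wsum, ← wsum_sub_right, ← wsum_sub_right,
    ← wsum_const_mul, ← wsum_add_right]
  refine hp.wsum_le fun k _ => ?_
  have hE : 0 ≤ exp (s * (k : ℝ) ^ 2 / 2) - 1 := by
    have := one_le_exp (show 0 ≤ s * (k : ℝ) ^ 2 / 2 by positivity)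
    linarith
  have hk : (0 : ℝ) ≤ k := Nat.cast_nonneg k
  have h1 : exp (k * (x + y)) - exp (k * x) ≤ k * y * exp (k * (x + y)) := by
    have e : exp (k * x) = exp (-(k * y)) * exp (k * (x + y)) := by rw [← exp_add]; congr 1; ring
    have := mul_le_mul_of_nonneg_right (add_one_le_exp (-(k * y))) (exp_nonneg (k * (x + y)))
    rw [e]; linarith
  have h2 : (2 / B) ^ n * (B / 2) ^ n = 1 := by
    rw [← mul_pow, div_mul_div_comm, mul_comm B, div_self (by positivity), one_pow]
  have h3 := mul_le_mul_of_nonneg_left h1 hE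
  have h4 : 0 ≤ (2 / B) ^ n * y * ((exp (s * (k : ℝ) ^ 2 / 2) - 1) * exp (k * (x + y))) := by
    have := mul_nonneg hE (exp_nonneg (k * (x + y)))
    positivity
  have e : (2 / B) ^ n * y * ((1 + k * (B / 2) ^ n) * (exp (s * (k : ℝ) ^ 2 / 2) - 1) *
      exp (k * (x + y))) = (2 / B) ^ n * y * ((exp (s * (k : ℝ) ^ 2 / 2) - 1) * exp (k * (x + y))) +
      ((2 / B) ^ n * (B / 2) ^ n) * ((exp (s * (k : ℝ) ^ 2 / 2) - 1) *
        (k * y * exp (k * (x + y)))) := by ring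
  rw [e, h2]
  linarith

end

end

end HierPinning

/-! ### One step of the annealed recursion around a base point. -/

namespace HierPinning

noncomputable section

open Polynomial

/-- The `i`-th window of the scale-`r` grid. -/
def window (B θ : ℝ) (r i : ℕ) : ℝ := θ * (2 / B) ^ r * (B / 2) ^ i

theorem window_nonneg {B θ : ℝ} (hB : 1 < B) (hθ : 0 ≤ θ) (r i : ℕ) : 0 ≤ window B θ r i := by
  unfold window; positivity

theorem two_div_pow_mul_div_two_pow {B : ℝ} (hB : 1 < B) (n : ℕ) :
    (2 / B) ^ n * (B / 2) ^ n = 1 := by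
  rw [← mul_pow, div_mul_div_comm, mul_comm B, div_self (by positivity), one_pow]

theorem window_add {B θ : ℝ} (hB : 1 < B) (r n : ℕ) : window B θ r (n + r) = θ * (B / 2) ^ n := by
  have := two_div_pow_mul_div_two_pow hB r
  rw [window, pow_add]
  linear_combination θ * (B / 2) ^ n * this

theorem window_anti {B θ : ℝ} (hB : 1 < B) (hB2 : B < 2) (hθ : 0 ≤ θ) (r : ℕ) {i j : ℕ}
    (hij : i ≤ j) : window B θ r j ≤ window B θ r i := by
  unfold window
  refine mul_le_mul_of_nonneg_left ?_ (by positivity)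
  exact pow_le_pow_of_le_one (by positivity) (by linarith) hij

/-- Upper control of `annF` at level `n` around a base point `x₀`. -/
structure UpperBound (B κ β θ b : ℝ) (r n : ℕ) (σ x₀ : ℝ) : Prop where
  le_one : annF B κ β n x₀ ≤ 1
  near : ∀ y, 0 ≤ y → y ≤ θ * (B / 2) ^ n → annF B κ β n (x₀ + y) - annF B κ β n x₀ ≤
    (1 + σ) * ((2 / B) ^ n * y) + b * ((2 / B) ^ n * y) ^ 2
  far : ∀ i ≤ n + r, annF B κ β n (x₀ + window B θ r i) ≤
    exp (2 ^ (n + r) / 2 ^ i * (3 * θ + 2 + σ) - 2)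

/-- Upper control of `annG` at level `n` around a base point `x₀`. -/
structure StepBound (B κ β θ b : ℝ) (r n : ℕ) (σ ρ x₀ : ℝ) : Prop where
  gap : annG B κ β n x₀ - annF B κ β n x₀ ≤ ρ
  near : ∀ y, 0 ≤ y → y ≤ θ * (B / 2) ^ n → annG B κ β n (x₀ + y) - annG B κ β n x₀ ≤
    (1 + σ) * ((2 / B) ^ n * y) + b * ((2 / B) ^ n * y) ^ 2
  far : ∀ i ≤ n + r, annG B κ β n (x₀ + window B θ r i) ≤
    exp (2 ^ (n + r) / 2 ^ i * (3 * θ + 2 + σ) - 2 + 2 ^ i / 2 ^ (n + r))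

section

variable {B κ β θ b C : ℝ} {r n : ℕ} {σ x₀ : ℝ}

theorem one_le_two_pow_div {i n : ℕ} (h : i ≤ n) : (1 : ℝ) ≤ 2 ^ n / 2 ^ i := by
  rw [le_div_iff₀ (by positivity), one_mul]
  exact pow_le_pow_right₀ (by norm_num) h

theorem natDegree_annPoly_le_shift (r : ℕ) : (annPoly B κ β n).natDegree ≤ 2 * 2 ^ (n + r) := by
  refine (natDegree_annPoly_le n).trans ?_
  have : 2 ^ n ≤ 2 ^ (n + r) := Nat.pow_le_pow_right (by norm_num) (Nat.le_add_right _ _)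
  omega

theorem kappa_pow_shift (hκ : 0 < κ) : β ^ 2 / κ ^ r * κ ^ (n + r) = β ^ 2 * κ ^ n := by
  rw [pow_add]; field_simp

theorem UpperBound.tail_le (hU : UpperBound B κ β θ b r n σ x₀) (hσ : σ ≤ 1)
    {m : ℕ} (hm : m ≤ n + r) :
    tailSum B (θ * (2 / B) ^ r) (3 * θ + 4) x₀ (annPoly B κ β n) (n + r) m ≤
      2 ^ m / 2 ^ (n + r) := by
  have h := tailSum_le (B := B) (Θ := θ * (2 / B) ^ r) (L := 3 * θ + 4) (x₀ := x₀) (n := n + r)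
    (m := m) (R := 1) (Q := 3 * θ + 3) (p := annPoly B κ β n) zero_le_one
    (by linarith) (fun i hi => ?_)
  · simpa using h
  · refine (hU.far i (hi.le.trans hm)).trans ?_
    rw [one_mul]
    refine exp_le_exp.2 ?_
    have := one_le_two_pow_div (hi.le.trans hm)
    nlinarith

/-- The weight bounds are applied at scale `n + r` with `τ = β ^ 2 / κ ^ r`, so that the grid can
start `r` levels wider than the Taylor window. The far bounds make the tails `O(1)`, and the damping
`3 * θ + 4` exceeds their rate `3 * θ + 3` by exactly the unit required in `tailSum_le`. -/
theorem UpperBound.step (hU : UpperBound B κ β θ b r n σ x₀) (hB : 1 < B)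
    (hκ : 0 < κ) (hκ1 : κ ≤ 1) (hθ : 0 ≤ θ) (hσ0 : 0 ≤ σ) (hσ : σ ≤ 1) (hC : 0 ≤ C)
    (hW : WeightBound B κ (θ * (2 / B) ^ r) (3 * θ + 4) C) (hCτ : C * (β ^ 2 / κ ^ r) ≤ 1) :
    StepBound B κ β θ b r n
      (σ + max ((2 / B) ^ r) 1 *
        (C * (β ^ 2 / κ ^ r) * corrRate B κ ^ (n + r) * (exp (3 * θ + 3) + 1)))
      (C * (β ^ 2 / κ ^ r) * corrRate B κ ^ (n + r) * (exp (3 * θ + 3) + 1)) x₀ := by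
  have hq := corrRate_pos (B := B) hκ
  have hp := nonnegCoeff_annPoly (κ := κ) (β := β) hB n
  have hd := natDegree_annPoly_le_shift (B := B) (κ := κ) (β := β) (n := n) r
  have hs := stepVar_nonneg (β := β) hκ1 hκ.le n
  have hsn : stepVar κ β n ≤ β ^ 2 / κ ^ r * κ ^ (n + r) := by
    rw [kappa_pow_shift hκ]; exact stepVar_le hκ.le n
  have hτ : 0 ≤ β ^ 2 / κ ^ r := by positivity
  have hwin := window_add (θ := θ) hB r n
  rw [window] at hwin
  have hfar : ev (annPoly B κ β n) (x₀ + θ * (2 / B) ^ r * (B / 2) ^ (n + r)) ≤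
      exp (3 * θ + 3) := by
    refine (hU.far (n + r) le_rfl).trans (exp_le_exp.2 ?_)
    rw [div_self (by positivity)]; linarith
  have htail : tailSum B (θ * (2 / B) ^ r) (3 * θ + 4) x₀ (annPoly B κ β n)
      (n + r) (n + r) ≤ 1 := by
    have := hU.tail_le hσ (le_refl (n + r))
    rwa [div_self (by positivity)] at this
  have hft := mul_le_mul_of_nonneg_left (add_le_add hfar htail)
    (show 0 ≤ C * (β ^ 2 / κ ^ r) * corrRate B κ ^ (n + r) by positivity)
  set ρ := C * (β ^ 2 / κ ^ r) * corrRate B κ ^ (n + r) * (exp (3 * θ + 3) + 1) with hρ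
  have hρ0 : 0 ≤ ρ := by positivity
  refine ⟨?_, fun y hy hyθ => ?_, fun i hi => ?_⟩
  · refine (ev_heat_sub_le hW hp hd hτ hCτ hs hsn (by linarith) hC hκ (x₀ := x₀) ?_).trans hft
    rw [hwin]
    have : 0 ≤ θ * (B / 2) ^ n := by positivity
    linarith
  · have hx : x₀ + y ≤ x₀ + θ * (2 / B) ^ r * (B / 2) ^ (n + r) := by rw [hwin]; linarith
    have h1 := ev_heat_diff_le hW hp hd hτ hCτ hs hsn (by linarith) hC hκ hy hx
    have h2 := hU.near y hy hyθ
    have hY : 0 ≤ (2 / B) ^ n * y := by positivity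
    have h3 : (2 / B) ^ (n + r) * y * (C * (β ^ 2 / κ ^ r) * corrRate B κ ^ (n + r) *
        (ev (annPoly B κ β n) (x₀ + θ * (2 / B) ^ r * (B / 2) ^ (n + r)) +
          tailSum B (θ * (2 / B) ^ r) (3 * θ + 4) x₀ (annPoly B κ β n) (n + r) (n + r))) ≤
        max ((2 / B) ^ r) 1 * ρ * ((2 / B) ^ n * y) := by
      calc _ ≤ (2 / B) ^ (n + r) * y * ρ := mul_le_mul_of_nonneg_left hft (by positivity)
        _ = (2 / B) ^ r * ρ * ((2 / B) ^ n * y) := by rw [pow_add]; ring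
        _ ≤ _ := by gcongr; exact le_max_left _ _
    simp only [annG, annF] at h1 h2 ⊢
    linarith
  · set W : ℝ := 2 ^ (n + r) / 2 ^ i with hWdef
    have hW1 : 1 ≤ W := one_le_two_pow_div hi
    have h1 := ev_heat_le_window hW hp hd hτ hCτ hs hsn hi (x₀ := x₀)
      (le_refl (x₀ + θ * (2 / B) ^ r * (B / 2) ^ i))
    have h2 := hU.tail_le hσ hi
    have h3 := hU.far i hi
    rw [← hWdef] at h1 h3
    have e : (2 : ℝ) ^ i / 2 ^ (n + r) = W⁻¹ := by rw [hWdef, inv_div]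
    rw [e] at h2 ⊢
    set A := C * (β ^ 2 / κ ^ r) * corrRate B κ ^ (n + r) with hA
    have hA0 : 0 ≤ A := by positivity
    have hAρ : A ≤ max ((2 / B) ^ r) 1 * ρ := by
      have h4 : A ≤ ρ := by
        rw [hρ]
        refine le_mul_of_one_le_right hA0 ?_
        linarith [exp_pos (3 * θ + 3)]
      exact h4.trans (le_mul_of_one_le_left hρ0 (le_max_right _ _))
    set E := W * (3 * θ + 2 + (σ + max ((2 / B) ^ r) 1 * ρ)) - 2 with hE
    have hE0 : 0 ≤ E := by
      have : 0 ≤ max ((2 / B) ^ r) 1 * ρ := hA0.trans hAρ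
      rw [hE]; nlinarith
    have h5 : exp (A * W) * annF B κ β n (x₀ + window B θ r i) ≤ exp E := by
      refine (mul_le_mul_of_nonneg_left h3 (exp_nonneg _)).trans ?_
      rw [← exp_add]
      refine exp_le_exp.2 ?_
      rw [hE]; nlinarith
    -- The additive tail is absorbed into the exponent through `e ^ E + w ≤ e ^ E * (1 + w) ≤ e ^ (E
    -- + w)`, valid since `E ≥ 0`.
    have hWi : 0 ≤ W⁻¹ := by positivity
    calc annG B κ β n (x₀ + window B θ r i) ≤ exp E + W⁻¹ :=
          h1.trans (add_le_add h5 h2)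
      _ ≤ exp E * (W⁻¹ + 1) := by nlinarith [one_le_exp hE0]
      _ ≤ exp E * exp W⁻¹ := by gcongr; exact add_one_le_exp _
      _ = exp (E + W⁻¹) := (exp_add _ _).symm

/-- Near the base point the increment `Δ` becomes `(2 g Δ + Δ ^ 2) / B` with `g ≤ 1`; the linear
part reproduces the slope, and the square is absorbed because the rescaled quadratic term gains the
factor `2 / B > 1`. Farther away the bound is squared, except at the innermost window, where the
near bound is used. -/
theorem StepBound.upperBound_succ {ρ : ℝ} (hS : StepBound B κ β θ b r n σ ρ x₀) (hB : 1 < B)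
    (hB2 : B < 2) (hκ : 0 < κ) (hκ1 : κ ≤ 1) (hθ : 0 ≤ θ) (hσ0 : 0 ≤ σ) (hσ : σ ≤ 1)
    (hb : 9 / 2 ≤ b * (1 - B / 2)) (hbθ : b * θ = 1) (hg : annG B κ β n x₀ ≤ 1) :
    UpperBound B κ β θ b r (n + 1) σ x₀ := by
  have hB0 : 0 < B := by linarith
  have hg0 := annG_pos (β := β) hB hκ.le hκ1 n x₀
  have hb0 : 0 ≤ b := by nlinarith
  have hle : annF B κ β (n + 1) x₀ ≤ 1 := by
    rw [annF_succ, div_le_one hB0]; nlinarith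
  have hnear : ∀ y, 0 ≤ y → y ≤ θ * (B / 2) ^ (n + 1) →
      annF B κ β (n + 1) (x₀ + y) - annF B κ β (n + 1) x₀ ≤
      (1 + σ) * ((2 / B) ^ (n + 1) * y) + b * ((2 / B) ^ (n + 1) * y) ^ 2 := by
    intro y hy hyθ
    have h1 := hS.near y hy (hyθ.trans (by
      gcongr ?_ * ?_
      exact pow_le_pow_of_le_one (by positivity) (by linarith) (Nat.le_succ n)))
    set Y := (2 / B) ^ n * y with hY
    have hY0 : 0 ≤ Y := by positivity
    have hYθ : Y ≤ θ := by
      have h2 : (2 / B) ^ n * y ≤ (2 / B) ^ n * (θ * (B / 2) ^ (n + 1)) := by gcongr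
      have h3 : (2 / B) ^ n * (θ * (B / 2) ^ (n + 1)) = θ * (B / 2) := by
        rw [pow_succ]
        linear_combination θ * (B / 2) * two_div_pow_mul_div_two_pow hB n
      rw [h3] at h2
      nlinarith
    have e : (2 / B) ^ (n + 1) * y = 2 / B * Y := by rw [pow_succ, hY]; ring
    rw [e, annF_succ, annF_succ, ← sub_div, div_le_iff₀ hB0]
    set Δ := annG B κ β n (x₀ + y) - annG B κ β n x₀ with hΔ
    have hΔ0 : 0 ≤ Δ := sub_nonneg.2 (annG_mono hB n (by linarith))
    have e2 : annG B κ β n (x₀ + y) = annG B κ β n x₀ + Δ := by rw [hΔ]; ring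
    rw [e2]
    have h4 : b * Y ≤ 1 := by rw [← hbθ]; gcongr
    have h5 : Δ ≤ 3 * Y := by nlinarith
    have h6 : Δ ^ 2 ≤ 9 * Y ^ 2 := by nlinarith
    have e3 : ((1 + σ) * (2 / B * Y) + b * (2 / B * Y) ^ 2) * B =
        2 * (1 + σ) * Y + 4 * b * Y ^ 2 / B := by field_simp; ring
    rw [e3]
    -- Here `Δ ≤ 3 * Y`, and `b * (1 - B / 2) ≥ 9 / 2` is what pays for `Δ ^ 2 ≤ 9 * Y ^ 2`.
    have h7 : 4 * b * Y ^ 2 / B ≥ 2 * b * Y ^ 2 + 9 * Y ^ 2 := by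
      rw [ge_iff_le, le_div_iff₀ hB0]
      have : 0 ≤ Y ^ 2 := sq_nonneg Y
      nlinarith
    nlinarith
  refine ⟨hle, hnear, fun i hi => ?_⟩
  rcases Nat.lt_or_ge i (n + 1 + r) with h | h
  · have hi' : i ≤ n + r := by omega
    have h1 := hS.far i hi'
    set W : ℝ := 2 ^ (n + r) / 2 ^ i with hW
    have hW1 : 1 ≤ W := one_le_two_pow_div hi'
    have e : (2 : ℝ) ^ i / 2 ^ (n + r) = W⁻¹ := by rw [hW, inv_div]
    have e' : (2 : ℝ) ^ (n + 1 + r) / 2 ^ i = 2 * W := by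
      rw [hW, add_right_comm, pow_succ]; ring
    rw [e] at h1
    rw [e']
    set E := W * (3 * θ + 2 + σ) - 2 + W⁻¹ with hE
    have hWi : 0 ≤ W⁻¹ := by positivity
    have hWi1 : W⁻¹ ≤ 1 := inv_le_one_of_one_le₀ hW1
    have hE0 : 0 ≤ E := by rw [hE]; nlinarith
    have h0 := (annG_pos (β := β) hB hκ.le hκ1 n (x₀ + window B θ r i)).le
    have h2 : annG B κ β n (x₀ + window B θ r i) ^ 2 ≤ exp (2 * E) := by
      rw [two_mul, exp_add, ← pow_two]; gcongr
    have h3 : 1 ≤ exp (2 * E) := one_le_exp (by linarith)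
    have h4 : annF B κ β (n + 1) (x₀ + window B θ r i) ≤ exp (2 * E) := by
      rw [annF_succ, div_le_iff₀ hB0]; nlinarith
    -- Doubling the exponent turns `-2 + W⁻¹` into `-4 + 2 * W⁻¹ ≤ -2`, so the offset `-2`
    -- reproduces itself.
    refine h4.trans (exp_le_exp.2 ?_)
    rw [hE]; linarith
  · obtain rfl : i = n + 1 + r := le_antisymm hi h
    rw [window_add hB, div_self (by positivity)]
    have h1 := hnear (θ * (B / 2) ^ (n + 1)) (by positivity) le_rfl
    have e : (2 / B) ^ (n + 1) * (θ * (B / 2) ^ (n + 1)) = θ := by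
      linear_combination θ * two_div_pow_mul_div_two_pow hB (n + 1)
    rw [e] at h1
    have h2 : annF B κ β (n + 1) (x₀ + θ * (B / 2) ^ (n + 1)) ≤ 3 * θ + 1 := by nlinarith
    refine h2.trans ((add_one_le_exp _).trans (exp_le_exp.2 ?_))
    linarith

theorem upperBound_zero (hB : 1 < B) (hB2 : B < 2) (hθ : 0 ≤ θ) (hθ1 : θ ≤ 1) (hb : 1 ≤ b)
    (hx : x₀ ≤ 0) : UpperBound B κ β θ b r 0 0 x₀ := by
  refine ⟨by simpa using hx, fun y hy hyθ => ?_, fun i hi => ?_⟩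
  · simp only [annF_zero, pow_zero, one_mul, add_zero, mul_one] at *
    rw [exp_add, ← mul_sub_one]
    have h1 : exp y - 1 ≤ y + y ^ 2 := by
      have := abs_exp_sub_one_sub_id_le (x := y) (by rw [abs_of_nonneg hy]; linarith)
      have := (abs_le.1 this).2
      linarith
    have h2 : 0 ≤ exp y - 1 := by linarith [add_one_le_exp y]
    have h3 : exp x₀ ≤ 1 := exp_le_one_iff.2 hx
    nlinarith [sq_nonneg y]
  · rw [annF_zero]
    refine exp_le_exp.2 ?_
    rw [zero_add] at hi ⊢
    have hW := one_le_two_pow_div hi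
    have h1 : window B θ r i ≤ θ * (2 ^ r / 2 ^ i) := by
      obtain ⟨d, rfl⟩ := Nat.exists_eq_add_of_le hi
      have h2 := two_div_pow_mul_div_two_pow hB i
      have e : window B θ (i + d) i = θ * (2 / B) ^ d := by
        rw [window, pow_add]; linear_combination θ * (2 / B) ^ d * h2
      have e' : (2 : ℝ) ^ (i + d) / 2 ^ i = 2 ^ d := by rw [pow_add]; field_simp
      rw [e, e']
      gcongr
      rw [div_le_iff₀ (by linarith)]; linarith
    nlinarith

end

end

end HierPinning

/-! ### The annealed recursion at its critical point. -/

namespace HierPinning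

noncomputable section

open Polynomial

/-- Width of the window around the critical point in which the annealed recursion is controlled
by its Taylor expansion. -/
def baseWidth (B : ℝ) : ℝ := 2 / 9 * (1 - B / 2)

/-- Critical points of the annealed recursion. -/
structure IsCritical (B κ β x₀ : ℝ) : Prop where
  le_one : ∀ n, annF B κ β n x₀ ≤ 1
  exists_gt : ∀ x, x₀ < x → ∃ n, 1 < annF B κ β n x

section

variable {B κ β θ b c C : ℝ} {r n : ℕ} {σ σ' ρ ρ' x₀ : ℝ}

theorem baseWidth_pos (hB2 : B < 2) : 0 < baseWidth B := by unfold baseWidth; linarith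

theorem baseWidth_lt_one (hB : 1 < B) : baseWidth B < 1 := by unfold baseWidth; linarith

theorem UpperBound.mono (h : UpperBound B κ β θ b r n σ x₀) (hB : 1 < B) (hσ : σ ≤ σ') :
    UpperBound B κ β θ b r n σ' x₀ := by
  refine ⟨h.le_one, fun y hy hyθ => (h.near y hy hyθ).trans ?_, fun i hi => (h.far i hi).trans ?_⟩
  · have : 0 ≤ (2 / B) ^ n * y := by positivity
    gcongr
  · gcongr

theorem StepBound.mono (h : StepBound B κ β θ b r n σ ρ x₀) (hB : 1 < B) (hσ : σ ≤ σ')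
    (hρ : ρ ≤ ρ') : StepBound B κ β θ b r n σ' ρ' x₀ := by
  refine ⟨h.gap.trans hρ, fun y hy hyθ => (h.near y hy hyθ).trans ?_,
    fun i hi => (h.far i hi).trans ?_⟩
  · have : 0 ≤ (2 / B) ^ n * y := by positivity
    gcongr
  · gcongr

theorem IsCritical.annG_le_one (h : IsCritical B κ β x₀) (hB : 1 < B) (n : ℕ) :
    annG B κ β n x₀ ≤ 1 := by
  have h1 := h.le_one (n + 1)
  rw [annF_succ, div_le_one (by linarith)] at h1
  nlinarith

theorem IsCritical.nonpos (h : IsCritical B κ β x₀) : x₀ ≤ 0 := by simpa using h.le_one 0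

/-- Upper control of the annealed recursion at all base points that are subcritical up to the
given level. -/
theorem exists_upper_control (hB : 1 < B) (hB2 : B < 2) (hκ : 0 < κ)
    (hκ' : κ < min (B ^ 2 / 4) (1 / 2)) (r : ℕ) :
    ∃ C c : ℝ, 1 ≤ C ∧ 0 < c ∧
      WeightBound B κ (baseWidth B * (2 / B) ^ r) (3 * baseWidth B + 4) C ∧
      ∀ β, c * β ^ 2 ≤ 1 → C * (β ^ 2 / κ ^ r) ≤ 1 ∧ ∀ x₀ ≤ 0, ∀ n,
        (∀ j < n, annG B κ β j x₀ ≤ 1) →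
        UpperBound B κ β (baseWidth B) (1 / baseWidth B) r n 1 x₀ ∧
        StepBound B κ β (baseWidth B) (1 / baseWidth B) r n 1
          (c * β ^ 2 * corrRate B κ ^ n) x₀ := by
  have hθ0 := baseWidth_pos hB2
  have hθ1 := baseWidth_lt_one hB
  have hκ1 : κ ≤ 1 := by
    have := hκ.trans (hκ'.trans_le (min_le_right _ _))
    have := hκ'.trans_le (min_le_right _ _)
    linarith
  obtain ⟨C, hC1, hW⟩ := exists_gaussian_weight_bound (Θ := baseWidth B * (2 / B) ^ r)
    (L := 3 * baseWidth B + 4) hB hB2 hκ hκ' (by positivity) (by positivity)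
  have hq0 := corrRate_pos (B := B) hκ
  have hq1 := corrRate_lt_one hB hκ'
  set θ := baseWidth B with hθ
  set q := corrRate B κ with hq
  have hC0 : 0 < C := by linarith
  obtain ⟨ρ, hρ⟩ : ∃ ρ, ρ = C / κ ^ r * (exp (3 * θ + 3) + 1) := ⟨_, rfl⟩
  have hρ0 : 0 < ρ := by rw [hρ]; positivity
  obtain ⟨c₁, hc₁⟩ : ∃ c₁, c₁ = max ((2 / B) ^ r) 1 * ρ := ⟨_, rfl⟩
  have hc₁ρ : ρ ≤ c₁ := by rw [hc₁]; exact le_mul_of_one_le_left hρ0.le (le_max_right _ _)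
  have h1q : 0 < 1 - q := by linarith
  have hc₁0 : 0 < c₁ := by linarith
  -- The summands ensure in turn that the accumulated slope error stays at most `1`, that the weight
  -- bounds apply, and that the gap bound holds with this constant.
  refine ⟨C, c₁ / (1 - q) + C / κ ^ r + c₁, hC1, by positivity, hW, fun β hβ => ?_⟩
  have t1 : 0 ≤ c₁ / (1 - q) * β ^ 2 := by positivity
  have t2 : 0 ≤ C / κ ^ r * β ^ 2 := by positivity
  have t3 : 0 ≤ c₁ * β ^ 2 := by positivity
  have hCτ : C * (β ^ 2 / κ ^ r) ≤ 1 := by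
    have e : C * (β ^ 2 / κ ^ r) = C / κ ^ r * β ^ 2 := by ring
    rw [e]; linarith
  have hσ1 : c₁ / (1 - q) * β ^ 2 ≤ 1 := by linarith
  refine ⟨hCτ, fun x₀ hx₀ => ?_⟩
  have hρle : ∀ n : ℕ, C * (β ^ 2 / κ ^ r) * q ^ (n + r) * (exp (3 * θ + 3) + 1) ≤
      ρ * β ^ 2 * q ^ n := fun n => by
    have e : ρ * β ^ 2 * q ^ n = C * (β ^ 2 / κ ^ r) * q ^ n * (exp (3 * θ + 3) + 1) := by
      rw [hρ]; ring
    rw [e]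
    have := pow_le_pow_of_le_one hq0.le hq1.le (Nat.le_add_right n r)
    gcongr
  have hsum : ∀ n : ℕ, ∑ j ∈ Finset.range n, c₁ * β ^ 2 * q ^ j ≤ 1 := fun n => by
    rw [← Finset.mul_sum]
    have h1 : ∑ j ∈ Finset.range n, q ^ j ≤ (1 - q)⁻¹ := by
      rw [← tsum_geometric_of_lt_one hq0.le hq1]
      exact (summable_geometric_of_lt_one hq0.le hq1).sum_le_tsum _ fun j _ => by positivity
    refine (mul_le_mul_of_nonneg_left h1 t3).trans ?_
    calc c₁ * β ^ 2 * (1 - q)⁻¹ = c₁ / (1 - q) * β ^ 2 := by ring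
      _ ≤ 1 := hσ1
  have hb : 9 / 2 ≤ 1 / θ * (1 - B / 2) := by
    rw [one_div_mul_eq_div, le_div_iff₀ hθ0, hθ, baseWidth]; linarith
  have hbθ : 1 / θ * θ = 1 := by field_simp
  have hstep : ∀ n, UpperBound B κ β θ (1 / θ) r n (∑ j ∈ Finset.range n, c₁ * β ^ 2 * q ^ j) x₀ →
      StepBound B κ β θ (1 / θ) r n (∑ j ∈ Finset.range (n + 1), c₁ * β ^ 2 * q ^ j)
        (ρ * β ^ 2 * q ^ n) x₀ := fun n hU => by
    refine (hU.step hB hκ hκ1 hθ0.le (Finset.sum_nonneg fun j _ => by positivity) (hsum n)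
      hC0.le hW hCτ).mono hB ?_ (hρle n)
    rw [Finset.sum_range_succ, hc₁]
    have := mul_le_mul_of_nonneg_left (hρle n) (show 0 ≤ max ((2 / B) ^ r) 1 by positivity)
    linarith
  have hmain : ∀ n, (∀ j < n, annG B κ β j x₀ ≤ 1) →
      UpperBound B κ β θ (1 / θ) r n (∑ j ∈ Finset.range n, c₁ * β ^ 2 * q ^ j) x₀ := by
    intro n
    induction n with
    | zero =>
      intro _
      simpa using upperBound_zero (κ := κ) (β := β) (r := r) hB hB2 hθ0.le hθ1.le
        ((one_le_div hθ0).2 hθ1.le) hx₀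
    | succ n ih =>
      intro h
      exact (hstep n (ih fun j hj => h j (hj.trans (Nat.lt_succ_self n)))).upperBound_succ hB hB2
        hκ hκ1 hθ0.le (Finset.sum_nonneg fun j _ => by positivity) (hsum _) hb hbθ
        (h n (Nat.lt_succ_self n))
  intro n h
  refine ⟨(hmain n h).mono hB (hsum n), (hstep n (hmain n h)).mono hB (hsum _) ?_⟩
  have : 0 ≤ c₁ / (1 - q) + C / κ ^ r := by positivity
  gcongr
  linarith

/-- Near-critical control of the annealed recursion. -/
structure CritControl (B κ β : ℝ) (r : ℕ) (C c x₀ : ℝ) : Prop where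
  small : C * (β ^ 2 / κ ^ r) ≤ 1
  nonpos : x₀ ≤ 0
  annG_le_one : ∀ n, annG B κ β n x₀ ≤ 1
  upper : ∀ n, UpperBound B κ β (baseWidth B) (1 / baseWidth B) r n 1 x₀
  step : ∀ n, StepBound B κ β (baseWidth B) (1 / baseWidth B) r n 1
    (c * β ^ 2 * corrRate B κ ^ n) x₀
  lower : ∀ n, 1 - c * β ^ 2 * corrRate B κ ^ n ≤ annF B κ β n x₀
  slope : ∀ n y, 0 ≤ y → (2 / B) ^ n * y / 2 ≤ annF B κ β n (x₀ + y) - annF B κ β n x₀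

theorem annF_diff_le_annG_diff (hB : 1 < B) (hκ : 0 ≤ κ) (hκ1 : κ ≤ 1) (n : ℕ) {x y : ℝ}
    (hxy : x ≤ y) : annF B κ β n y - annF B κ β n x ≤ annG B κ β n y - annG B κ β n x := by
  simp only [annF, annG]
  rw [ev_heat, ev_heat, ev_eq_wsum, ev_eq_wsum, ← wsum_sub_right, ← wsum_sub_right]
  refine (nonnegCoeff_annPoly hB n).wsum_le fun k _ => ?_
  rw [← mul_sub]
  refine le_mul_of_one_le_left (sub_nonneg.2 (exp_le_exp.2 (by gcongr))) (one_le_exp ?_)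
  have := stepVar_nonneg (β := β) hκ1 hκ n
  positivity

-- If the mean fell too far below `1` at the critical point, it would also do so at a slightly
-- larger field; there the smoothing could never bring it back to `1`, contradicting criticality.
-- Once the mean is close to `1`, the slope loses only a summable amount.
set_option maxHeartbeats 1000000 in
theorem exists_crit_control (hB : 1 < B) (hB2 : B < 2) (hκ : 0 < κ)
    (hκ' : κ < min (B ^ 2 / 4) (1 / 2)) (r : ℕ) :
    ∃ C c : ℝ, 1 ≤ C ∧ 0 < c ∧
      WeightBound B κ (baseWidth B * (2 / B) ^ r) (3 * baseWidth B + 4) C ∧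
      ∀ β, c * β ^ 2 ≤ 1 → ∀ x₀, IsCritical B κ β x₀ → CritControl B κ β r C c x₀ := by
  obtain ⟨C, c, hC, hc, hW, H⟩ := exists_upper_control hB hB2 hκ hκ' r
  have hκ1 : κ ≤ 1 := by
    have := hκ'.trans_le (min_le_right _ _)
    linarith
  have hq0 := corrRate_pos (B := B) hκ
  have hq1 := corrRate_lt_one hB hκ'
  set q := corrRate B κ with hq
  have h1q : 0 < 1 - q := by linarith
  have h2B : 0 < 2 - B := by linarith
  have hB0 : 0 < B := by linarith
  obtain ⟨d, hd⟩ : ∃ d, d = c / (1 - q) := ⟨_, rfl⟩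
  have hd0 : 0 < d := by rw [hd]; positivity
  -- This makes `1 - d * β ^ 2 * q ^ n` self-consistent: adding the gap `c * β ^ 2 * q ^ n` gives
  -- exactly the same expression at `n + 1`.
  have hdc : d - d * q = c := by rw [hd]; field_simp
  -- The term `d / (2 - B)` yields `D ≤ 2 - B`, so squaring and averaging does not reduce a deficit
  -- `D`; the last two terms keep the slope above `1 / 2`.
  obtain ⟨c', hc'⟩ : ∃ c', c' = c + d / (2 - B) + d + 2 * d + 2 * (d / (1 - q)) := ⟨_, rfl⟩
  have hc'0 : 0 < c' := by rw [hc']; positivity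
  refine ⟨C, c', hC, hc'0, hW, fun β hβ x₀ hx₀ => ?_⟩
  have t1 : 0 ≤ c * β ^ 2 := by positivity
  have t2 : 0 ≤ d / (2 - B) * β ^ 2 := by positivity
  have t3 : 0 ≤ d * β ^ 2 := by positivity
  have t4 : 0 ≤ d / (1 - q) * β ^ 2 := by positivity
  have hβ' : c * β ^ 2 + d / (2 - B) * β ^ 2 + d * β ^ 2 + 2 * (d * β ^ 2) +
      2 * (d / (1 - q) * β ^ 2) ≤ 1 := by
    rw [hc'] at hβ; linarith
  have hcβ : c * β ^ 2 ≤ 1 := by linarith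
  have hdβ : d * β ^ 2 ≤ 2 - B := by
    have : d / (2 - B) * β ^ 2 ≤ 1 := by linarith
    rw [div_mul_eq_mul_div, div_le_one h2B] at this
    exact this
  obtain ⟨hCτ, HU⟩ := H β hcβ
  have hg := hx₀.annG_le_one hB
  have hU := fun n => HU x₀ hx₀.nonpos n fun j _ => hg j
  have hqn : ∀ n : ℕ, 0 < q ^ n := fun n => by positivity
  have hqn1 : ∀ n : ℕ, q ^ n ≤ 1 := fun n => pow_le_one₀ hq0.le hq1.le
  have hdn : ∀ n : ℕ, 0 ≤ d * β ^ 2 * q ^ n := fun n => by positivity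
  have hlow : ∀ n, 1 - d * β ^ 2 * q ^ n ≤ annF B κ β n x₀ := by
    intro n
    by_contra! hlt
    have hlt1 : annF B κ β n x₀ < 1 := by linarith [hdn n]
    have hglt : ∀ j ∈ Finset.range n, annG B κ β j x₀ < 1 := by
      intro j hj
      by_contra! hge
      have h1 : 1 ≤ annF B κ β (j + 1) x₀ := by
        rw [annF_succ, le_div_iff₀ hB0]; nlinarith
      obtain ⟨k, hk⟩ := Nat.exists_eq_add_of_le (Finset.mem_range.1 hj)
      have h2 := annF_growth hB hκ.le hκ1 h1 k
      have h3 : 0 ≤ (2 / B) ^ k * (annF B κ β (j + 1) x₀ - 1) :=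
        mul_nonneg (by positivity) (by linarith)
      rw [← Nat.succ_eq_add_one j, ← hk] at h2
      rw [Nat.succ_eq_add_one] at h2
      linarith
    have hev : ∀ᶠ x in 𝓝[>] x₀, annF B κ β n x < 1 - d * β ^ 2 * q ^ n ∧
        ∀ j ∈ Finset.range n, annG B κ β j x < 1 := by
      refine nhdsWithin_le_nhds (((continuous_annF n).continuousAt.eventually_lt
        continuousAt_const hlt).and ?_)
      rw [Filter.eventually_all_finset]
      exact fun j hj => (continuous_annG j).continuousAt.eventually_lt continuousAt_const
        (hglt j hj)
    obtain ⟨x₁, ⟨hx₁, hx₁'⟩, hx₁0⟩ := (hev.and self_mem_nhdsWithin).exists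
    have hneg : x₁ ≤ 0 := by
      rcases Nat.eq_zero_or_pos n with rfl | hn
      · have := hdn 0
        rw [annF_zero] at hx₁
        exact exp_le_one_iff.1 (by linarith)
      · have h1 := annF_le_annG (β := β) hB hκ.le hκ1 0 x₁
        have h2 := hx₁' 0 (Finset.mem_range.2 hn)
        rw [annF_zero] at h1
        exact exp_le_one_iff.1 (by linarith)
    -- The point `x₁` is supercritical, so the upper control must be re-established level by level:
    -- it holds as long as the smoothed means stay at most `1`, which the induction carries along.
    have hind : ∀ k, annF B κ β (n + k) x₁ < 1 - d * β ^ 2 * q ^ (n + k) ∧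
        ∀ j < n + k, annG B κ β j x₁ ≤ 1 := by
      intro k
      induction k with
      | zero => exact ⟨hx₁, fun j hj => (hx₁' j (Finset.mem_range.2 hj)).le⟩
      | succ k ih =>
        obtain ⟨ih1, ih2⟩ := ih
        have hgap := (HU x₁ hneg (n + k) ih2).2.gap
        have e : d * β ^ 2 * q ^ (n + k + 1) = d * β ^ 2 * q ^ (n + k) -
            c * β ^ 2 * q ^ (n + k) := by
          rw [← hdc, pow_succ]; ring
        have hg1 : annG B κ β (n + k) x₁ < 1 - d * β ^ 2 * q ^ (n + k + 1) := by
          rw [e]; linarith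
        have hd1 := hdn (n + k + 1)
        refine ⟨?_, fun j hj => ?_⟩
        · rw [← add_assoc, annF_succ, div_lt_iff₀ hB0]
          have hg0 := annG_pos (β := β) hB hκ.le hκ1 (n + k) x₁
          have hd2 : d * β ^ 2 * q ^ (n + k + 1) ≤ 2 - B :=
            (mul_le_of_le_one_right t3 (hqn1 _)).trans hdβ
          set D := d * β ^ 2 * q ^ (n + k + 1)
          nlinarith
        · rcases Nat.lt_or_ge j (n + k) with h | h
          · exact ih2 j h
          · obtain rfl : j = n + k := by omega
            linarith
    obtain ⟨N, hN⟩ := hx₀.exists_gt x₁ hx₁0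
    rcases Nat.lt_or_ge N n with h | h
    · have := annF_le_annG (β := β) hB hκ.le hκ1 N x₁
      have := hx₁' N (Finset.mem_range.2 h)
      linarith
    · obtain ⟨k, rfl⟩ := Nat.exists_eq_add_of_le h
      have := (hind k).1
      have := hdn (n + k)
      linarith
  have hdc' : d ≤ c' := by
    have : 0 ≤ d / (2 - B) := by positivity
    have : 0 ≤ d / (1 - q) := by positivity
    rw [hc']; linarith
  have hcc' : c ≤ c' := by
    have : 0 ≤ d / (2 - B) := by positivity
    have : 0 ≤ d / (1 - q) := by positivity
    rw [hc']; linarith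
  refine ⟨hCτ, hx₀.nonpos, hg, fun n => (hU n).1, fun n => (hU n).2.mono hB le_rfl ?_,
    fun n => le_trans ?_ (hlow n), fun n y hy => ?_⟩
  · have := hqn n
    gcongr
  · have := hqn n
    gcongr
  have hsum : ∀ n : ℕ, ∑ j ∈ Finset.range n, d * β ^ 2 * q ^ j ≤ d / (1 - q) * β ^ 2 := fun n => by
    rw [← Finset.mul_sum]
    have h1 : ∑ j ∈ Finset.range n, q ^ j ≤ (1 - q)⁻¹ := by
      rw [← tsum_geometric_of_lt_one hq0.le hq1]
      exact (summable_geometric_of_lt_one hq0.le hq1).sum_le_tsum _ fun j _ => by positivity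
    refine (mul_le_mul_of_nonneg_left h1 t3).trans_eq ?_
    ring
  -- The discarded `Δ ^ 2` is nonnegative, and the linear factor is at least `1 - d * β ^ 2 * q ^
  -- n`; the slope decreases by at most this deficit at each level.
  have hslope : (1 - d * β ^ 2 - ∑ j ∈ Finset.range n, d * β ^ 2 * q ^ j) * ((2 / B) ^ n * y) ≤
      annF B κ β n (x₀ + y) - annF B κ β n x₀ := by
    induction n with
    | zero =>
      have h0 := hlow 0
      simp only [annF_zero, pow_zero, mul_one, Finset.range_zero, Finset.sum_empty, sub_zero,
        one_mul] at h0 ⊢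
      rw [exp_add, ← mul_sub_one]
      have := add_one_le_exp y
      have : 0 < exp x₀ := exp_pos _
      nlinarith
    | succ n ih =>
      set m := 1 - d * β ^ 2 - ∑ j ∈ Finset.range n, d * β ^ 2 * q ^ j with hm
      have hm1 : m ≤ 1 := by
        have : 0 ≤ ∑ j ∈ Finset.range n, d * β ^ 2 * q ^ j :=
          Finset.sum_nonneg fun j _ => hdn j
        linarith
      have h1 := ih.trans (annF_diff_le_annG_diff (β := β) hB hκ.le hκ1 n
        (show x₀ ≤ x₀ + y by linarith))
      have h2 := (hlow n).trans (annF_le_annG (β := β) hB hκ.le hκ1 n x₀)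
      have h3 := hdn n
      have h4 : annG B κ β n x₀ ≤ annG B κ β n (x₀ + y) := annG_mono hB n (by linarith)
      rw [Finset.sum_range_succ, ← sub_sub, ← hm, annF_succ, annF_succ, ← sub_div,
        le_div_iff₀ hB0]
      have e : (m - d * β ^ 2 * q ^ n) * ((2 / B) ^ (n + 1) * y) * B =
          2 * ((m - d * β ^ 2 * q ^ n) * ((2 / B) ^ n * y)) := by
        have hBB : 2 / B * B = 2 := div_mul_cancel₀ 2 hB0.ne'
        rw [pow_succ]
        linear_combination (m - d * β ^ 2 * q ^ n) * (2 / B) ^ n * y * hBB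
      rw [e]
      have hY : 0 ≤ (2 / B) ^ n * y := by positivity
      set Y := (2 / B) ^ n * y
      set D := d * β ^ 2 * q ^ n
      set g0 := annG B κ β n x₀
      set g1 := annG B κ β n (x₀ + y)
      have h5 : 0 ≤ g1 - g0 := by linarith
      have h6 : (1 - D) * (g1 - g0) ≤ g0 * (g1 - g0) := mul_le_mul_of_nonneg_right h2 h5
      have h7 : (m - D) * Y ≤ (1 - D) * (g1 - g0) := by
        have hD1 : D ≤ 1 := by
          have : D ≤ d * β ^ 2 := mul_le_of_le_one_right t3 (hqn1 n)
          linarith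
        have h8 : (1 - D) * (m * Y) ≤ (1 - D) * (g1 - g0) :=
          mul_le_mul_of_nonneg_left h1 (by linarith)
        have h9 : 0 ≤ D * (1 - m) * Y := by
          have : 0 ≤ 1 - m := by linarith
          positivity
        linarith
      have h10 := sq_nonneg (g1 - g0)
      linarith
  refine le_trans ?_ hslope
  have hY : 0 ≤ (2 / B) ^ n * y := by positivity
  have h1 : 1 / 2 ≤ 1 - d * β ^ 2 - ∑ j ∈ Finset.range n, d * β ^ 2 * q ^ j := by
    linarith [hsum n]
  linarith [mul_le_mul_of_nonneg_right h1 hY]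

end

end

end HierPinning

/-! ### Ingredients of the variance recursion near the critical point. -/

namespace HierPinning

noncomputable section

open Polynomial

section

variable {B κ β c C : ℝ} {r n : ℕ} {x₀ : ℝ}

theorem nonnegCoeff_excessPoly {v : ℝ[X]} (hv : NonnegCoeff v) (hB : 1 < B) {s : ℝ} (hs : 0 ≤ s)
    (n : ℕ) : NonnegCoeff (excessPoly B κ β s n v) :=
  (hv.heat s).add ((nonnegCoeff_annPoly hB n).heatVar hs)

theorem nonnegCoeff_varPoly (hB : 1 < B) (hκ : 0 ≤ κ) (hκ1 : κ ≤ 1) (n : ℕ) :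
    NonnegCoeff (varPoly B κ β n) := by
  induction n with
  | zero => exact NonnegCoeff.zero
  | succ n ih =>
    have hE := nonnegCoeff_excessPoly (κ := κ) (β := β) ih hB (stepVar_nonneg (β := β) hκ1 hκ n) n
    have hg := (nonnegCoeff_annPoly (κ := κ) (β := β) hB n).heat (stepVar κ β n)
    rw [varPoly, pow_two (heat _ _)]
    exact (NonnegCoeff.const (by positivity)).mul
      (hE.mul (((NonnegCoeff.const (by norm_num)).mul (hg.mul hg)).add hE))

theorem natDegree_heat_annPoly_sq_le (s : ℝ) (n : ℕ) :
    (heat s (annPoly B κ β n) ^ 2).natDegree ≤ 2 * 2 ^ n :=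
  natDegree_pow_le.trans (Nat.mul_le_mul_left 2
    ((natDegree_heat_le _ _).trans (natDegree_annPoly_le n)))

theorem natDegree_excessPoly_le {v : ℝ[X]} (hv : v.natDegree ≤ 2 * 2 ^ n) (s : ℝ) :
    (excessPoly B κ β s n v).natDegree ≤ 2 * 2 ^ n := by
  refine natDegree_add_le_of_degree_le ((natDegree_heat_le _ _).trans hv) ?_
  refine (natDegree_sub_le_of_le ?_ (natDegree_heat_annPoly_sq_le s n)).trans (max_self _).le
  exact (natDegree_heat_le _ _).trans
    (natDegree_pow_le.trans (Nat.mul_le_mul_left 2 (natDegree_annPoly_le n)))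

theorem natDegree_varPoly_le (n : ℕ) : (varPoly B κ β n).natDegree ≤ 2 * 2 ^ n := by
  induction n with
  | zero => simp [varPoly]
  | succ n ih =>
    have hE := natDegree_excessPoly_le (B := B) (κ := κ) (β := β) ih (stepVar κ β n)
    rw [varPoly]
    refine (natDegree_C_mul_le _ _).trans (natDegree_mul_le.trans ?_)
    have h2 : (C 2 * heat (stepVar κ β n) (annPoly B κ β n) ^ 2 +
        excessPoly B κ β (stepVar κ β n) n (varPoly B κ β n)).natDegree ≤ 2 * 2 ^ n :=
      natDegree_add_le_of_degree_le
        ((natDegree_C_mul_le _ _).trans (natDegree_heat_annPoly_sq_le _ n)) hE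
    rw [pow_succ 2 n]
    omega

theorem natDegree_varPoly_le_shift (r : ℕ) : (varPoly B κ β n).natDegree ≤ 2 * 2 ^ (n + r) :=
  (natDegree_varPoly_le n).trans (Nat.mul_le_mul_left 2
    (Nat.pow_le_pow_right (by norm_num) (Nat.le_add_right _ _)))

theorem ev_varPoly_succ (hB : 1 < B) (n : ℕ) (x : ℝ) :
    ev (varPoly B κ β (n + 1)) x = 2 / B ^ 2 *
      (ev (excessPoly B κ β (stepVar κ β n) n (varPoly B κ β n)) x *
        (annG B κ β n x ^ 2 +
          ev (excessPoly B κ β (stepVar κ β n) n (varPoly B κ β n)) x / 2)) := by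
  rw [varPoly, ev_mul, ev_mul, ev_add, ev_mul, ev_C, ev_C, ev_pow, annG]
  field_simp

/-- Bound on the contribution of the correlations between blocks to the variance. -/
theorem CritControl.heatVar_le (h : CritControl B κ β r C c x₀) (hB : 1 < B) (hB2 : B < 2)
    (hκ : 0 < κ) (hC : 1 ≤ C)
    (hW : WeightBound B κ (baseWidth B * (2 / B) ^ r) (3 * baseWidth B + 4) C)
    {s : ℝ} (hs : 0 ≤ s) (hsn : s ≤ β ^ 2 * κ ^ n) {m : ℕ} (hm : m ≤ n + r) {x : ℝ}
    (hx : x ≤ x₀ + window B (baseWidth B) r m) :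
    ev (heatVar s (annPoly B κ β n)) x ≤ 4 * C ^ 2 * ((2 / B) ^ r) ^ 2 * (β ^ 2 * (2 / B ^ 2) ^ n *
      corrRate B κ ^ n * exp ((6 * baseWidth B + 10) * (2 ^ (n + r) / 2 ^ m))) := by
  have hp := nonnegCoeff_annPoly (κ := κ) (β := β) hB n
  have hθ0 := baseWidth_pos hB2
  set θ := baseWidth B with hθ
  have hW1 := one_le_two_pow_div hm
  set W : ℝ := 2 ^ (n + r) / 2 ^ m with hWdef
  have h1 := wsum_mul_heat_le (x₀ := x₀) hW hp (natDegree_annPoly_le_shift r)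
    (show 0 ≤ β ^ 2 / κ ^ r by positivity) h.small hs (by rwa [kappa_pow_shift hκ]) (by linarith)
    hm hx
  have h2 := (h.upper n).tail_le le_rfl hm
  have h3 := (h.upper n).far m hm
  rw [← hWdef] at h1 h3
  rw [← hθ] at h2 h3
  rw [← inv_div ((2 : ℝ) ^ (n + r)) (2 ^ m), ← hWdef] at h2
  set S₁ := wsum (fun k => k * (exp (s * (k : ℝ) ^ 2) * exp (k * x))) (annPoly B κ β n) with hS
  have hS0 : 0 ≤ S₁ := hp.wsum_nonneg fun k => by positivity
  have h4 : (B / 2) ^ (n + r) * S₁ ≤ 2 * C * exp ((3 * θ + 5) * W) := by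
    refine h1.trans ?_
    rw [mul_comm (2 : ℝ) C, mul_assoc C]
    refine mul_le_mul_of_nonneg_left ?_ (by linarith)
    have e1 : exp (2 * W) * ev (annPoly B κ β n) (x₀ + θ * (2 / B) ^ r * (B / 2) ^ m) ≤
        exp ((3 * θ + 5) * W) := by
      refine (mul_le_mul_of_nonneg_left h3 (exp_nonneg _)).trans ?_
      rw [← exp_add]; exact exp_le_exp.2 (by linarith)
    have e2 : (1 : ℝ) ≤ exp ((3 * θ + 5) * W) := one_le_exp (by positivity)
    have e3 : W⁻¹ ≤ 1 := inv_le_one_of_one_le₀ hW1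
    linarith
  have h5 : S₁ ≤ (2 / B) ^ (n + r) * (2 * C * exp ((3 * θ + 5) * W)) := by
    have h6 := mul_le_mul_of_nonneg_left h4 (show 0 ≤ (2 / B) ^ (n + r) by positivity)
    rw [← mul_assoc, two_div_pow_mul_div_two_pow hB, one_mul] at h6
    exact h6
  refine (ev_heatVar_le hp hs x).trans ?_
  rw [← hS]
  calc s * S₁ ^ 2 ≤ β ^ 2 * κ ^ n * ((2 / B) ^ (n + r) * (2 * C * exp ((3 * θ + 5) * W))) ^ 2 := by
        gcongr
    _ = 4 * C ^ 2 * ((2 / B) ^ r) ^ 2 * (β ^ 2 * ((κ * (2 / B) ^ 2) ^ n) *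
          exp ((3 * θ + 5) * W) ^ 2) := by
        rw [pow_add, mul_pow κ, ← pow_mul (2 / B) 2 n, mul_comm 2 n, pow_mul (2 / B) n 2]; ring
    _ = 4 * C ^ 2 * ((2 / B) ^ r) ^ 2 * (β ^ 2 * (2 / B ^ 2) ^ n * (2 * κ) ^ n *
          exp ((6 * θ + 10) * W)) := by
        -- The correlation contribution is thus smaller than the natural growth `(2 / B ^ 2) ^ n` of
        -- the variance by `(2 * κ) ^ n`, hence summable relative to it.
        have e1 : κ * (2 / B) ^ 2 = 2 / B ^ 2 * (2 * κ) := by ring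
        have e2 : exp ((3 * θ + 5) * W) ^ 2 = exp ((6 * θ + 10) * W) := by
          rw [← exp_nat_mul]; congr 1; push_cast; ring
        rw [e1, e2, mul_pow]; ring
    _ ≤ _ := by
        have : 2 * κ ≤ corrRate B κ := le_max_left _ _
        gcongr

theorem CritControl.annG_le_far (h : CritControl B κ β r C c x₀) {i : ℕ}
    (hi : i ≤ n + r) : annG B κ β n (x₀ + window B (baseWidth B) r i) ≤
      exp ((3 * baseWidth B + 3) * (2 ^ (n + r) / 2 ^ i)) := by
  refine ((h.step n).far i hi).trans (exp_le_exp.2 ?_)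
  have hW := one_le_two_pow_div hi
  rw [← inv_div ((2 : ℝ) ^ (n + r))]
  have := inv_le_one_of_one_le₀ hW
  linarith

/-- The Taylor bound gives `g ≤ 1 + 3 * δ` with `δ ≤ 1`, and `(1 + 3 * δ) ^ 2 ≤ 1 + 15 * δ`. -/
theorem CritControl.annG_sq_le_near (h : CritControl B κ β r C c x₀) (hB : 1 < B) (hB2 : B < 2)
    (hκ : 0 < κ) (hκ1 : κ ≤ 1) {i : ℕ} (hi : n + r ≤ i) :
    annG B κ β n (x₀ + window B (baseWidth B) r i) ^ 2 ≤
      exp (15 * ((2 / B) ^ (n + r) * (B / 2) ^ i)) := by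
  have hθ0 := baseWidth_pos hB2
  have hθ1 := baseWidth_lt_one hB
  have hy0 := window_nonneg hB hθ0.le r i
  have hyθ := window_anti hB hB2 hθ0.le r hi
  rw [window_add hB] at hyθ
  have h1 := (h.step n).near _ hy0 hyθ
  have h2 := h.annG_le_one n
  have e : (2 / B) ^ n * window B (baseWidth B) r i =
      baseWidth B * ((2 / B) ^ (n + r) * (B / 2) ^ i) := by rw [window, pow_add]; ring
  rw [e] at h1
  have hδ1 : (2 / B) ^ (n + r) * (B / 2) ^ i ≤ 1 := by
    calc (2 / B) ^ (n + r) * (B / 2) ^ i ≤ (2 / B) ^ (n + r) * (B / 2) ^ (n + r) := by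
          gcongr ?_ * ?_
          exact pow_le_pow_of_le_one (by positivity) (by linarith) hi
      _ = 1 := two_div_pow_mul_div_two_pow hB _
  have hδ0 : 0 ≤ (2 / B) ^ (n + r) * (B / 2) ^ i := by positivity
  set δ := (2 / B) ^ (n + r) * (B / 2) ^ i
  set θ := baseWidth B
  have e2 : 1 / θ * (θ * δ) ^ 2 = θ * δ * δ := by field_simp
  rw [e2] at h1
  have h3 : θ * δ ≤ δ := mul_le_of_le_one_left hδ0 hθ1.le
  have h4 : θ * δ * δ ≤ δ := by
    have : θ * δ * δ ≤ δ * 1 := mul_le_mul h3 hδ1 hδ0 hδ0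
    linarith
  have h5 : annG B κ β n (x₀ + window B θ r i) ≤ 1 + 3 * δ := by linarith
  have h6 := annG_pos (β := β) hB hκ.le hκ1 n (x₀ + window B θ r i)
  calc annG B κ β n (x₀ + window B θ r i) ^ 2 ≤ (1 + 3 * δ) ^ 2 := by gcongr
    _ ≤ 15 * δ + 1 := by nlinarith
    _ ≤ exp (15 * δ) := add_one_le_exp _

end

end

end HierPinning

/-! ### Propagation of the variance bounds. -/

namespace HierPinning

noncomputable section

open Polynomial

/-- Control of the variance of the partition function of a block near the point `x₀`. -/
structure VarBound (B κ β V A D : ℝ) (r n : ℕ) (x₀ : ℝ) : Prop where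
  near : ∀ i, n + r ≤ i → ev (varPoly B κ β n) (x₀ + window B (baseWidth B) r i) ≤
    β ^ 2 * (2 / B ^ 2) ^ n * (A * ∑ j ∈ Finset.range n, corrRate B κ ^ j) *
      exp (V * β ^ 2 * ∑ j ∈ Finset.range n, (2 / B ^ 2) ^ j +
        15 * ∑ j ∈ Finset.range n, (2 / B) ^ (j + r) * (B / 2) ^ i)
  far : ∀ i ≤ n + r, ev (varPoly B κ β n) (x₀ + window B (baseWidth B) r i) ≤
    V * β ^ 2 * (2 / B ^ 2) ^ n * exp (2 ^ (n + r) / 2 ^ i *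
      (6 * baseWidth B + 14 + D * ∑ j ∈ Finset.range n, corrRate B κ ^ j) - 4)

/-- Relations between the constants that make the bounds on the variance propagate. -/
structure VarConst (B κ β V A C C₂ : ℝ) (r : ℕ) : Prop where
  one_le : 1 ≤ C
  weight : WeightBound B κ (baseWidth B * (2 / B) ^ r) (3 * baseWidth B + 4) C
  one_le₂ : 1 ≤ C₂
  weight₂ : WeightBound B κ (baseWidth B * (2 / B) ^ r) (6 * baseWidth B + 16) C₂
  small : C₂ * (β ^ 2 / κ ^ r) ≤ 1
  small_V : 2 * V * (C₂ * (β ^ 2 / κ ^ r)) ≤ 1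
  small_sum : C₂ * (β ^ 2 / κ ^ r) ≤ 1 - corrRate B κ
  A_def : A = 1 + 4 * C ^ 2 * ((2 / B) ^ r) ^ 2 * exp (6 * baseWidth B + 10)
  V_def : V = A / (1 - corrRate B κ) * exp (1 + 15 / (2 / B - 1))

section

variable {B κ β c C C₂ V A D : ℝ} {r n : ℕ} {x₀ : ℝ}

theorem geom_sum_le_inv {q : ℝ} (hq : 0 ≤ q) (hq1 : q < 1) (n : ℕ) :
    ∑ j ∈ Finset.range n, q ^ j ≤ (1 - q)⁻¹ := by
  rw [← tsum_geometric_of_lt_one hq hq1]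
  exact (summable_geometric_of_lt_one hq hq1).sum_le_tsum _ fun j _ => pow_nonneg hq j

/-- The logarithmic excesses of the means grow geometrically up to the level of the window, so their
total is bounded uniformly in `n`; this keeps the variance growth at the rate `2 / B ^ 2`. -/
theorem sum_two_div_pow_mul_le (hB : 1 < B) (hB2 : B < 2) (r : ℕ) {n i : ℕ} (hi : n + r ≤ i) :
    ∑ j ∈ Finset.range n, (2 / B) ^ (j + r) * (B / 2) ^ i ≤ 1 / (2 / B - 1) := by
  have hg : 1 < 2 / B := (one_lt_div (by linarith)).2 hB2
  have hg1 : 0 < 2 / B - 1 := by linarith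
  have h1 : (B / 2) ^ i ≤ (B / 2) ^ (n + r) :=
    pow_le_pow_of_le_one (by linarith) (by linarith) hi
  have h2 := two_div_pow_mul_div_two_pow hB (n + r)
  have h3 : ∑ j ∈ Finset.range n, (2 / B) ^ (j + r) * (B / 2) ^ i =
      ((2 / B) ^ n - 1) / (2 / B - 1) * ((2 / B) ^ r * (B / 2) ^ i) := by
    rw [← geom_sum_eq hg.ne', Finset.sum_mul]
    exact Finset.sum_congr rfl fun j _ => by rw [pow_add]; ring
  rw [h3, div_mul_eq_mul_div]
  refine div_le_div_of_nonneg_right ?_ hg1.le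
  calc ((2 / B) ^ n - 1) * ((2 / B) ^ r * (B / 2) ^ i)
      ≤ (2 / B) ^ n * ((2 / B) ^ r * (B / 2) ^ (n + r)) := by
        gcongr
        linarith
    _ = 1 := by rw [← h2, pow_add]; ring

namespace VarConst

theorem one_le_A (h : VarConst B κ β V A C C₂ r) (hB : 1 < B) : 1 ≤ A := by
  rw [h.A_def, le_add_iff_nonneg_right]; positivity

theorem corr_le_A (h : VarConst B κ β V A C C₂ r) (hB : 1 < B) (hB2 : B < 2) :
    4 * C ^ 2 * ((2 / B) ^ r) ^ 2 ≤ A := by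
  rw [h.A_def]
  have hθ := baseWidth_pos hB2
  have h1 : 1 ≤ exp (6 * baseWidth B + 10) := one_le_exp (by linarith)
  have h2 : 0 ≤ 4 * C ^ 2 * ((2 / B) ^ r) ^ 2 := by positivity
  nlinarith

theorem A_le_V (h : VarConst B κ β V A C C₂ r) (hB : 1 < B) (hB2 : B < 2) (hκ : 0 < κ)
    (hκ' : κ < min (B ^ 2 / 4) (1 / 2)) : A ≤ V := by
  have hq0 := corrRate_pos (B := B) hκ
  have hq1 := corrRate_lt_one hB hκ'
  have hA := h.one_le_A hB
  have hg : 0 < 2 / B - 1 := sub_pos.2 ((one_lt_div (by linarith)).2 hB2)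
  have h1 : 1 ≤ exp (1 + 15 / (2 / B - 1)) := one_le_exp (by positivity)
  have h2 : A ≤ A / (1 - corrRate B κ) := by
    rw [le_div_iff₀ (by linarith)]; nlinarith
  rw [h.V_def]
  nlinarith

/-- `V` is chosen as the supremum of the near bound. Its occurrence in the exponent is harmless,
because it enters there only through a quantity assumed to be at most `1`. -/
theorem near_le (h : VarConst B κ β V A C C₂ r) (hB : 1 < B) (hB2 : B < 2) (hκ : 0 < κ)
    (hκ' : κ < min (B ^ 2 / 4) (1 / 2)) {n i k : ℕ} (hi : n + r ≤ i)
    (hΛ : V * β ^ 2 * ∑ j ∈ Finset.range n, (2 / B ^ 2) ^ j ≤ 1) :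
    (A * ∑ j ∈ Finset.range k, corrRate B κ ^ j) *
      exp (V * β ^ 2 * ∑ j ∈ Finset.range n, (2 / B ^ 2) ^ j +
        15 * ∑ j ∈ Finset.range n, (2 / B) ^ (j + r) * (B / 2) ^ i) ≤ V := by
  have hA := h.one_le_A hB
  have h1 := geom_sum_le_inv (corrRate_pos (B := B) hκ).le (corrRate_lt_one hB hκ') k
  have h2 := sum_two_div_pow_mul_le hB hB2 r hi
  refine le_trans (b := A * (1 - corrRate B κ)⁻¹ * exp (1 + 15 / (2 / B - 1))) ?_
    (le_of_eq (by rw [h.V_def, div_eq_mul_inv A]))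
  refine mul_le_mul (mul_le_mul_of_nonneg_left h1 (by linarith)) (exp_le_exp.2 ?_)
    (exp_nonneg _) ?_
  · have : 15 / (2 / B - 1) = 15 * (1 / (2 / B - 1)) := by ring
    linarith
  · have := corrRate_lt_one hB hκ'
    have : 0 < (1 - corrRate B κ)⁻¹ := inv_pos.2 (by linarith)
    positivity

end VarConst

theorem varBound_zero (hV : 0 ≤ V) : VarBound B κ β V A D r 0 x₀ := by
  refine ⟨fun i _ => ?_, fun i _ => ?_⟩
  · simp [varPoly]
  · simp only [varPoly, ev_zero]
    positivity

namespace VarBound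

theorem tail_le (h : VarBound B κ β V A (C₂ * (β ^ 2 / κ ^ r)) r n x₀)
    (hc : VarConst B κ β V A C C₂ r) (hB : 1 < B) (hκ : 0 < κ)
    (hκ' : κ < min (B ^ 2 / 4) (1 / 2)) (hV : 0 ≤ V) {m : ℕ} (hm : m ≤ n + r) :
    tailSum B (baseWidth B * (2 / B) ^ r) (6 * baseWidth B + 16) x₀ (varPoly B κ β n) (n + r) m ≤
      V * β ^ 2 * (2 / B ^ 2) ^ n := by
  have h1q : 0 < 1 - corrRate B κ := by linarith [corrRate_lt_one hB hκ']
  have hσ : C₂ * (β ^ 2 / κ ^ r) * ∑ j ∈ Finset.range n, corrRate B κ ^ j ≤ 1 := by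
    have h1 := geom_sum_le_inv (corrRate_pos (B := B) hκ).le (corrRate_lt_one hB hκ') n
    have h0 : 0 ≤ C₂ * (β ^ 2 / κ ^ r) := mul_nonneg (by linarith [hc.one_le₂]) (by positivity)
    calc _ ≤ (1 - corrRate B κ) * (1 - corrRate B κ)⁻¹ :=
          mul_le_mul hc.small_sum h1
            (Finset.sum_nonneg fun j _ => pow_nonneg (corrRate_pos hκ).le j) h1q.le
      _ = 1 := mul_inv_cancel₀ h1q.ne'
  have h1 : (2 : ℝ) ^ m / 2 ^ (n + r) ≤ 1 := by
    rw [div_le_one (by positivity)]; exact pow_le_pow_right₀ (by norm_num) hm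
  refine (tailSum_le (R := V * β ^ 2 * (2 / B ^ 2) ^ n) (Q := 6 * baseWidth B + 15)
    (by positivity) (by linarith) fun i hi => ?_).trans (mul_le_of_le_one_right (by positivity) h1)
  refine (h.far i (hi.le.trans hm)).trans ?_
  refine mul_le_mul_of_nonneg_left (exp_le_exp.2 ?_) (by positivity)
  have hW : (0 : ℝ) ≤ 2 ^ (n + r) / 2 ^ i := by positivity
  nlinarith

/-- Smoothed variance, tail and correlation term are each at most `v * exp (M - 4)`, and `3 ≤ e ^ 2`
weakens the offset from `-4` to `-2`. The parameter `s` is free: the recursion uses `stepVar`, the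
final second moment the full variance `β ^ 2 * κ ^ n`. -/
theorem excess_far (h : VarBound B κ β V A (C₂ * (β ^ 2 / κ ^ r)) r n x₀)
    (hc : VarConst B κ β V A C C₂ r) (hcrit : CritControl B κ β r C c x₀)
    (hB : 1 < B) (hB2 : B < 2) (hκ : 0 < κ) (hκ' : κ < min (B ^ 2 / 4) (1 / 2))
    {s : ℝ} (hs : 0 ≤ s) (hsn : s ≤ β ^ 2 * κ ^ n) {i : ℕ} (hi : i ≤ n + r) :
    ev (excessPoly B κ β s n (varPoly B κ β n)) (x₀ + window B (baseWidth B) r i) ≤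
      V * β ^ 2 * (2 / B ^ 2) ^ n * exp (2 ^ (n + r) / 2 ^ i *
        (6 * baseWidth B + 14 + C₂ * (β ^ 2 / κ ^ r) *
          ∑ j ∈ Finset.range (n + 1), corrRate B κ ^ j) - 2) := by
  have hκ1 : κ ≤ 1 := by linarith [hκ'.trans_le (min_le_right (B ^ 2 / 4) (1 / 2))]
  have hq0 := corrRate_pos (B := B) hκ
  have hq1 := corrRate_lt_one hB hκ'
  have hθ := baseWidth_pos hB2
  have hAV := hc.A_le_V hB hB2 hκ hκ'
  have hHA := hc.corr_le_A hB hB2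
  have hA := hc.one_le_A hB
  have hτ : 0 ≤ C₂ * (β ^ 2 / κ ^ r) := mul_nonneg (by linarith [hc.one_le₂]) (by positivity)
  have hheat := ev_heat_le_window (x₀ := x₀) hc.weight₂
    (nonnegCoeff_varPoly (β := β) hB hκ.le hκ1 n)
    (natDegree_varPoly_le_shift r) (by positivity) hc.small hs
    (by rwa [kappa_pow_shift hκ]) hi (le_refl (x₀ + window B (baseWidth B) r i))
  have htail := h.tail_le hc hB hκ hκ' (by linarith) hi
  have hcorr := hcrit.heatVar_le hB hB2 hκ hc.one_le hc.weight hs hsn hi le_rfl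
  have hfar := h.far i hi
  have hW := one_le_two_pow_div hi
  rw [excessPoly, ev_add, Finset.sum_range_succ]
  set W : ℝ := 2 ^ (n + r) / 2 ^ i
  set θ := baseWidth B
  set q := corrRate B κ
  set D := C₂ * (β ^ 2 / κ ^ r)
  set S := ∑ j ∈ Finset.range n, q ^ j
  set X := x₀ + window B θ r i
  set v := V * β ^ 2 * (2 / B ^ 2) ^ n with hv
  have hv0 : 0 ≤ v := by have : 0 ≤ V := by linarith
                         positivity
  have hS0 : 0 ≤ S := Finset.sum_nonneg fun j _ => pow_nonneg hq0.le j
  have hqn : q ^ n ≤ 1 := pow_le_one₀ hq0.le hq1.le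
  have hqN : q ^ (n + r) ≤ q ^ n := pow_le_pow_of_le_one hq0.le hq1.le (Nat.le_add_right _ _)
  have hDS : 0 ≤ D * S := mul_nonneg hτ hS0
  have hDq : 0 ≤ D * q ^ n := mul_nonneg hτ (by positivity)
  set M := W * (6 * θ + 14 + D * (S + q ^ n)) with hM
  have e1 : exp (D * q ^ (n + r) * W) * ev (varPoly B κ β n) X ≤ v * exp (M - 4) := by
    refine (mul_le_mul_of_nonneg_left hfar (exp_nonneg _)).trans ?_
    rw [mul_left_comm, ← exp_add]
    refine mul_le_mul_of_nonneg_left (exp_le_exp.2 ?_) hv0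
    have : D * q ^ (n + r) * W ≤ D * q ^ n * W := by gcongr
    rw [hM]; linarith
  have hM4 : 0 ≤ M - 4 := by rw [hM]; nlinarith
  have e2 : v ≤ v * exp (M - 4) := le_mul_of_one_le_right hv0 (one_le_exp hM4)
  have e3 : 4 * C ^ 2 * ((2 / B) ^ r) ^ 2 * (β ^ 2 * (2 / B ^ 2) ^ n * q ^ n *
      exp ((6 * θ + 10) * W)) ≤ v * exp (M - 4) := by
    calc _ ≤ V * (β ^ 2 * (2 / B ^ 2) ^ n * 1 * exp (M - 4)) := by
          gcongr
          · linarith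
          · linarith
          · rw [hM]; nlinarith
      _ = v * exp (M - 4) := by rw [hv]; ring
  have e4 : 3 * exp (M - 4) ≤ exp (M - 2) := by
    have : M - 2 = 2 + (M - 4) := by ring
    rw [this, exp_add]
    have := add_one_le_exp (2 : ℝ)
    exact mul_le_mul_of_nonneg_right (by linarith) (exp_nonneg _)
  have e5 := mul_le_mul_of_nonneg_left e4 hv0
  linarith

/-- Here smoothing must cost an additive summable term, not a constant factor, since constants would
compound over the levels; hence the use of `ev_heat_sub_le`. -/
theorem excess_near (h : VarBound B κ β V A (C₂ * (β ^ 2 / κ ^ r)) r n x₀)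
    (hc : VarConst B κ β V A C C₂ r) (hcrit : CritControl B κ β r C c x₀)
    (hB : 1 < B) (hB2 : B < 2) (hκ : 0 < κ) (hκ' : κ < min (B ^ 2 / 4) (1 / 2))
    (hΛ : V * β ^ 2 * ∑ j ∈ Finset.range n, (2 / B ^ 2) ^ j ≤ 1)
    {s : ℝ} (hs : 0 ≤ s) (hsn : s ≤ β ^ 2 * κ ^ n) {i : ℕ} (hi : n + r ≤ i) :
    ev (excessPoly B κ β s n (varPoly B κ β n)) (x₀ + window B (baseWidth B) r i) ≤
      β ^ 2 * (2 / B ^ 2) ^ n * (A * ∑ j ∈ Finset.range (n + 1), corrRate B κ ^ j) *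
      exp (V * β ^ 2 * ∑ j ∈ Finset.range n, (2 / B ^ 2) ^ j +
        15 * ∑ j ∈ Finset.range n, (2 / B) ^ (j + r) * (B / 2) ^ i) := by
  have hκ1 : κ ≤ 1 := by linarith [hκ'.trans_le (min_le_right (B ^ 2 / 4) (1 / 2))]
  have hq0 := corrRate_pos (B := B) hκ
  have hq1 := corrRate_lt_one hB hκ'
  have hθ := baseWidth_pos hB2
  have hAV := hc.A_le_V hB hB2 hκ hκ'
  have hA := hc.one_le_A hB
  have hV : 0 ≤ V := by linarith
  have hτ : 0 ≤ C₂ * (β ^ 2 / κ ^ r) := mul_nonneg (by linarith [hc.one_le₂]) (by positivity)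
  have hwin := window_anti hB hB2 hθ.le r hi
  have hheat := ev_heat_sub_le (x₀ := x₀) hc.weight₂
    (nonnegCoeff_varPoly (β := β) hB hκ.le hκ1 n)
    (natDegree_varPoly_le_shift r) (by positivity) hc.small hs
    (by rwa [kappa_pow_shift hκ]) (by linarith) (by linarith [hc.one_le₂]) hκ
    (show x₀ + window B (baseWidth B) r i ≤ x₀ + window B (baseWidth B) r (n + r) by linarith)
  have htail := h.tail_le hc hB hκ hκ' hV le_rfl
  have hcorr := hcrit.heatVar_le hB hB2 hκ hc.one_le hc.weight hs hsn le_rfl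
    (show x₀ + window B (baseWidth B) r i ≤ x₀ + window B (baseWidth B) r (n + r) by linarith)
  have hnear := h.near i hi
  have hnearN : ev (varPoly B κ β n) (x₀ + window B (baseWidth B) r (n + r)) ≤
      V * β ^ 2 * (2 / B ^ 2) ^ n := by
    refine (h.near _ le_rfl).trans ?_
    rw [mul_assoc]
    refine (mul_le_mul_of_nonneg_left (hc.near_le hB hB2 hκ hκ' le_rfl hΛ)
      (by positivity)).trans (le_of_eq (by ring))
  rw [excessPoly, ev_add, Finset.sum_range_succ]
  rw [div_self (by positivity), mul_one] at hcorr
  set T := exp (V * β ^ 2 * ∑ j ∈ Finset.range n, (2 / B ^ 2) ^ j +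
        15 * ∑ j ∈ Finset.range n, (2 / B) ^ (j + r) * (B / 2) ^ i)
  have hT : 1 ≤ T := one_le_exp (add_nonneg
    (mul_nonneg (by positivity) (Finset.sum_nonneg fun j _ => by positivity))
    (mul_nonneg (by norm_num) (Finset.sum_nonneg fun j _ => by positivity)))
  rw [window] at hnearN
  set θ := baseWidth B
  set q := corrRate B κ
  set D := C₂ * (β ^ 2 / κ ^ r)
  set S := ∑ j ∈ Finset.range n, q ^ j
  set X := x₀ + window B θ r i
  set u := β ^ 2 * (2 / B ^ 2) ^ n with hu
  have hu0 : 0 ≤ u := by positivity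
  have hqN : q ^ (n + r) ≤ q ^ n := pow_le_pow_of_le_one hq0.le hq1.le (Nat.le_add_right _ _)
  have hqn0 : 0 ≤ q ^ n := by positivity
  have e1 : D * q ^ (n + r) * (ev (varPoly B κ β n) (x₀ + θ * (2 / B) ^ r * (B / 2) ^ (n + r)) +
      tailSum B (θ * (2 / B) ^ r) (6 * θ + 16) x₀ (varPoly B κ β n) (n + r) (n + r)) ≤
      u * q ^ n := by
    calc _ ≤ D * q ^ n * (V * β ^ 2 * (2 / B ^ 2) ^ n + V * β ^ 2 * (2 / B ^ 2) ^ n) :=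
          (mul_le_mul_of_nonneg_left (add_le_add hnearN htail) (by positivity)).trans
            (mul_le_mul_of_nonneg_right (by gcongr) (by positivity))
      _ = 2 * V * D * (u * q ^ n) := by rw [hu]; ring
      _ ≤ 1 * (u * q ^ n) := mul_le_mul_of_nonneg_right hc.small_V (by positivity)
      _ = _ := one_mul _
  have e2 : u * (A * q ^ n) ≤ u * (A * q ^ n) * T := le_mul_of_one_le_right (by positivity) hT
  have e3 : u * (A * (S + q ^ n)) * T = u * (A * S) * T + u * (A * q ^ n) * T := by ring
  -- The two parts of `A` cover the smoothing error and the correlation term respectively.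
  have e4 : u * q ^ n + 4 * C ^ 2 * ((2 / B) ^ r) ^ 2 * (u * q ^ n * exp (6 * θ + 10)) =
      u * (A * q ^ n) := by rw [hc.A_def]; ring
  rw [e3]
  linarith

/-- Near the base point, `g ^ 2 + E / 2` is bounded by an exponential whose exponents are summed in
`VarBound`. Farther away it is at most `exp (K - 2)`, and multiplying by the bound on `E` restores
the offset `-4`. -/
theorem succ (h : VarBound B κ β V A (C₂ * (β ^ 2 / κ ^ r)) r n x₀)
    (hc : VarConst B κ β V A C C₂ r) (hcrit : CritControl B κ β r C c x₀)
    (hB : 1 < B) (hB2 : B < 2) (hκ : 0 < κ) (hκ' : κ < min (B ^ 2 / 4) (1 / 2))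
    (hΛ : V * β ^ 2 * ∑ j ∈ Finset.range (n + 1), (2 / B ^ 2) ^ j ≤ 1) :
    VarBound B κ β V A (C₂ * (β ^ 2 / κ ^ r)) r (n + 1) x₀ := by
  have hκ1 : κ ≤ 1 := by linarith [hκ'.trans_le (min_le_right (B ^ 2 / 4) (1 / 2))]
  have hq0 := corrRate_pos (B := B) hκ
  have hθ := baseWidth_pos hB2
  have hA := hc.one_le_A hB
  have hV : 0 ≤ V := by linarith [hc.A_le_V hB hB2 hκ hκ']
  have hτ : 0 ≤ C₂ * (β ^ 2 / κ ^ r) := mul_nonneg (by linarith [hc.one_le₂]) (by positivity)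
  have hs := stepVar_nonneg (β := β) hκ1 hκ.le n
  have hsn := stepVar_le (β := β) hκ.le n
  have hΛ' := hΛ
  rw [Finset.sum_range_succ, mul_add] at hΛ'
  have hsum0 : 0 ≤ V * β ^ 2 * ∑ j ∈ Finset.range n, (2 / B ^ 2) ^ j :=
    mul_nonneg (by positivity) (Finset.sum_nonneg fun j _ => by positivity)
  have hv0 : 0 ≤ V * β ^ 2 * (2 / B ^ 2) ^ n := by positivity
  have hEpos : ∀ x, 0 ≤ ev (excessPoly B κ β (stepVar κ β n) n (varPoly B κ β n)) x :=
    fun x => (nonnegCoeff_excessPoly (nonnegCoeff_varPoly hB hκ.le hκ1 n) hB hs n).ev_nonneg x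
  have hnear : ∀ i, n + 1 + r ≤ i →
      ev (varPoly B κ β (n + 1)) (x₀ + window B (baseWidth B) r i) ≤
      β ^ 2 * (2 / B ^ 2) ^ (n + 1) *
        (A * ∑ j ∈ Finset.range (n + 1), corrRate B κ ^ j) *
      exp (V * β ^ 2 * ∑ j ∈ Finset.range (n + 1), (2 / B ^ 2) ^ j +
        15 * ∑ j ∈ Finset.range (n + 1), (2 / B) ^ (j + r) * (B / 2) ^ i) := by
    intro i hi
    have hi' : n + r ≤ i := by omega
    have h1 := h.excess_near hc hcrit hB hB2 hκ hκ' (by linarith) hs hsn hi'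
    have h2 := hc.near_le (k := n + 1) hB hB2 hκ hκ' hi' (by linarith)
    have h3 := hcrit.annG_sq_le_near hB hB2 hκ hκ1 hi'
    have h4 := hEpos (x₀ + window B (baseWidth B) r i)
    rw [ev_varPoly_succ hB, Finset.sum_range_succ (fun j => (2 / B ^ 2) ^ j),
      Finset.sum_range_succ (fun j => (2 / B) ^ (j + r) * (B / 2) ^ i)]
    set E := ev (excessPoly B κ β (stepVar κ β n) n (varPoly B κ β n))
      (x₀ + window B (baseWidth B) r i)
    set g := annG B κ β n (x₀ + window B (baseWidth B) r i)
    set δ := (2 / B) ^ (n + r) * (B / 2) ^ i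
    set T := V * β ^ 2 * ∑ j ∈ Finset.range n, (2 / B ^ 2) ^ j +
        15 * ∑ j ∈ Finset.range n, (2 / B) ^ (j + r) * (B / 2) ^ i with hT
    set S := ∑ j ∈ Finset.range (n + 1), corrRate B κ ^ j
    have hE : E ≤ V * β ^ 2 * (2 / B ^ 2) ^ n := by
      refine h1.trans ?_
      rw [mul_assoc]
      exact (mul_le_mul_of_nonneg_left h2 (by positivity)).trans (le_of_eq (by ring))
    have h5 : g ^ 2 + E / 2 ≤ exp (15 * δ + V * β ^ 2 * (2 / B ^ 2) ^ n) := by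
      rw [exp_add]
      have a1 : 1 ≤ exp (15 * δ) := one_le_exp (by positivity)
      have a2 := add_one_le_exp (V * β ^ 2 * (2 / B ^ 2) ^ n)
      have a3 := mul_le_mul_of_nonneg_left (show 1 + E ≤ exp (V * β ^ 2 * (2 / B ^ 2) ^ n) by
        linarith) (exp_nonneg (15 * δ))
      nlinarith
    calc 2 / B ^ 2 * (E * (g ^ 2 + E / 2))
        ≤ 2 / B ^ 2 * ((β ^ 2 * (2 / B ^ 2) ^ n * (A * S) * exp T) *
          exp (15 * δ + V * β ^ 2 * (2 / B ^ 2) ^ n)) := by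
          refine mul_le_mul_of_nonneg_left ?_ (by positivity)
          exact mul_le_mul h1 h5 (by positivity) (h4.trans h1)
      _ = β ^ 2 * (2 / B ^ 2) ^ (n + 1) * (A * S) *
          (exp T * exp (15 * δ + V * β ^ 2 * (2 / B ^ 2) ^ n)) := by ring
      _ = _ := by rw [← exp_add]; congr 2; rw [hT]; ring
  refine ⟨hnear, fun i hi => ?_⟩
  rcases Nat.lt_or_ge (n + r) i with hi' | hi'
  · obtain rfl : i = n + 1 + r := by omega
    refine (hnear _ le_rfl).trans ?_
    rw [mul_assoc, div_self (by positivity), one_mul]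
    have h1 := hc.near_le (k := n + 1) hB hB2 hκ hκ' le_rfl hΛ
    have h2 : 0 ≤ C₂ * (β ^ 2 / κ ^ r) * ∑ j ∈ Finset.range (n + 1), corrRate B κ ^ j :=
      mul_nonneg hτ (Finset.sum_nonneg fun j _ => by positivity)
    calc _ ≤ β ^ 2 * (2 / B ^ 2) ^ (n + 1) * V :=
          mul_le_mul_of_nonneg_left h1 (by positivity)
      _ = V * β ^ 2 * (2 / B ^ 2) ^ (n + 1) * 1 := by ring
      _ ≤ _ := mul_le_mul_of_nonneg_left (one_le_exp (by linarith)) (by positivity)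
  · have h1 := h.excess_far hc hcrit hB hB2 hκ hκ' hs hsn hi'
    have h2 := hcrit.annG_le_far hi'
    have h3 := annG_pos (β := β) hB hκ.le hκ1 n (x₀ + window B (baseWidth B) r i)
    have h4 := hEpos (x₀ + window B (baseWidth B) r i)
    have hW := one_le_two_pow_div hi'
    have hW2 : (2 : ℝ) ^ (n + 1 + r) / 2 ^ i = 2 * (2 ^ (n + r) / 2 ^ i) := by
      rw [show n + 1 + r = n + r + 1 by omega, pow_succ]; ring
    have hDS : 0 ≤ C₂ * (β ^ 2 / κ ^ r) * ∑ j ∈ Finset.range (n + 1), corrRate B κ ^ j :=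
      mul_nonneg hτ (Finset.sum_nonneg fun j _ => by positivity)
    rw [ev_varPoly_succ hB, hW2]
    set E := ev (excessPoly B κ β (stepVar κ β n) n (varPoly B κ β n))
      (x₀ + window B (baseWidth B) r i)
    set g := annG B κ β n (x₀ + window B (baseWidth B) r i)
    set W : ℝ := 2 ^ (n + r) / 2 ^ i
    set θ := baseWidth B
    set K := W * (6 * θ + 14 + C₂ * (β ^ 2 / κ ^ r) *
      ∑ j ∈ Finset.range (n + 1), corrRate B κ ^ j) with hK
    have hv1 : V * β ^ 2 * (2 / B ^ 2) ^ n ≤ 1 := by linarith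
    have a1 : E ≤ exp (K - 2) := h1.trans (mul_le_of_le_one_left (exp_nonneg _) hv1)
    have a2 : g ^ 2 ≤ exp (K - 2) / 2 := by
      have b1 : g ^ 2 ≤ exp ((6 * θ + 6) * W) := by
        calc g ^ 2 ≤ exp ((3 * θ + 3) * W) ^ 2 := by gcongr
          _ = exp ((6 * θ + 6) * W) := by rw [← exp_nat_mul]; congr 1; push_cast; ring
      have b2 : 2 * exp ((6 * θ + 6) * W) ≤ exp (K - 2) := by
        calc 2 * exp ((6 * θ + 6) * W) ≤ exp 1 * exp ((6 * θ + 6) * W) := by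
              have := add_one_le_exp (1 : ℝ)
              exact mul_le_mul_of_nonneg_right (by linarith) (exp_nonneg _)
          _ ≤ exp (K - 2) := by
              rw [← exp_add]; refine exp_le_exp.2 ?_; rw [hK]; nlinarith
      linarith
    calc 2 / B ^ 2 * (E * (g ^ 2 + E / 2))
        ≤ 2 / B ^ 2 * ((V * β ^ 2 * (2 / B ^ 2) ^ n * exp (K - 2)) * exp (K - 2)) := by
          refine mul_le_mul_of_nonneg_left ?_ (by positivity)
          exact mul_le_mul h1 (by linarith) (by positivity) (h4.trans h1)
      _ = V * β ^ 2 * (2 / B ^ 2) ^ (n + 1) * (exp (K - 2) * exp (K - 2)) := by ring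
      _ = _ := by rw [← exp_add, hK]; congr 2; ring

end VarBound

theorem VarConst.varBound (hc : VarConst B κ β V A C C₂ r) (hcrit : CritControl B κ β r C c x₀)
    (hB : 1 < B) (hB2 : B < 2) (hκ : 0 < κ) (hκ' : κ < min (B ^ 2 / 4) (1 / 2)) (n : ℕ)
    (hΛ : V * β ^ 2 * ∑ j ∈ Finset.range n, (2 / B ^ 2) ^ j ≤ 1) :
    VarBound B κ β V A (C₂ * (β ^ 2 / κ ^ r)) r n x₀ := by
  have hV : 0 ≤ V := by linarith [hc.A_le_V hB hB2 hκ hκ', hc.one_le_A hB]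
  induction n with
  | zero => exact varBound_zero hV
  | succ n ih =>
    refine (ih ?_).succ hc hcrit hB hB2 hκ hκ' hΛ
    rw [Finset.sum_range_succ, mul_add] at hΛ
    have : 0 ≤ V * β ^ 2 * (2 / B ^ 2) ^ n := by positivity
    linarith

/-- Bounds on the annealed partition function and on the variance of the partition function near
the annealed critical point, for weak disorder. -/
theorem exists_variance_control (hB : 1 < B) (hB2 : B < 2) (hκ : 0 < κ)
    (hκ' : κ < min (B ^ 2 / 4) (1 / 2)) (r : ℕ) :
    ∃ C c V : ℝ, 1 ≤ C ∧ 0 < c ∧ 1 ≤ V ∧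
      WeightBound B κ (baseWidth B * (2 / B) ^ r) (3 * baseWidth B + 4) C ∧
      ∀ β, c * β ^ 2 ≤ 1 → ∀ x₀, IsCritical B κ β x₀ → CritControl B κ β r C c x₀ ∧
        ∀ n, V * β ^ 2 * ∑ j ∈ Finset.range n, (2 / B ^ 2) ^ j ≤ 1 → ∀ i ≤ n + r,
          ev (excessPoly B κ β (β ^ 2 * κ ^ n) n (varPoly B κ β n))
              (x₀ + window B (baseWidth B) r i) ≤
            V * β ^ 2 * (2 / B ^ 2) ^ n * exp ((6 * baseWidth B + 15) * (2 ^ (n + r) / 2 ^ i)) := by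
  have hθ := baseWidth_pos hB2
  have h1q : 0 < 1 - corrRate B κ := by linarith [corrRate_lt_one hB hκ']
  obtain ⟨C, c, hC, hc, hW, H⟩ := exists_crit_control hB hB2 hκ hκ' r
  obtain ⟨C₂, hC₂, hW₂⟩ := exists_gaussian_weight_bound hB hB2 hκ hκ'
    (show 0 < baseWidth B * (2 / B) ^ r by positivity)
    (show 0 ≤ 6 * baseWidth B + 16 by linarith)
  set A := 1 + 4 * C ^ 2 * ((2 / B) ^ r) ^ 2 * exp (6 * baseWidth B + 10) with hA
  set V := A / (1 - corrRate B κ) * exp (1 + 15 / (2 / B - 1)) with hV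
  have hA0 : 0 < A := by positivity
  have hV0 : 0 < V := by positivity
  set D := C₂ / κ ^ r with hD
  have hD0 : 0 < D := by positivity
  have hc' : c ≤ max c (max (2 * V * D) (max D (D / (1 - corrRate B κ)))) := le_max_left _ _
  refine ⟨C, _, V, hC, hc.trans_le hc', ?_, hW, fun β hβ x₀ hx₀ => ?_⟩
  · have : VarConst B κ 0 V A C C₂ r := ⟨hC, hW, hC₂, hW₂, by simp, by simp, by simpa using h1q.le,
      hA, hV⟩
    linarith [this.A_le_V hB hB2 hκ hκ', this.one_le_A hB]
  · have hb0 := sq_nonneg β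
    have key : ∀ a, a ≤ max c (max (2 * V * D) (max D (D / (1 - corrRate B κ)))) → a * β ^ 2 ≤ 1 :=
      fun a ha => (mul_le_mul_of_nonneg_right ha hb0).trans hβ
    have hcrit := H β (key c hc') x₀ hx₀
    have eD : C₂ * (β ^ 2 / κ ^ r) = D * β ^ 2 := by rw [hD]; ring
    have hconst : VarConst B κ β V A C C₂ r := by
      refine ⟨hC, hW, hC₂, hW₂, ?_, ?_, ?_, hA, hV⟩
      · rw [eD]; exact key D (by simp)
      · rw [eD, ← mul_assoc]; exact key (2 * V * D) (by simp)
      · have := key (D / (1 - corrRate B κ)) (by simp)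
        rw [div_mul_eq_mul_div, div_le_one h1q] at this
        rwa [eD]
    have hmono : c * β ^ 2 ≤ max c (max (2 * V * D) (max D (D / (1 - corrRate B κ)))) * β ^ 2 :=
      mul_le_mul_of_nonneg_right hc' hb0
    refine ⟨{ hcrit with step := fun n => (hcrit.step n).mono hB le_rfl ?_,
                         lower := fun n => le_trans ?_ (hcrit.lower n) }, fun n hΛ i hi => ?_⟩
    · exact mul_le_mul_of_nonneg_right hmono (pow_nonneg (corrRate_pos hκ).le n)
    · have := mul_le_mul_of_nonneg_right hmono (pow_nonneg (corrRate_pos (B := B) hκ).le n)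
      linarith
    · have hV1 := (hconst.varBound hcrit hB hB2 hκ hκ' n hΛ)
      refine (hV1.excess_far hconst hcrit hB hB2 hκ hκ' (by positivity) le_rfl hi).trans ?_
      refine mul_le_mul_of_nonneg_left (exp_le_exp.2 ?_) (by positivity)
      have h1 := geom_sum_le_inv (corrRate_pos (B := B) hκ).le (corrRate_lt_one hB hκ') (n + 1)
      have h2 : C₂ * (β ^ 2 / κ ^ r) * ∑ j ∈ Finset.range (n + 1), corrRate B κ ^ j ≤ 1 := by
        calc _ ≤ (1 - corrRate B κ) * (1 - corrRate B κ)⁻¹ :=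
              mul_le_mul hconst.small_sum h1
                (Finset.sum_nonneg fun j _ => pow_nonneg (corrRate_pos hκ).le j) h1q.le
          _ = 1 := mul_inv_cancel₀ h1q.ne'
      have hW1 : (0 : ℝ) ≤ 2 ^ (n + r) / 2 ^ i := by positivity
      nlinarith

end

end

end HierPinning

/-! ### Comparison of the free energies above the critical window. -/

namespace HierPinning

noncomputable section

open Polynomial

section

variable {B κ β c C x₀ x : ℝ} {r m i : ℕ}

/-- Once the mean is at least `1`, the additive tail can be absorbed multiplicatively, so that the
logarithm doubles up to an error. -/
theorem CritControl.log_annF_succ_le (h : CritControl B κ β r C c x₀) (hB : 1 < B) (hκ : 0 < κ)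
    (hκ1 : κ ≤ 1) (hC : 1 ≤ C)
    (hW : WeightBound B κ (baseWidth B * (2 / B) ^ r) (3 * baseWidth B + 4) C)
    (hi : i ≤ m + r) (hx : x ≤ x₀ + window B (baseWidth B) r i) (hf : 1 ≤ annF B κ β m x) :
    log (annF B κ β (m + 1) x) ≤ 2 * (log (annF B κ β m x) +
      (C * (β ^ 2 / κ ^ r) * corrRate B κ ^ (m + r) * (2 ^ (m + r) / 2 ^ i) +
        2 ^ i / 2 ^ (m + r))) := by
  have hq0 := corrRate_pos (B := B) hκ
  have hs := stepVar_nonneg (β := β) hκ1 hκ.le m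
  have hsn : stepVar κ β m ≤ β ^ 2 / κ ^ r * κ ^ (m + r) := by
    rw [kappa_pow_shift hκ]; exact stepVar_le hκ.le m
  have h1 := ev_heat_le_window (x₀ := x₀) hW (nonnegCoeff_annPoly (κ := κ) (β := β) hB m)
    (natDegree_annPoly_le_shift r) (by positivity) h.small hs hsn hi hx
  have h2 := (h.upper m).tail_le le_rfl hi
  change annG B κ β m x ≤ exp (C * (β ^ 2 / κ ^ r) * corrRate B κ ^ (m + r) *
    (2 ^ (m + r) / 2 ^ i)) * annF B κ β m x + _ at h1
  have hg1 : 1 ≤ annG B κ β m x := hf.trans (annF_le_annG hB hκ.le hκ1 m x)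
  have ha : 0 ≤ C * (β ^ 2 / κ ^ r) * corrRate B κ ^ (m + r) * (2 ^ (m + r) / 2 ^ i) := by
    positivity
  have hw : (0 : ℝ) ≤ 2 ^ i / 2 ^ (m + r) := by positivity
  set a := C * (β ^ 2 / κ ^ r) * corrRate B κ ^ (m + r) * (2 ^ (m + r) / 2 ^ i)
  set w : ℝ := 2 ^ i / 2 ^ (m + r)
  set f := annF B κ β m x
  set g := annG B κ β m x
  have hgf : g ≤ f * exp (a + w) := by
    rw [exp_add]
    have e1 : 1 ≤ exp a := one_le_exp ha
    have e2 := add_one_le_exp w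
    have e3 : w ≤ exp a * f * w := le_mul_of_one_le_left hw (by nlinarith)
    have e4 : exp a * f * (w + 1) ≤ exp a * f * exp w :=
      mul_le_mul_of_nonneg_left e2 (by positivity)
    linarith
  have hfg : annF B κ β (m + 1) x ≤ g ^ 2 := by
    rw [annF_succ, div_le_iff₀ (by linarith)]
    have : 1 ≤ g ^ 2 := one_le_pow₀ hg1
    nlinarith
  have hlog := log_le_log (annF_pos hB _ _) hfg
  rw [log_pow] at hlog
  have hlog2 := log_le_log (by linarith) hgf
  rw [log_mul (by linarith) (exp_pos _).ne', log_exp] at hlog2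
  push_cast at hlog
  linarith

theorem CritControl.log_annF_add_le (h : CritControl B κ β r C c x₀) (hB : 1 < B) (hB2 : B < 2)
    (hκ : 0 < κ) (hκ' : κ < min (B ^ 2 / 4) (1 / 2)) (hC : 1 ≤ C)
    (hW : WeightBound B κ (baseWidth B * (2 / B) ^ r) (3 * baseWidth B + 4) C)
    (hi : i ≤ m + r) (hx : x ≤ x₀ + window B (baseWidth B) r i) (hf : 1 ≤ annF B κ β m x)
    (l : ℕ) :
    log (annF B κ β (m + l) x) ≤ 2 ^ l * (log (annF B κ β m x) +
      C * (β ^ 2 / κ ^ r) * corrRate B κ ^ m * (2 ^ (m + r) / 2 ^ i) *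
        ∑ t ∈ Finset.range l, corrRate B κ ^ t + ∑ t ∈ Finset.range l, (1 / 2) ^ t) := by
  have hκ1 : κ ≤ 1 := by linarith [hκ'.trans_le (min_le_right (B ^ 2 / 4) (1 / 2))]
  have hq0 := corrRate_pos (B := B) hκ
  have hq1 := corrRate_lt_one hB hκ'
  induction l with
  | zero => simp
  | succ l ih =>
    have hfl : 1 ≤ annF B κ β (m + l) x := by
      refine le_trans ?_ (annF_growth hB hκ.le hκ1 hf l)
      have : 0 ≤ (2 / B) ^ l * (annF B κ β m x - 1) := mul_nonneg (by positivity) (by linarith)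
      linarith
    have h1 := h.log_annF_succ_le hB hκ hκ1 hC hW (show i ≤ m + l + r by omega) hx hfl
    rw [← add_assoc]
    refine h1.trans ?_
    rw [Finset.sum_range_succ, Finset.sum_range_succ, pow_succ (2 : ℝ) l]
    have hw1 := one_le_two_pow_div hi
    have e1 : (2 : ℝ) ^ (m + l + r) / 2 ^ i = 2 ^ l * (2 ^ (m + r) / 2 ^ i) := by
      rw [show m + l + r = l + (m + r) by omega, pow_add]; ring
    have e2 : corrRate B κ ^ (m + l + r) ≤ corrRate B κ ^ m * corrRate B κ ^ l := by
      rw [← pow_add]; exact pow_le_pow_of_le_one hq0.le hq1.le (by omega)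
    have e3 : (2 : ℝ) ^ i / 2 ^ (m + l + r) ≤ 2 ^ l * (1 / 2) ^ l := by
      rw [← mul_pow, mul_one_div_cancel two_ne_zero, one_pow, div_le_one (by positivity)]
      exact pow_le_pow_right₀ (by norm_num) (by omega)
    rw [e1]
    have e4 : C * (β ^ 2 / κ ^ r) * corrRate B κ ^ (m + l + r) * (2 ^ l * (2 ^ (m + r) / 2 ^ i)) ≤
        C * (β ^ 2 / κ ^ r) * (corrRate B κ ^ m * corrRate B κ ^ l) *
          (2 ^ l * (2 ^ (m + r) / 2 ^ i)) := by gcongr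
    linarith

variable {Ω : Type*} [MeasurableSpace Ω] {P : Measure Ω} {ω : ℕ → Ω → ℝ}

theorem CritControl.annealedF_le (h : CritControl B κ β r C c x₀) (hB : 1 < B) (hB2 : B < 2)
    (hκ : 0 < κ) (hκ' : κ < min (B ^ 2 / 4) (1 / 2)) (hω : IsHierGaussian κ P ω) (hC : 1 ≤ C)
    (hW : WeightBound B κ (baseWidth B * (2 / B) ^ r) (3 * baseWidth B + 4) C)
    (hi : i ≤ m + r) (hx : x ≤ x₀ + window B (baseWidth B) r i) (hf : 1 ≤ annF B κ β m x)
    (hsmall : C * (β ^ 2 / κ ^ r) * corrRate B κ ^ m * (2 ^ (m + r) / 2 ^ i) ≤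
      1 - corrRate B κ) :
    annealedF B P ω β x ≤ (log (annF B κ β m x) + 3) / 2 ^ m := by
  have hq0 := corrRate_pos (B := B) hκ
  have hq1 := corrRate_lt_one hB hκ'
  refine HierPinning.annealedF_le hB hκ.le (hκ'.trans_le (min_le_right _ _)) hω
    ((eventually_ge_atTop m).mono fun n hn => ?_)
  obtain ⟨l, rfl⟩ := Nat.exists_eq_add_of_le hn
  refine (h.log_annF_add_le hB hB2 hκ hκ' hC hW hi hx hf l).trans ?_
  have e : (log (annF B κ β m x) + 3) / 2 ^ m * 2 ^ (m + l) =
      2 ^ l * (log (annF B κ β m x) + 3) := by rw [pow_add]; field_simp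
  rw [e]
  refine mul_le_mul_of_nonneg_left ?_ (by positivity)
  -- The correlation errors total at most `1` and the tails at most `2`, whence the constant `3`.
  have h1 := geom_sum_le_inv (q := 1 / 2) (by norm_num) (by norm_num) l
  have h2 := geom_sum_le_inv hq0.le hq1 l
  have h1q : 0 < 1 - corrRate B κ := by linarith
  have h3 := mul_le_mul hsmall h2 (Finset.sum_nonneg fun t _ => by positivity) h1q.le
  rw [mul_inv_cancel₀ h1q.ne'] at h3
  norm_num at h1
  norm_num
  linarith

/-- The variance costs the fraction `η / 2` of `log A`; the other `η / 2` pays for all additive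
constants, which is why the mean has to exceed the stated exponential. -/
theorem quenchedF_ge_of_excess_le (hB : 1 < B) (hκ : 0 ≤ κ) (hκ2 : κ < 1 / 2)
    (hω : IsHierGaussian κ P ω) {η : ℝ} (hη : 0 < η) (hη1 : η < 1) {n : ℕ}
    (hf : exp (2 / η * (4 + log B - log ((B - 1) / B))) ≤ annF B κ β (n + 1) x)
    (hv : ev (excessPoly B κ β (β ^ 2 * κ ^ (n + 1)) (n + 1) (varPoly B κ β (n + 1))) x ≤ η / 8)
    (ha : annealedF B P ω β x ≤ (log (annF B κ β (n + 1) x) + 3) / 2 ^ (n + 1)) :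
    (1 - η) * annealedF B P ω β x ≤ quenchedF B P ω β x := by
  have hK : log ((B - 1) / B) ≤ 0 :=
    log_nonpos (div_nonneg (by linarith) (by linarith)) (by rw [div_le_one (by linarith)]; linarith)
  have hlB := log_pos hB
  have hs : 0 ≤ β ^ 2 * κ ^ (n + 1) := by positivity
  have hfA : annF B κ β (n + 1) x ≤ ev (heat (β ^ 2 * κ ^ (n + 1)) (annPoly B κ β (n + 1))) x :=
    (nonnegCoeff_annPoly hB (n + 1)).ev_le_ev_heat hs x
  have h0 : 0 ≤ 2 / η * (4 + log B - log ((B - 1) / B)) :=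
    mul_nonneg (by positivity) (by linarith)
  have hf1 : 1 ≤ annF B κ β (n + 1) x := (one_le_exp h0).trans hf
  have hq := integral_log_partZ_ge (β := β) (h := x) hB hω n (hf1.trans hfA)
  have hF := (tendsto_quenchedF_n_and_le hB hκ hκ2 hω β x).2 (n + 1)
  set A := ev (heat (β ^ 2 * κ ^ (n + 1)) (annPoly B κ β (n + 1))) x
  set v := ev (excessPoly B κ β (β ^ 2 * κ ^ (n + 1)) (n + 1) (varPoly B κ β (n + 1))) x
  set f := annF B κ β (n + 1) x
  set K := log ((B - 1) / B)
  have hlf : log f ≤ log A := log_le_log (by linarith) hfA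
  have hl0 : 2 / η * (4 + log B - K) ≤ log f := by
    have := log_le_log (exp_pos _) hf
    rwa [log_exp] at this
  have hl1 : 4 + log B - K ≤ η / 2 * log f := by
    have := mul_le_mul_of_nonneg_left hl0 (show 0 ≤ η / 2 by linarith)
    rwa [← mul_assoc, show η / 2 * (2 / η) = 1 by field_simp, one_mul] at this
  refine (mul_le_mul_of_nonneg_left ha (by linarith)).trans (le_trans ?_ hF)
  rw [← mul_div_assoc]
  refine div_le_div_of_nonneg_right ?_ (by positivity)
  have hlog2 : log 2 ≤ 1 := by have := log_two_lt_d9; linarith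
  have h4 : 4 * (log A - K) * v ≤ 4 * (log A - K) * (η / 8) :=
    mul_le_mul_of_nonneg_left hv (by linarith)
  have h5 : (1 - η / 2) * log f ≤ (1 - η / 2) * log A :=
    mul_le_mul_of_nonneg_left hlf (by linarith)
  have h6 : 0 ≤ -K * (1 - η / 2) := mul_nonneg (by linarith) (by linarith)
  have hq' : log A - log 2 - 4 * (log A - K) * v ≤ ∫ a, log (partZ B β x ω (n + 1) a) ∂P := hq
  linarith

theorem isCritical_annealedHc (hB : 1 < B) (hB2 : B < 2) (hκ : 0 ≤ κ) (hκ2 : κ < 1 / 2)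
    (hω : IsHierGaussian κ P ω) (β : ℝ) : IsCritical B κ β (annealedHc B P ω β) := by
  refine ⟨(le_annealedHc_iff hB hB2 hκ hκ2 hω β _).1 le_rfl, fun x hx => ?_⟩
  by_contra! hn
  exact absurd ((le_annealedHc_iff hB hB2 hκ hκ2 hω β x).2 hn) (not_le.2 hx)

/-- Comparison of the free energies at a distance `u` from the annealed critical point, in terms
of the level `i` at which `u` is of the order of the critical window. -/
theorem exists_comparison (hB : 1 < B) (hB2 : B < 2) (hκ : 0 < κ)
    (hκ' : κ < min (B ^ 2 / 4) (1 / 2)) (hω : IsHierGaussian κ P ω) :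
    ∃ b Θ : ℝ, 0 < b ∧ 1 ≤ Θ ∧ ∀ η, 0 < η → η < 1 → ∃ k : ℕ, ∃ δ > 0, ∀ β u : ℝ, ∀ i : ℕ,
      b * β ^ 2 ≤ 1 → Θ * (B / 2) ^ (i + 1) < u → u ≤ Θ * (B / 2) ^ i →
      b * β ^ 2 * ∑ j ∈ Finset.range (i + k), (2 / B ^ 2) ^ j ≤ 1 →
      β ^ 2 * (2 / B ^ 2) ^ (i + k) ≤ δ → β ^ 2 * corrRate B κ ^ (i + k) ≤ δ →
      (1 - η) * annealedF B P ω β (annealedHc B P ω β + u) ≤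
        quenchedF B P ω β (annealedHc B P ω β + u) := by
  have hκ2 : κ < 1 / 2 := hκ'.trans_le (min_le_right _ _)
  have hκ1 : κ ≤ 1 := by linarith
  have hθ := baseWidth_pos hB2
  have hq0 := corrRate_pos (B := B) hκ
  have hq1 := corrRate_lt_one hB hκ'
  have h1q : 0 < 1 - corrRate B κ := by linarith
  have hg : 1 < 2 / B := (one_lt_div (by linarith)).2 hB2
  -- The grid is enlarged until its outer width exceeds `1`, although the Taylor expansion only
  -- holds in the narrower `baseWidth`; then every `u < 1` lies in some window and forces growth at
  -- level `i + 1`.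
  obtain ⟨r, hr⟩ := pow_unbounded_of_one_lt (1 / baseWidth B) hg
  rw [div_lt_iff₀' hθ] at hr
  obtain ⟨C, c, V, hC, hc, hV, hW, H⟩ := exists_variance_control hB hB2 hκ hκ' r
  refine ⟨max (4 * c) V, baseWidth B * (2 / B) ^ r, lt_max_of_lt_right (by linarith), hr.le,
    fun η hη hη1 => ?_⟩
  -- The excess over `1` starts at `1 / 4` and grows by `2 / B` per level: after `k` levels the mean
  -- passes the threshold of `quenchedF_ge_of_excess_le`.
  obtain ⟨k, hk⟩ := pow_unbounded_of_one_lt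
    (4 * exp (2 / η * (4 + log B - log ((B - 1) / B)))) hg
  set δ₁ := η / 8 / (V * exp ((6 * baseWidth B + 15) * 2 ^ (k + 1 + r))) with hδ₁
  set δ₂ := (1 - corrRate B κ) * κ ^ r / (C * 2 ^ (k + 1 + r)) with hδ₂
  refine ⟨k + 1, min δ₁ δ₂, lt_min (by positivity) (by positivity),
    fun β u i hbβ hiu hui hΛ hδV hδC => ?_⟩
  have hb0 := sq_nonneg β
  have hcβ : 4 * c * β ^ 2 ≤ 1 := (mul_le_mul_of_nonneg_right (le_max_left _ _) hb0).trans hbβ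
  set x₀ := annealedHc B P ω β
  obtain ⟨hcrit, hvar⟩ := H β (by nlinarith) x₀ (isCritical_annealedHc hB hB2 hκ.le hκ2 hω β)
  have hu0 : 0 < u := lt_of_le_of_lt (by positivity) hiu
  have hx : x₀ + u ≤ x₀ + window B (baseWidth B) r i := add_le_add_right hui _
  have him : i ≤ i + (k + 1) + r := by omega
  have hWm : (2 : ℝ) ^ (i + (k + 1) + r) / 2 ^ i = 2 ^ (k + 1 + r) := by
    rw [add_assoc, pow_add]; field_simp
  have hΛ' : V * β ^ 2 * ∑ j ∈ Finset.range (i + (k + 1)), (2 / B ^ 2) ^ j ≤ 1 :=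
    le_trans (mul_le_mul_of_nonneg_right (mul_le_mul_of_nonneg_right (le_max_right _ _) hb0)
      (Finset.sum_nonneg fun j _ => by positivity)) hΛ
  -- The slope contributes at least `1 / 2`, and the deficit at criticality is at most `1 / 4`.
  have hlow : 5 / 4 ≤ annF B κ β (i + 1) (x₀ + u) := by
    have h1 := hcrit.slope (i + 1) u hu0.le
    have h2 := hcrit.lower (i + 1)
    have h3 : c * β ^ 2 * corrRate B κ ^ (i + 1) ≤ c * β ^ 2 :=
      mul_le_of_le_one_right (by positivity) (pow_le_one₀ hq0.le hq1.le)
    have h4 := mul_le_mul_of_nonneg_left hiu.le (show 0 ≤ (2 / B) ^ (i + 1) by positivity)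
    rw [mul_left_comm, two_div_pow_mul_div_two_pow hB, mul_one] at h4
    linarith
  have hm : i + (k + 1) = i + 1 + k := by omega
  have hf : exp (2 / η * (4 + log B - log ((B - 1) / B))) ≤
      annF B κ β (i + (k + 1)) (x₀ + u) := by
    rw [hm]
    refine le_trans ?_ (annF_growth hB hκ.le hκ1 (by linarith) k)
    have : (2 / B) ^ k * (1 / 4) ≤ (2 / B) ^ k * (annF B κ β (i + 1) (x₀ + u) - 1) :=
      mul_le_mul_of_nonneg_left (by linarith) (by positivity)
    linarith
  have hf1 : 1 ≤ annF B κ β (i + (k + 1)) (x₀ + u) := by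
    rw [hm]
    refine le_trans ?_ (annF_growth hB hκ.le hκ1 (by linarith) k)
    have : 0 ≤ (2 / B) ^ k * (annF B κ β (i + 1) (x₀ + u) - 1) :=
      mul_nonneg (by positivity) (by linarith)
    linarith
  refine quenchedF_ge_of_excess_le (n := i + k) hB hκ.le hκ2 hω hη hη1 hf ?_ ?_
  · have h1 := hvar (i + (k + 1)) hΛ' i him
    rw [hWm] at h1
    refine ((nonnegCoeff_excessPoly (nonnegCoeff_varPoly hB hκ.le hκ1 _) hB (by positivity)
      _).ev_mono hx).trans (h1.trans ?_)
    have h2 := hδV.trans (min_le_left _ _)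
    rw [hδ₁, le_div_iff₀ (by positivity)] at h2
    linarith
  · refine hcrit.annealedF_le hB hB2 hκ hκ' hω hC hW him hx hf1 ?_
    rw [show i + k + 1 = i + (k + 1) from rfl, hWm]
    have h2 := hδC.trans (min_le_right _ _)
    rw [hδ₂, le_div_iff₀ (by positivity), ← div_le_iff₀ (by positivity)] at h2
    refine le_trans (le_of_eq ?_) h2
    ring

end

end

end HierPinning

/-! ### The three regimes of the geometric sum. -/

namespace HierPinning

noncomputable section

section

variable {B κ : ℝ} {Ω : Type*} [MeasurableSpace Ω] {P : Measure Ω} {ω : ℕ → Ω → ℝ}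

theorem exists_window {B Θ u : ℝ} (hB : 1 < B) (hB2 : B < 2) (hΘ : 1 ≤ Θ) (hu : 0 < u)
    (hu1 : u < 1) : ∃ i : ℕ, Θ * (B / 2) ^ (i + 1) < u ∧ u ≤ Θ * (B / 2) ^ i := by
  have hΘ0 : 0 < Θ := by linarith
  obtain ⟨i, h1, h2⟩ := exists_nat_pow_near_of_lt_one (div_pos hu hΘ0)
    ((div_le_one hΘ0).2 (by linarith)) (show 0 < B / 2 by linarith)
    (show B / 2 < 1 by linarith)
  exact ⟨i, by rwa [lt_div_iff₀' hΘ0] at h1, by rwa [div_le_iff₀' hΘ0] at h2⟩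

theorem two_div_pow_le_of_le {B Θ u : ℝ} {i : ℕ} (hB : 1 < B) (hu : 0 < u)
    (h : u ≤ Θ * (B / 2) ^ i) : (2 / B) ^ i ≤ Θ / u := by
  rw [le_div_iff₀ hu]
  have h1 := mul_le_mul_of_nonneg_left h (show 0 ≤ (2 / B) ^ i by positivity)
  rwa [mul_left_comm, two_div_pow_mul_div_two_pow hB, mul_one] at h1

/-- The series converges, so its bound fixes `β₀` independently of `η`; a small `u` forces a large
level, which makes the two remaining terms small. -/
theorem comparison_of_sqrt_two_lt (hB : 1 < B) (hB2 : B < 2) (hκ : 0 < κ)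
    (hκ' : κ < min (B ^ 2 / 4) (1 / 2)) (hω : IsHierGaussian κ P ω) (hBs : √2 < B) :
    ∃ β₀ : ℝ, 0 < β₀ ∧ ∀ η : ℝ, 0 < η → η < 1 → ∃ ε : ℝ, 0 < ε ∧
      ∀ β : ℝ, 0 ≤ β → β ≤ β₀ → ∀ u : ℝ, 0 < u → u < ε →
        (1 - η) * annealedF B P ω β (annealedHc B P ω β + u) ≤
          quenchedF B P ω β (annealedHc B P ω β + u) := by
  obtain ⟨b, Θ, hb, hΘ, H⟩ := exists_comparison hB hB2 hκ hκ' hω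
  have hB2' : 2 < B ^ 2 := (sqrt_lt' (by linarith)).1 hBs
  have hq0 := corrRate_pos (B := B) hκ
  have hq1 := corrRate_lt_one hB hκ'
  have hl1 : 2 / B ^ 2 < 1 := (div_lt_one (by linarith)).2 hB2'
  have hl0 : 0 < 2 / B ^ 2 := by positivity
  have h1l : 0 < 1 - 2 / B ^ 2 := by linarith
  refine ⟨√((1 - 2 / B ^ 2) / b), sqrt_pos.2 (by positivity), fun η hη hη1 => ?_⟩
  obtain ⟨k, δ, hδ, H⟩ := H η hη hη1
  set ρ := max (2 / B ^ 2) (corrRate B κ) with hρ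
  have hρ0 : 0 ≤ ρ := hl0.le.trans (le_max_left _ _)
  have hρ1 : ρ < 1 := max_lt hl1 hq1
  obtain ⟨N, hN⟩ := exists_pow_lt_of_lt_one (show 0 < b * δ by positivity) hρ1
  refine ⟨min 1 (Θ * (B / 2) ^ N), lt_min one_pos (by positivity), fun β hβ hββ u hu huε => ?_⟩
  obtain ⟨i, hiu, hui⟩ := exists_window hB hB2 hΘ hu (huε.trans_le (min_le_left _ _))
  have hNi : N ≤ i + k := by
    by_contra! hlt
    have h1 : Θ * (B / 2) ^ N ≤ Θ * (B / 2) ^ (i + 1) := by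
      refine mul_le_mul_of_nonneg_left ?_ (by linarith)
      exact pow_le_pow_of_le_one (by linarith) (by linarith) (by omega)
    linarith [huε.trans_le (min_le_right _ _)]
  have hβ2 : b * β ^ 2 ≤ 1 - 2 / B ^ 2 := by
    have := (le_sqrt hβ (by positivity)).1 hββ
    rwa [le_div_iff₀' hb] at this
  have hpow : ∀ a, 0 ≤ a → a ≤ ρ → β ^ 2 * a ^ (i + k) ≤ δ := fun a ha haρ => by
    have h1 : a ^ (i + k) ≤ b * δ := (pow_le_pow_left₀ ha haρ _).trans
      ((pow_le_pow_of_le_one hρ0 hρ1.le hNi).trans hN.le)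
    have h2 := mul_le_mul_of_nonneg_left h1 (sq_nonneg β)
    nlinarith
  refine H β u i (by linarith) hiu hui ?_ (hpow _ hl0.le (le_max_left _ _))
    (hpow _ hq0.le (le_max_right _ _))
  calc _ ≤ (1 - 2 / B ^ 2) * (1 - 2 / B ^ 2)⁻¹ :=
        mul_le_mul hβ2 (geom_sum_le_inv hl0.le hl1 _)
          (Finset.sum_nonneg fun j _ => by positivity) h1l.le
    _ = 1 := mul_inv_cancel₀ h1l.ne'

/-- By definition of `ν`, `(2 / B) ^ ν = 2`. -/
theorem two_div_rpow_two_sub_pureNu (hB : 1 < B) (hB2 : B < 2) :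
    (2 / B) ^ (2 - pureNu B) = 2 / B ^ 2 := by
  have hg : 1 < 2 / B := (one_lt_div (by linarith)).2 hB2
  have hl := log_pos hg
  rw [rpow_sub (by linarith), rpow_two, rpow_def_of_pos (x := 2 / B) (by linarith), pureNu,
    mul_div_cancel₀ _ hl.ne', exp_log two_pos]
  field_simp

/-- The geometric sum is comparable to its last term, so both conditions reduce to `β ^ 2 * l ^ (i +
k) ≤ δ'`. As `l ^ i` is at most `(Θ / u) ^ (2 - ν)`, this follows from the lower bound on `u`, and
solving for `u` gives the constant `c`. -/
theorem comparison_of_lt_sqrt_two (hB : 1 < B) (hB2 : B < 2) (hκ : 0 < κ)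
    (hκ' : κ < min (B ^ 2 / 4) (1 / 2)) (hω : IsHierGaussian κ P ω) (hBs : B < √2)
    {η : ℝ} (hη : 0 < η) (hη1 : η < 1) :
    ∃ c β₀ ε : ℝ, 0 < c ∧ 0 < β₀ ∧ 0 < ε ∧ ∀ β : ℝ, 0 ≤ β → β ≤ β₀ →
      ∀ u : ℝ, c * β ^ (2 / (2 - pureNu B)) < u → u < ε →
        (1 - η) * annealedF B P ω β (annealedHc B P ω β + u) ≤
          quenchedF B P ω β (annealedHc B P ω β + u) := by
  obtain ⟨b, Θ, hb, hΘ, H⟩ := exists_comparison hB hB2 hκ hκ' hω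
  obtain ⟨k, δ, hδ, H⟩ := H η hη hη1
  have hB2' : B ^ 2 < 2 := (lt_sqrt (by linarith)).1 hBs
  have hq0 := corrRate_pos (B := B) hκ
  have hq1 := corrRate_lt_one hB hκ'
  have hg : 1 < 2 / B := (one_lt_div (by linarith)).2 hB2
  have hl1 : 1 < 2 / B ^ 2 := (one_lt_div (by positivity)).2 hB2'
  have hl0 : 0 < 2 / B ^ 2 := by linarith
  have hpow := two_div_rpow_two_sub_pureNu hB hB2
  have ha : 0 < 2 - pureNu B := by
    by_contra! hneg
    have := rpow_le_one_of_one_le_of_nonpos hg.le hneg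
    linarith
  set a := 2 - pureNu B
  set l := 2 / B ^ 2
  set δ' := min δ ((l - 1) / b) with hδ'
  have hδ0 : 0 < δ' := lt_min hδ (div_pos (by linarith) hb)
  have hΘ0 : 0 < Θ := by linarith
  have hc0 : 0 < l ^ k / δ' := by positivity
  refine ⟨Θ * (l ^ k / δ') ^ (1 / a), √(min (1 / b) δ), 1, by positivity,
    sqrt_pos.2 (lt_min (by positivity) hδ), one_pos, fun β hβ hββ u hcu hu1 => ?_⟩
  have hu : 0 < u := lt_of_le_of_lt (by positivity) hcu
  have hβ2 := (le_sqrt hβ (le_min (by positivity) hδ.le)).1 hββ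
  have hβb : b * β ^ 2 ≤ 1 := by
    have := hβ2.trans (min_le_left _ _)
    rwa [le_div_iff₀' hb] at this
  obtain ⟨i, hiu, hui⟩ := exists_window hB hB2 hΘ hu hu1
  have hua : Θ ^ a * (l ^ k / δ') * β ^ 2 ≤ u ^ a := by
    have h1 := rpow_le_rpow (by positivity) hcu.le ha.le
    rwa [mul_rpow (by positivity) (by positivity), mul_rpow hΘ0.le (by positivity),
      ← rpow_mul hc0.le, ← rpow_mul hβ, one_div_mul_cancel ha.ne', rpow_one,
      div_mul_cancel₀ _ ha.ne', rpow_two] at h1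
  have hli : l ^ i * u ^ a ≤ Θ ^ a := by
    have h1 := rpow_le_rpow (by positivity) (two_div_pow_le_of_le hB hu hui) ha.le
    rw [div_rpow hΘ0.le hu.le, ← rpow_natCast, ← rpow_mul (by positivity), mul_comm (i : ℝ),
      rpow_mul (by positivity), hpow, rpow_natCast, le_div_iff₀ (by positivity)] at h1
    exact h1
  have hmain : β ^ 2 * l ^ (i + k) ≤ δ' := by
    have hΘa : 0 < Θ ^ a := by positivity
    have h1 := mul_le_mul_of_nonneg_left hua (show 0 ≤ l ^ i by positivity)
    have h2 := h1.trans hli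
    have e : l ^ i * (Θ ^ a * (l ^ k / δ') * β ^ 2) = Θ ^ a * (β ^ 2 * l ^ (i + k) / δ') := by
      rw [pow_add]; ring
    rw [e] at h2
    have h3 : β ^ 2 * l ^ (i + k) / δ' ≤ 1 := le_of_mul_le_mul_left (by linarith) hΘa
    rwa [div_le_one hδ0] at h3
  refine H β u i hβb hiu hui ?_ (hmain.trans (min_le_left _ _)) ?_
  · rw [geom_sum_eq hl1.ne', ← mul_div_assoc, div_le_one (by linarith)]
    have h1 := hmain.trans (min_le_right _ _)
    rw [le_div_iff₀' hb] at h1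
    have : 0 ≤ b * β ^ 2 := by positivity
    linarith
  · exact (mul_le_of_le_one_right (sq_nonneg β) (pow_le_one₀ hq0.le hq1.le)).trans
      (hβ2.trans (min_le_right _ _))

/-- The sum is now the number of levels, at most a constant plus a multiple of `|log u|`. With `|log
u| ≤ β ^ (-2 / 3)`, the factor `β ^ 2` leaves `β ^ (4 / 3) ≤ β`, so `c = 1` works once `β₀` is
small. -/
theorem comparison_of_eq_sqrt_two (hB : 1 < B) (hB2 : B < 2) (hκ : 0 < κ)
    (hκ' : κ < min (B ^ 2 / 4) (1 / 2)) (hω : IsHierGaussian κ P ω) (hBs : B = √2)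
    {η : ℝ} (hη : 0 < η) (hη1 : η < 1) :
    ∃ β₀ c : ℝ, 0 < β₀ ∧ 0 < c ∧ ∀ β : ℝ, 0 < β → β ≤ β₀ →
      ∀ u : ℝ, c * exp (-c * β ^ (-(2 / 3) : ℝ)) < u → u < 1 →
        (1 - η) * annealedF B P ω β (annealedHc B P ω β + u) ≤
          quenchedF B P ω β (annealedHc B P ω β + u) := by
  obtain ⟨b, Θ, hb, hΘ, H⟩ := exists_comparison hB hB2 hκ hκ' hω
  obtain ⟨k, δ, hδ, H⟩ := H η hη hη1
  have hl : 2 / B ^ 2 = 1 := by rw [hBs, sq_sqrt (by norm_num), div_self two_ne_zero]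
  have hq0 := corrRate_pos (B := B) hκ
  have hq1 := corrRate_lt_one hB hκ'
  have hg : 0 < log (2 / B) := log_pos ((one_lt_div (by linarith)).2 hB2)
  have hΘl : 0 ≤ log Θ := log_nonneg hΘ
  set M := (log Θ + 1) / log (2 / B) + k + 1 with hM
  have hM1 : 1 ≤ M := by
    have : 0 ≤ (log Θ + 1) / log (2 / B) := by positivity
    have : (0 : ℝ) ≤ k := Nat.cast_nonneg k
    linarith
  refine ⟨min 1 (min (1 / (b * M)) δ), 1, lt_min one_pos (lt_min (by positivity) hδ), one_pos,
    fun β hβ hββ u hcu hu1 => ?_⟩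
  have hβ1 : β ≤ 1 := hββ.trans (min_le_left _ _)
  have hβM : b * β * M ≤ 1 := by
    have := hββ.trans ((min_le_right _ _).trans (min_le_left _ _))
    rw [le_div_iff₀ (by positivity)] at this
    linarith
  have hβδ : β ≤ δ := hββ.trans ((min_le_right _ _).trans (min_le_right _ _))
  have hββ2 : β ^ 2 ≤ β := by nlinarith
  rw [one_mul, neg_one_mul] at hcu
  have hu : 0 < u := (exp_pos _).trans hcu
  obtain ⟨i, hiu, hui⟩ := exists_window hB hB2 hΘ hu hu1
  have hi : i * log (2 / B) ≤ log Θ + β ^ (-(2 / 3) : ℝ) := by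
    have h1 := log_le_log (by positivity) (two_div_pow_le_of_le hB hu hui)
    rw [log_pow, log_div (by linarith) hu.ne'] at h1
    have h2 := log_le_log (exp_pos _) hcu.le
    rw [log_exp] at h2
    linarith
  have hβi : β ^ 2 * (i * log (2 / B)) ≤ β * (log Θ + 1) := by
    refine (mul_le_mul_of_nonneg_left hi (sq_nonneg β)).trans ?_
    have h1 : β ^ 2 * β ^ (-(2 / 3) : ℝ) ≤ β := by
      rw [← rpow_two, ← rpow_add hβ]
      calc β ^ ((2 : ℝ) + -(2 / 3)) ≤ β ^ (1 : ℝ) :=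
            rpow_le_rpow_of_exponent_ge hβ hβ1 (by norm_num)
        _ = β := rpow_one β
    have h2 : β ^ 2 * log Θ ≤ β * log Θ := mul_le_mul_of_nonneg_right hββ2 hΘl
    linarith
  have hβm : β ^ 2 * (i + k : ℕ) ≤ β * M := by
    have h1 : β ^ 2 * i ≤ β * ((log Θ + 1) / log (2 / B)) := by
      rw [← mul_div_assoc, le_div_iff₀ hg]; linarith
    have h2 : β ^ 2 * k ≤ β * k := mul_le_mul_of_nonneg_right hββ2 (Nat.cast_nonneg k)
    push_cast
    rw [hM]
    linarith
  have hbβ : b * β ^ 2 ≤ b * β := mul_le_mul_of_nonneg_left hββ2 hb.le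
  have hbβ1 : b * β ≤ 1 := le_trans (le_mul_of_one_le_right (by positivity) hM1) hβM
  refine H β u i (by linarith) hiu hui ?_ ?_ ?_
  · rw [hl]
    simp only [one_pow, Finset.sum_const, Finset.card_range, nsmul_eq_mul, mul_one]
    have := mul_le_mul_of_nonneg_left hβm hb.le
    linarith
  · rw [hl, one_pow, mul_one]; linarith
  · exact (mul_le_of_le_one_right (sq_nonneg β) (pow_le_one₀ hq0.le hq1.le)).trans (by linarith)

end

end

end HierPinning

theorem proposition6p1 {Ω : Type*} [MeasurableSpace Ω] (P : Measure Ω) (ω : ℕ → Ω → ℝ)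
    (B κ : ℝ) (hB₁ : 1 < B) (hB₂ : B < 2) (hκ₀ : 0 < κ) (hκ : κ < min (B ^ 2 / 4) (1 / 2))
    (hω : HierPinning.IsHierGaussian κ P ω) :
    -- the free energies and the annealed critical point are well defined
    (∀ β : ℝ, 0 ≤ β → ∀ h : ℝ,
      (∀ n : ℕ, Integrable (HierPinning.partZ B β h ω n) P ∧
        Integrable (fun a => Real.log (HierPinning.partZ B β h ω n a)) P) ∧
      Tendsto (HierPinning.quenchedF_n B P ω β h) atTop (𝓝 (HierPinning.quenchedF B P ω β h)) ∧
      Tendsto (HierPinning.annealedF_n B P ω β h) atTop (𝓝 (HierPinning.annealedF B P ω β h)) ∧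
      (h ≤ HierPinning.annealedHc B P ω β → HierPinning.annealedF B P ω β h = 0) ∧
      (HierPinning.annealedHc B P ω β < h → 0 < HierPinning.annealedF B P ω β h)) ∧
    -- the case `B > √2`
    (√2 < B → ∃ β₀ : ℝ, 0 < β₀ ∧ ∀ η : ℝ, 0 < η → η < 1 → ∃ ε : ℝ, 0 < ε ∧
      ∀ β : ℝ, 0 ≤ β → β ≤ β₀ → ∀ u : ℝ, 0 < u → u < ε →
        (1 - η) * HierPinning.annealedF B P ω β (HierPinning.annealedHc B P ω β + u) ≤
          HierPinning.quenchedF B P ω β (HierPinning.annealedHc B P ω β + u)) ∧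
    -- the case `B < √2`
    (B < √2 → ∀ η : ℝ, 0 < η → η < 1 →
      ∃ c β₀ ε : ℝ, 0 < c ∧ 0 < β₀ ∧ 0 < ε ∧
      ∀ β : ℝ, 0 ≤ β → β ≤ β₀ →
        ∀ u : ℝ, c * β ^ (2 / (2 - HierPinning.pureNu B)) < u → u < ε →
        (1 - η) * HierPinning.annealedF B P ω β (HierPinning.annealedHc B P ω β + u) ≤
          HierPinning.quenchedF B P ω β (HierPinning.annealedHc B P ω β + u)) ∧
    -- the case `B = √2`
    (B = √2 → ∀ η : ℝ, 0 < η → η < 1 →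
      ∃ β₀ c : ℝ, 0 < β₀ ∧ 0 < c ∧
      ∀ β : ℝ, 0 < β → β ≤ β₀ →
        ∀ u : ℝ, c * Real.exp (-c * β ^ (-(2 / 3) : ℝ)) < u → u < 1 →
        (1 - η) * HierPinning.annealedF B P ω β (HierPinning.annealedHc B P ω β + u) ≤
          HierPinning.quenchedF B P ω β (HierPinning.annealedHc B P ω β + u)) := by
  have hκ2 : κ < 1 / 2 := hκ.trans_le (min_le_right _ _)
  refine ⟨fun β _ h => ⟨fun n => ⟨HierPinning.integrable_partZ hω n,
      HierPinning.integrable_log_partZ hB₁ hω n⟩,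
    (HierPinning.tendsto_quenchedF_n_and_le hB₁ hκ₀.le hκ2 hω β h).1,
    HierPinning.tendsto_annealedF_n hB₁ hκ₀.le hκ2 hω β h, fun hh => ?_, fun hh => ?_⟩,
    HierPinning.comparison_of_sqrt_two_lt hB₁ hB₂ hκ₀ hκ hω,
    fun hBs η hη hη1 => HierPinning.comparison_of_lt_sqrt_two hB₁ hB₂ hκ₀ hκ hω hBs hη hη1,
    fun hBs η hη hη1 => HierPinning.comparison_of_eq_sqrt_two hB₁ hB₂ hκ₀ hκ hω hBs hη hη1⟩
  · exact (HierPinning.annealedF_eq_zero_iff hB₁ hB₂ hκ₀.le hκ2 hω β h).2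
      ((HierPinning.le_annealedHc_iff hB₁ hB₂ hκ₀.le hκ2 hω β h).1 hh)
  · refine (HierPinning.annealedF_nonneg hB₁ hκ₀.le hκ2 hω β h).lt_of_ne' fun h0 => ?_
    exact absurd ((HierPinning.le_annealedHc_iff hB₁ hB₂ hκ₀.le hκ2 hω β h).2
      ((HierPinning.annealedF_eq_zero_iff hB₁ hB₂ hκ₀.le hκ2 hω β h).1 h0)) (not_le.2 hh)
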